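/- **Conventions.** The Fourier transforms are $\widehat f(\xi)=\int_{\mathbb R} e^{-ix\xi}f(x)\,dx$ and $\widehat F(\xi,\tau)=\iint e^{-i(x\xi+t\tau)}F(x,t)\,dx\,dt$ (extended to tempered distributions), $\langle a\rangle=\sqrt{1+a^2}$, and $$\|F\|_{X^{s,b}}=\big\|\langle\xi\rangle^s\langle\tau+\xi^2\rangle^b\,\widehat F(\xi,\tau)\big\|_{L^2_{\xi,\tau}} .$$ Let $\eta\in C^\infty(\mathbb R)$ be real-valued with $\eta=1$ on $[-1,1]$ and $\operatorname{supp}\eta\subset[-2,2]$, and put $\eta_T(t)=\eta(t/T)$. Let $\rho\in C^\infty(\mathbb R)$ be real-valued with $\rho=1$ on $[0,\infty)$ and support bounded below. Let $\chi$ be the characteristic function of $[0,\infty)$. For boundary data $g$ put $$W_0^t(0,g)(x)=\frac1\pi\int_0^\infty e^{-i\beta^2t+i\beta x}\,\beta\,\widehat{\chi g}(-\beta^2)\,d\beta+\frac1\pi\int_0^\infty e^{i\beta^2t-\beta x}\rho(\beta x)\,\beta\,\widehat{\chi g}(\beta^2)\,d\beta ,$$ where, after multiplication by $\eta_T(t)$,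 the $\beta$-integrals are understood as improper integrals converging in $L^2(\mathbb R^2_{x,t})$. For $x>0$, $t>0$ this is the solution of the linear Schrödinger equation $iu_t+u_{xx}=0$ with zero initial data and boundary data $u(0,t)=g(t)$. **Proposition.** Let $0\le b<\frac12$ and $T_0>0$. There is a constant $C>0$, depending only on $b$, $T_0$, $\eta$ and $\rho$, such that for all $0<T\le T_0$ and all tempered distributions $F$ on $\mathbb R^2$ with $\|F\|_{X^{0,-b}}<\infty$ the following holds. The time-truncated Duhamel term has a trace at $x=0$, $$q(t)=\Big[\eta_T(t)\int_0^t e^{i(t-t')\Delta}F(t')\,dt'\Big]_{x=0}\in L^2(\mathbb R_t),$$ the function $\eta_T(t)W_0^t(0,q)$ is well defined in $L^2(\mathbb R^2)$, and $$\|\eta_T\,W_0^t(0,q)\|_{X^{0,b}}\le C\,T^{1-2b}\,\|F\|_{X^{0,-b}} .$$ Here the Duhamel term at time $t$ is the function of $x$ whose spatial Fourier transform is $$\frac1{2\pi}\int_{\mathbb R}\Big(\int_0^t e^{-i(t-t')\xi^2}e^{it'\mu}\,dt'\Big)\widehat F(\xi,\mu)\,d\mu ,$$ and for each $x\in\mathbb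 R$ its value at $x$, multiplied by $\eta_T(t)$, is given by the Fourier inversion integral over $|\xi|\le R$ as $R\to\infty$, with convergence in $L^2(\mathbb R_t)$; this is part of the assertion. -/

import Mathlib

open MeasureTheory Filter Topology Set
open scoped ENNReal SchwartzMap FourierTransform ContDiff

noncomputable section

namespace SchrodingerHalfLine

/-- The space-time plane, with coordinates `(x, t)` (or `(ξ, τ)` on the Fourier side). -/
abbrev Plane : Type := WithLp 2 (ℝ × ℝ)

/-- The Japanese bracket `⟨a⟩ = √(1 + a²)`. -/
def bracket (a : ℝ) : ℝ := Real.sqrt (1 + a ^ 2)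

/-- The space-time Fourier transform of the tempered distribution `F`, in the normalisation
`F̂(ξ, τ) = ∫∫ e^{-i(xξ + tτ)} F(x, t) dx dt`, is the function `f`.
(Mathlib's transform `𝓕` has the kernel `e^{-2πi⟨·,·⟩}`, so that `𝓕 F = F̂(2π ·)`.)
Such an `f` is automatically locally integrable, hence determined by `F` almost everywhere. -/
def HasFourierFunction (F : 𝓢'(Plane, ℂ)) (f : Plane → ℂ) : Prop :=
  ∀ φ : 𝓢(Plane, ℂ),
    Integrable (fun k : Plane => φ k * f ((2 * Real.pi) • k)) ∧
      (𝓕 F) φ = ∫ k : Plane, φ k * f ((2 * Real.pi) • k)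

/-- The Bourgain norm `‖F‖_{X^{s,b}} = ‖⟨ξ⟩^s ⟨τ + ξ²⟩^b F̂(ξ, τ)‖_{L²}` of the Schrödinger flow
`e^{itΔ}`, whose space-time Fourier transform lives on `τ = -ξ²`.
It is `∞` if `F̂` is not a function. -/
def xNorm (s b : ℝ) (F : 𝓢'(Plane, ℂ)) : ℝ≥0∞ :=
  ⨅ (f : Plane → ℂ) (_ : HasFourierFunction F f),
    eLpNorm (fun k : Plane =>
      ((bracket k.fst ^ s * bracket (k.snd + k.fst ^ 2) ^ b : ℝ) : ℂ) * f k) 2 volume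

/-- The spatial Fourier transform at `ξ` of the Duhamel term `∫₀ᵗ e^{i(t-t')Δ} F(t') dt'`, where
`f = F̂`: since `e^{i(t-t')Δ}` multiplies by `e^{-i(t-t')ξ²}` and the spatial transform of `F(t')`
is `(2π)⁻¹ ∫ e^{it'μ} f(ξ, μ) dμ`, the plane wave of frequency `(ξ, μ)` contributes
`∫₀ᵗ e^{-i(t-t')ξ²} e^{it'μ} dt'`. -/
def duhamelFourier (f : Plane → ℂ) (ξ t : ℝ) : ℂ :=
  ((2 * Real.pi : ℝ) : ℂ)⁻¹ *
    ∫ μ : ℝ, (∫ t' in (0 : ℝ)..t,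
        Complex.exp (-Complex.I * ((t - t') * ξ ^ 2 : ℝ)) * Complex.exp (Complex.I * (t' * μ : ℝ))) *
      f (WithLp.toLp 2 (ξ, μ))

/-- The time-truncated Duhamel term `η_T(t) ∫₀ᵗ e^{i(t-t')Δ} F(t') dt'` at the point `x`, with the
spatial frequencies restricted to `|ξ| ≤ R`; here `η_T(t) = η(t / T)`. -/
def duhamelPartial (η : ℝ → ℝ) (T : ℝ) (f : Plane → ℂ) (R x t : ℝ) : ℂ :=
  (η (t / T) : ℂ) * (((2 * Real.pi : ℝ) : ℂ)⁻¹ *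
    ∫ ξ in (-R)..R, Complex.exp (Complex.I * (x * ξ : ℝ)) * duhamelFourier f ξ t)

/-- `w x`, as a function of `t`, is the time-truncated Duhamel term
`η_T(t) ∫₀ᵗ e^{i(t-t')Δ} F(t') dt'` at the point `x`, for every `x`: the spatial Fourier inversion
integral is an improper integral that converges in `L²(ℝ_t)` at each point `x`. The trace at
`x = 0` is `w 0`. -/
def IsTruncatedDuhamel (η : ℝ → ℝ) (T : ℝ) (F : 𝓢'(Plane, ℂ))
    (w : ℝ → Lp ℂ 2 (volume : Measure ℝ)) : Prop :=
  ∃ f : Plane → ℂ, HasFourierFunction F f ∧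
    ∀ x : ℝ, Tendsto (fun R : ℝ =>
      eLpNorm (fun t : ℝ => w x t - duhamelPartial η T f R x t) 2 volume) atTop (𝓝 0)

/-- The Fourier transform of `χ g`, with `χ` the characteristic function of `[0, ∞)`. -/
def boundaryFourier (g : ℝ → ℂ) (τ : ℝ) : ℂ :=
  ∫ t in Ici (0 : ℝ), Complex.exp (-Complex.I * (t * τ : ℝ)) * g t

/-- The integral over `0 ≤ β ≤ R` in the formula
`W₀ᵗ(0, g)(x) = π⁻¹ ∫₀^∞ e^{-iβ²t + iβx} β (χg)^(-β²) dβ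
  + π⁻¹ ∫₀^∞ e^{iβ²t - βx} ρ(βx) β (χg)^(β²) dβ`
for the solution of the Schrödinger equation on the half line with zero initial data and boundary
data `g`, extended to `x < 0` by means of the cut-off `ρ`. -/
def boundaryFlowPartial (ρ : ℝ → ℝ) (g : ℝ → ℂ) (R x t : ℝ) : ℂ :=
  ((Real.pi : ℝ) : ℂ)⁻¹ *
      (∫ β in (0 : ℝ)..R, Complex.exp (Complex.I * (-(β ^ 2 * t) + β * x : ℝ)) *
        ((β : ℂ) * boundaryFourier g (-β ^ 2))) +
    ((Real.pi : ℝ) : ℂ)⁻¹ *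
      ∫ β in (0 : ℝ)..R, Complex.exp (Complex.I * (β ^ 2 * t : ℝ)) *
        ((Real.exp (-(β * x)) * ρ (β * x) : ℝ) : ℂ) * ((β : ℂ) * boundaryFourier g (β ^ 2))

/-- `u = η_T(t) W₀ᵗ(0, g)` on the space-time plane, the integrals over `β` being improper integrals
that converge in `L²(ℝ²)` after multiplication by `η_T(t) = η(t / T)`. -/
def IsTruncatedBoundaryFlow (η ρ : ℝ → ℝ) (T : ℝ) (g : ℝ → ℂ)
    (u : Lp ℂ 2 (volume : Measure Plane)) : Prop :=
  Tendsto (fun R : ℝ => eLpNorm (fun p : Plane =>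
    u p - (η (p.snd / T) : ℂ) * boundaryFlowPartial ρ g R p.fst p.snd) 2 volume) atTop (𝓝 0)

end SchrodingerHalfLine

end

open SchrodingerHalfLine

/-!
The estimate factors through the energy of the boundary data
`dataEnergy r p = ∫ (1 + r|β|)² |p(β)|² dβ`, with `r = √T` and `p(β) = (χq)^(±β²)`: the trace `q`
has finite energy, and finite energy is all that the boundary flow needs. In the variable
`τ = ±β²` this is the square of an `H^{1/4}` norm of `χq`, with more weight at low frequencies and
adapted to the parabolic length scale `r` of the time interval.

*From `F` to the boundary.* The amplitude `F̂(ξ, μ)` with modulation `σ = μ + ξ²` contributes to the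
Duhamel term at `x = 0` the free wave `e^{-itξ²}` times `∫₀ᵗ e^{it'σ} dt'`. The Fourier transform in
time of this product, cut off by `η_T` and by `[0, ∞)`, decays both in the frequency `λ` relative
to the free wave and in `λ - σ`: the Duhamel factor vanishes at `t = 0`, so an integration by parts
costs no boundary term there (`exists_norm_duhamelMultiplier_le`). The trace is therefore an
integral operator applied to `⟨σ⟩^{-b} F̂`, whose kernel (`traceKernel`) satisfies a weighted Schur test with
the weight `1 + r|β|` on the boundary side precisely because `b < 1/2`
(`lintegral_sq_traceKernel_le`). This bounds the trace of every frequency-truncated Duhamel term,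
shows that the truncations converge in `L²` of time (`exists_isTruncatedDuhamel`), and by Fatou's
lemma gives `dataEnergy ≤ C T^{2-2b} ‖F‖²_{X^{0,-b}}` for the limit
(`exists_dataEnergy_boundaryFourier_le`).

*From the boundary to the flow.* The truncated boundary flow has an explicit space-time Fourier
transform, with `n` and `κ` the Fourier transforms of `η` and of the Schwartz function
`e^{-y} ρ(y)`: the oscillating part is `2ξ p(ξ) T n(T(τ + ξ²))` for `ξ > 0`, and the evanescent part
is `π⁻¹ ∫ T n(T(τ - β²)) κ(ξ/β) p(β) dβ`. On the first the weight `⟨τ + ξ²⟩^b` is absorbed by the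
decay of `n`. On the second `1 + T|τ + ξ²|` is at most
`(1 + T|τ - β²|) (1 + r|β|)² (1 + |ξ/β|)²`, and as `2b < 1` the power `b` of the middle factor is
absorbed by the weight of the data; a Schur test in `(ξ, τ)` and `β` then finishes. Both parts
are bounded in `X^{0,b}` by `C T^{-2b}` times the energy (`flowEnergy_flowFourier_le`). The same
bound applied to the tail `β > R` shows that the improper integrals over `β` converge
(`exists_isTruncatedBoundaryFlow`).

Multiplying the two bounds gives `T^{2-4b}`, the square of the factor `T^{1-2b}`.
-/

noncomputable section

namespace SchrodingerHalfLine

/-! ### A weighted Schur test -/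

/-- The Cauchy–Schwarz inequality for lower Lebesgue integrals, in squared form. -/
lemma sq_lintegral_mul_le {β : Type*} [MeasurableSpace β] {ν : Measure β} {f g : β → ℝ≥0∞}
    (hf : AEMeasurable f ν) (hg : AEMeasurable g ν) :
    (∫⁻ y, f y * g y ∂ν) ^ 2 ≤ (∫⁻ y, f y ^ 2 ∂ν) * ∫⁻ y, g y ^ 2 ∂ν := by
  have h := ENNReal.lintegral_mul_le_Lp_mul_Lq ν Real.HolderConjugate.two_two hf hg
  have h2 := pow_le_pow_left' h 2
  refine h2.trans (le_of_eq ?_)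
  rw [mul_pow, ← ENNReal.rpow_natCast, ← ENNReal.rpow_natCast, ← ENNReal.rpow_mul,
    ← ENNReal.rpow_mul]
  norm_num

/-- Schur's test for a kernel that is dominated by a product `a * c`, where `a` is square-integrable
in the second variable and `c` is square-integrable in the first, both uniformly. -/
lemma lintegral_sq_lintegral_le {α β : Type*} [MeasurableSpace α] [MeasurableSpace β]
    {μ : Measure α} {ν : Measure β} [SFinite μ] [SFinite ν]
    {k a c : α → β → ℝ≥0∞} {h : β → ℝ≥0∞} {A B : ℝ≥0∞}
    (ha : Measurable (Function.uncurry a)) (hc : Measurable (Function.uncurry c))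
    (hh : Measurable h) (hk : ∀ x y, k x y ≤ a x y * c x y)
    (hA : ∀ x, ∫⁻ y, a x y ^ 2 ∂ν ≤ A) (hB : ∀ᵐ y ∂ν, ∫⁻ x, c x y ^ 2 ∂μ ≤ B) :
    ∫⁻ x, (∫⁻ y, k x y * h y ∂ν) ^ 2 ∂μ ≤ A * B * ∫⁻ y, h y ^ 2 ∂ν := by
  have hc2 : Measurable (Function.uncurry fun x y => (c x y * h y) ^ 2) :=
    (hc.mul (hh.comp measurable_snd)).pow_const 2
  calc ∫⁻ x, (∫⁻ y, k x y * h y ∂ν) ^ 2 ∂μ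
      ≤ ∫⁻ x, A * ∫⁻ y, (c x y * h y) ^ 2 ∂ν ∂μ := by
        refine lintegral_mono fun x => ?_
        calc (∫⁻ y, k x y * h y ∂ν) ^ 2
            ≤ (∫⁻ y, a x y * (c x y * h y) ∂ν) ^ 2 := by
              refine pow_le_pow_left' (lintegral_mono fun y => ?_) 2
              rw [← mul_assoc]
              exact mul_le_mul_left (hk x y) _
          _ ≤ (∫⁻ y, a x y ^ 2 ∂ν) * ∫⁻ y, (c x y * h y) ^ 2 ∂ν :=
              sq_lintegral_mul_le (ha.comp measurable_prodMk_left).aemeasurable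
                ((hc.comp measurable_prodMk_left).mul hh).aemeasurable
          _ ≤ _ := mul_le_mul_left (hA x) _
    _ = A * ∫⁻ y, ∫⁻ x, (c x y * h y) ^ 2 ∂μ ∂ν := by
        have hm : Measurable fun x => ∫⁻ y, (c x y * h y) ^ 2 ∂ν := hc2.lintegral_prod_right'
        rw [lintegral_const_mul _ hm, lintegral_lintegral_swap]
        exact hc2.aemeasurable
    _ ≤ A * ∫⁻ y, B * h y ^ 2 ∂ν := by
        refine mul_le_mul_right (lintegral_mono_ae ?_) _
        filter_upwards [hB] with y hy
        simp_rw [mul_pow]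
        have hm : Measurable fun x => c x y ^ 2 :=
          (hc.comp measurable_prodMk_right).pow_const 2
        rw [lintegral_mul_const _ hm]
        exact mul_le_mul_left hy _
    _ = A * B * ∫⁻ y, h y ^ 2 ∂ν := by
        rw [lintegral_const_mul _ (hh.pow_const 2), mul_assoc]

/-! ### Integrals of powers of brackets -/

/-- The weight `1 + |a|`, equivalent to the Japanese bracket `⟨a⟩`, but submultiplicative without a
constant. -/
def japanese (a : ℝ) : ℝ := 1 + |a|

lemma one_le_japanese (a : ℝ) : 1 ≤ japanese a := by
  unfold japanese; linarith [abs_nonneg a]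

lemma japanese_pos (a : ℝ) : 0 < japanese a := one_pos.trans_le (one_le_japanese a)

@[fun_prop]
lemma continuous_japanese : Continuous japanese := by unfold japanese; fun_prop

@[fun_prop]
lemma measurable_japanese : Measurable japanese := continuous_japanese.measurable

lemma japanese_neg (a : ℝ) : japanese (-a) = japanese a := by simp [japanese]

lemma japanese_sub_comm (a c : ℝ) : japanese (a - c) = japanese (c - a) := by
  rw [← japanese_neg, neg_sub]

lemma japanese_add_le_mul (a c : ℝ) : japanese (a + c) ≤ japanese a * japanese c := by
  unfold japanese
  nlinarith [abs_add_le a c, abs_nonneg a, abs_nonneg c, mul_nonneg (abs_nonneg a) (abs_nonneg c)]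

lemma japanese_add_le_add (a c : ℝ) : japanese (a + c) ≤ japanese a + japanese c := by
  unfold japanese; linarith [abs_add_le a c]

lemma bracket_pos (a : ℝ) : 0 < bracket a := Real.sqrt_pos.mpr (by positivity)

lemma bracket_le_japanese (a : ℝ) : bracket a ≤ japanese a := by
  unfold bracket japanese
  rw [Real.sqrt_le_left (by positivity)]
  nlinarith [sq_abs a, abs_nonneg a]

lemma one_le_bracket (a : ℝ) : 1 ≤ bracket a := by
  unfold bracket
  rw [Real.one_le_sqrt]
  nlinarith [sq_nonneg a]

@[fun_prop]
lemma continuous_bracket : Continuous bracket := by unfold bracket; fun_prop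

/-- `∫ (1 + |y|)^{-p} dy`, finite for `p > 1`. -/
def japaneseIntegral (p : ℝ) : ℝ≥0∞ := ∫⁻ y : ℝ, ENNReal.ofReal (japanese y ^ (-p))

lemma japaneseIntegral_lt_top {p : ℝ} (hp : 1 < p) : japaneseIntegral p < ⊤ := by
  have := finite_integral_one_add_norm (E := ℝ) (μ := volume) (r := p) (by simpa using hp)
  simpa [japaneseIntegral, japanese] using this

lemma lintegral_comp_mul_left {r : ℝ} (hr : 0 < r) (f : ℝ → ℝ≥0∞) :
    ∫⁻ y, f (r * y) = ENNReal.ofReal r⁻¹ * ∫⁻ y, f y := by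
  have he : MeasurableEmbedding fun y : ℝ => r * y :=
    (MeasurableEquiv.mulLeft₀ r hr.ne').measurableEmbedding
  have h := he.lintegral_map (μ := volume) f
  rw [Real.map_volume_mul_left hr.ne', lintegral_smul_measure, abs_of_pos (inv_pos.mpr hr)] at h
  exact h.symm

lemma lintegral_japanese_sub {p : ℝ} (c : ℝ) :
    ∫⁻ y : ℝ, ENNReal.ofReal (japanese (c - y) ^ (-p)) = japaneseIntegral p :=
  lintegral_sub_left_eq_self (fun y => ENNReal.ofReal (japanese y ^ (-p))) c

/-- The substitution `y = ξ²` in integrals of even functions. -/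
lemma lintegral_abs_mul_comp_sq (G : ℝ → ℝ≥0∞) :
    ∫⁻ ξ : ℝ, ENNReal.ofReal |ξ| * G (ξ ^ 2) = ∫⁻ y in Ioi (0 : ℝ), G y := by
  have himage : (fun x : ℝ => x ^ 2) '' Ioi 0 = Ioi 0 := by
    ext y
    constructor
    · rintro ⟨x, hx, rfl⟩
      exact pow_pos (mem_Ioi.mp hx) 2
    · intro hy
      exact ⟨√y, Real.sqrt_pos.mpr hy, Real.sq_sqrt (le_of_lt hy)⟩
  have h1 := lintegral_image_eq_lintegral_abs_deriv_mul (s := Ioi (0 : ℝ)) (f := fun x => x ^ 2)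
    (f' := fun x => 2 * x) measurableSet_Ioi
    (fun x _ => by simpa using (hasDerivAt_pow 2 x).hasDerivWithinAt)
    (fun x hx y hy hxy => by
      exact (pow_left_inj₀ (le_of_lt hx) (le_of_lt hy) two_ne_zero).mp hxy) G
  rw [himage] at h1
  set g : ℝ → ℝ≥0∞ := fun ξ => ENNReal.ofReal |ξ| * G (ξ ^ 2) with hg
  have hneg : ∫⁻ ξ in Iio (0 : ℝ), g ξ = ∫⁻ ξ in Ioi (0 : ℝ), g ξ := by
    have hmp : MeasurePreserving (fun x : ℝ => -x) volume volume :=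
      Measure.measurePreserving_neg volume
    have := hmp.setLIntegral_comp_preimage_emb (MeasurableEquiv.neg ℝ).measurableEmbedding g (Ioi 0)
    rw [← this]
    simp [hg]
  have hsplit : ∫⁻ ξ, g ξ = (∫⁻ ξ in Iio (0 : ℝ), g ξ) + ∫⁻ ξ in Ioi (0 : ℝ), g ξ := by
    rw [← lintegral_add_compl g (measurableSet_Iio (a := (0 : ℝ)))]
    congr 1
    rw [compl_Iio]
    exact setLIntegral_congr Ioi_ae_eq_Ici.symm
  rw [hsplit, hneg, h1, ← two_mul, ← lintegral_const_mul' _ _ (by simp)]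
  refine lintegral_congr fun ξ => ?_
  rw [hg, abs_mul, ENNReal.ofReal_mul (by positivity)]
  simp [mul_assoc]

/-- Integration over the line through the two half lines, parametrised by `±ξ²`. -/
lemma lintegral_eq_lintegral_abs_mul_comp_sq (G : ℝ → ℝ≥0∞) :
    ∫⁻ y, G y = (∫⁻ ξ : ℝ, ENNReal.ofReal |ξ| * G (ξ ^ 2)) +
      ∫⁻ ξ : ℝ, ENNReal.ofReal |ξ| * G (-ξ ^ 2) := by
  rw [lintegral_abs_mul_comp_sq G, lintegral_abs_mul_comp_sq fun y => G (-y),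
    ← lintegral_add_compl G (measurableSet_Ioi (a := (0 : ℝ)))]
  congr 1
  have hmp : MeasurePreserving (fun x : ℝ => -x) volume volume :=
    Measure.measurePreserving_neg volume
  have := hmp.setLIntegral_comp_preimage_emb (MeasurableEquiv.neg ℝ).measurableEmbedding G (Iio 0)
  rw [compl_Ioi, setLIntegral_congr Iio_ae_eq_Iic.symm, ← this]
  simp

lemma lintegral_abs_mul_japanese_sq_sub_le (p c : ℝ) :
    ∫⁻ ξ : ℝ, ENNReal.ofReal (|ξ| * japanese (ξ ^ 2 - c) ^ (-p)) ≤ japaneseIntegral p := by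
  simp_rw [ENNReal.ofReal_mul (abs_nonneg _)]
  rw [lintegral_abs_mul_comp_sq fun y => ENNReal.ofReal (japanese (y - c) ^ (-p)),
    ← lintegral_japanese_sub c]
  simp_rw [japanese_sub_comm c]
  exact setLIntegral_le_lintegral _ _

/-- The bound for `∫ (1 + |ξ² - c|)^{1/2 - p} dξ` below, uniform in `c`. -/
def quadraticIntegralBound (p : ℝ) : ℝ≥0∞ := 2 + 4 * japaneseIntegral p

lemma quadraticIntegralBound_lt_top {p : ℝ} (hp : 1 < p) : quadraticIntegralBound p < ⊤ := by
  have := japaneseIntegral_lt_top hp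
  unfold quadraticIntegralBound
  finiteness

/-- A product of powers of two weights is at most the sum of the corresponding pure powers, by
replacing the larger weight with the smaller one. -/
lemma rpow_half_sub_mul_le {x y p : ℝ} (hx : 1 ≤ x) (hy : 1 ≤ y) (hp : 1 / 2 ≤ p) :
    x ^ (1 / 2 - p) * y ^ (-(1 / 2) : ℝ) ≤ x ^ (-p) + y ^ (-p) := by
  have hx0 : 0 < x := by linarith
  have hy0 : 0 < y := by linarith
  rcases le_total x y with h | h
  · calc x ^ (1 / 2 - p) * y ^ (-(1 / 2) : ℝ)
        ≤ x ^ (1 / 2 - p) * x ^ (-(1 / 2) : ℝ) := by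
          gcongr ?_ * ?_
          exact Real.rpow_le_rpow_of_nonpos hx0 h (by norm_num)
      _ = x ^ (-p) := by rw [← Real.rpow_add hx0]; ring_nf
      _ ≤ _ := by linarith [Real.rpow_pos_of_pos hy0 (-p)]
  · calc x ^ (1 / 2 - p) * y ^ (-(1 / 2) : ℝ)
        ≤ y ^ (1 / 2 - p) * y ^ (-(1 / 2) : ℝ) := by
          gcongr ?_ * ?_
          exact Real.rpow_le_rpow_of_nonpos hy0 h (by linarith)
      _ = y ^ (-p) := by rw [← Real.rpow_add hy0]; ring_nf
      _ ≤ _ := by linarith [Real.rpow_pos_of_pos hx0 (-p)]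

/-- Away from the origin the density `|ξ|⁻¹` of the substitution `y = ξ²` is at most
`2 (1 + |y|)^{-1/2}`, and supplies the missing half power of decay. -/
lemma lintegral_japanese_sq_sub_le {p : ℝ} (hp : 1 / 2 ≤ p) (c : ℝ) :
    ∫⁻ ξ : ℝ, ENNReal.ofReal (japanese (ξ ^ 2 - c) ^ (1 / 2 - p)) ≤ quadraticIntegralBound p := by
  have hpt : ∀ ξ : ℝ, ENNReal.ofReal (japanese (ξ ^ 2 - c) ^ (1 / 2 - p)) ≤
      (Icc (-1 : ℝ) 1).indicator 1 ξ +
        (2 * ENNReal.ofReal (|ξ| * japanese (ξ ^ 2 - c) ^ (-p)) +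
          2 * ENNReal.ofReal (|ξ| * japanese (ξ ^ 2 - 0) ^ (-p))) := by
    intro ξ
    by_cases hξ : ξ ∈ Icc (-1 : ℝ) 1
    · rw [indicator_of_mem hξ]
      refine le_add_right ?_
      simp only [Pi.one_apply, ENNReal.ofReal_le_one]
      exact Real.rpow_le_one_of_one_le_of_nonpos (one_le_japanese _) (by linarith)
    · refine le_add_left ?_
      have hξ1 : 1 ≤ |ξ| := by
        by_contra! h
        exact hξ (abs_le.mp h.le)
      rw [← mul_add, ← ENNReal.ofReal_add
        (mul_nonneg (abs_nonneg _) (Real.rpow_nonneg (japanese_pos _).le _))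
        (mul_nonneg (abs_nonneg _) (Real.rpow_nonneg (japanese_pos _).le _)),
        show (2 : ℝ≥0∞) = ENNReal.ofReal 2 by simp, ← ENNReal.ofReal_mul (by norm_num)]
      refine ENNReal.ofReal_le_ofReal ?_
      rw [sub_zero]
      -- `(1 + ξ²)^{-1/2} |ξ|` is bounded below, which makes room for the factor `|ξ|` in the
      -- substitution `y = ξ²`
      have hj : japanese (ξ ^ 2) ^ (1 / 2 : ℝ) ≤ 2 * |ξ| := by
        rw [← Real.sqrt_eq_rpow, Real.sqrt_le_left (by positivity)]
        have : |ξ ^ 2| = |ξ| ^ 2 := by rw [abs_pow]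
        unfold japanese
        rw [this]
        nlinarith
      have h0 := Real.rpow_pos_of_pos (japanese_pos (ξ ^ 2 - c)) (1 / 2 - p)
      have h1 := rpow_half_sub_mul_le (one_le_japanese (ξ ^ 2 - c)) (one_le_japanese (ξ ^ 2)) hp
      have h2 : japanese (ξ ^ 2) ^ (-(1 / 2) : ℝ) * japanese (ξ ^ 2) ^ (1 / 2 : ℝ) = 1 := by
        rw [← Real.rpow_add (japanese_pos _)]; norm_num
      have h3 := Real.rpow_pos_of_pos (japanese_pos (ξ ^ 2)) (-(1 / 2) : ℝ)
      calc japanese (ξ ^ 2 - c) ^ (1 / 2 - p)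
          = japanese (ξ ^ 2 - c) ^ (1 / 2 - p) * japanese (ξ ^ 2) ^ (-(1 / 2) : ℝ) *
            japanese (ξ ^ 2) ^ (1 / 2 : ℝ) := by rw [mul_assoc, h2, mul_one]
        _ ≤ (japanese (ξ ^ 2 - c) ^ (-p) + japanese (ξ ^ 2) ^ (-p)) * (2 * |ξ|) := by
            apply mul_le_mul h1 hj (Real.rpow_nonneg (japanese_pos _).le _)
            exact (mul_pos h0 h3).le.trans h1
        _ = _ := by ring
  have hm : ∀ c : ℝ, Measurable fun ξ : ℝ =>
      ENNReal.ofReal (|ξ| * japanese (ξ ^ 2 - c) ^ (-p)) := fun c => by fun_prop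
  refine (lintegral_mono hpt).trans ?_
  rw [lintegral_add_left (measurable_one.indicator measurableSet_Icc),
    lintegral_add_left ((hm c).const_mul 2), lintegral_const_mul _ (hm c),
    lintegral_const_mul _ (hm 0), lintegral_indicator_one measurableSet_Icc]
  have h1 := lintegral_abs_mul_japanese_sq_sub_le p c
  have h2 := lintegral_abs_mul_japanese_sq_sub_le p 0
  calc _ ≤ ENNReal.ofReal (1 - -1) + (2 * japaneseIntegral p + 2 * japaneseIntegral p) := by
        rw [Real.volume_Icc]; gcongr
    _ = quadraticIntegralBound p := by
        unfold quadraticIntegralBound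
        rw [← add_mul]; norm_num

/-! ### The kernel of the boundary trace -/

/-- The bound for `∫ (1 + |β|) (1 + |sβ² + c|)^{-p} dβ` and for
`(1 + |β|) ∫ (1 + |sβ² + ξ²|)^{-p} dξ`, where `s = ±1`. -/
def traceIntegralBound (p : ℝ) : ℝ≥0∞ := japaneseIntegral p + 2 * quadraticIntegralBound p

lemma traceIntegralBound_lt_top {p : ℝ} (hp : 1 < p) : traceIntegralBound p < ⊤ := by
  have := japaneseIntegral_lt_top hp
  have := quadraticIntegralBound_lt_top hp
  unfold traceIntegralBound
  finiteness

lemma lintegral_le_traceIntegralBound {p : ℝ} (hp : 1 ≤ p) (c : ℝ) {g : ℝ → ℝ}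
    (hg : ∀ ξ, g ξ ≤ |ξ| * japanese (ξ ^ 2 - c) ^ (-p) +
      2 * japanese (ξ ^ 2 - c) ^ (1 / 2 - p)) :
    ∫⁻ ξ : ℝ, ENNReal.ofReal (g ξ) ≤ traceIntegralBound p := by
  have hm : Measurable fun ξ : ℝ => ENNReal.ofReal (|ξ| * japanese (ξ ^ 2 - c) ^ (-p)) := by
    fun_prop
  have hm2 : Measurable fun ξ : ℝ => ENNReal.ofReal (japanese (ξ ^ 2 - c) ^ (1 / 2 - p)) := by
    fun_prop
  calc ∫⁻ ξ : ℝ, ENNReal.ofReal (g ξ)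
      ≤ ∫⁻ ξ : ℝ, (ENNReal.ofReal (|ξ| * japanese (ξ ^ 2 - c) ^ (-p)) +
          2 * ENNReal.ofReal (japanese (ξ ^ 2 - c) ^ (1 / 2 - p))) := by
        refine lintegral_mono fun ξ => (ENNReal.ofReal_le_ofReal (hg ξ)).trans (le_of_eq ?_)
        have h0 := Real.rpow_nonneg (japanese_pos (ξ ^ 2 - c)).le (-p)
        have h1 := Real.rpow_nonneg (japanese_pos (ξ ^ 2 - c)).le (1 / 2 - p)
        rw [ENNReal.ofReal_add (by positivity) (by positivity), ENNReal.ofReal_mul (by norm_num)]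
        simp
    _ ≤ _ := by
        rw [lintegral_add_left hm, lintegral_const_mul _ hm2]
        exact add_le_add (lintegral_abs_mul_japanese_sq_sub_le p c)
          (mul_le_mul_right (lintegral_japanese_sq_sub_le (by linarith) c) _)

lemma lintegral_japanese_mul_right_le {p s : ℝ} (hp : 1 ≤ p) (hs : |s| = 1) (B : ℝ) :
    ∫⁻ ξ : ℝ, ENNReal.ofReal (japanese B * japanese (s * B ^ 2 + ξ ^ 2) ^ (-p)) ≤
      traceIntegralBound p := by
  refine lintegral_le_traceIntegralBound hp (-(s * B ^ 2)) fun ξ => ?_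
  rw [sub_neg_eq_add, add_comm (ξ ^ 2)]
  set x := japanese (s * B ^ 2 + ξ ^ 2) with hx
  have hx1 : 1 ≤ x := one_le_japanese _
  have hx0 : 0 < x := by linarith
  have hs1 : 1 ≤ √x := Real.one_le_sqrt.mpr hx1
  have hsq : √x ^ 2 = x := Real.sq_sqrt hx0.le
  have hB : |B| ≤ |ξ| + √x := by
    refine abs_le_of_sq_le_sq' ?_ (by positivity) |> fun h => abs_le.mpr h
    have h1 : B ^ 2 = |s * B ^ 2| := by rw [abs_mul, hs, one_mul, abs_of_nonneg (sq_nonneg B)]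
    have h2 : |s * B ^ 2| ≤ |s * B ^ 2 + ξ ^ 2| + ξ ^ 2 := by
      have := abs_sub_abs_le_abs_sub (s * B ^ 2) (-(ξ ^ 2))
      rw [abs_neg, abs_of_nonneg (sq_nonneg ξ), sub_neg_eq_add] at this
      linarith
    have h3 : |s * B ^ 2 + ξ ^ 2| ≤ x := by rw [hx]; unfold japanese; linarith
    nlinarith [sq_abs ξ, abs_nonneg ξ]
  have hj : japanese B ≤ |ξ| + 2 * x ^ (1 / 2 : ℝ) := by
    rw [← Real.sqrt_eq_rpow]; unfold japanese; linarith
  calc japanese B * x ^ (-p) ≤ (|ξ| + 2 * x ^ (1 / 2 : ℝ)) * x ^ (-p) := by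
        gcongr
    _ = _ := by
        rw [add_mul, mul_assoc 2, ← Real.rpow_add hx0]
        ring_nf

lemma lintegral_japanese_mul_left_le {p s : ℝ} (hp : 1 ≤ p) (hs : |s| = 1) (c : ℝ) :
    ∫⁻ β : ℝ, ENNReal.ofReal (japanese β * japanese (s * β ^ 2 + c) ^ (-p)) ≤
      traceIntegralBound p := by
  refine lintegral_le_traceIntegralBound hp (-(s * c)) fun β => ?_
  have hss : s * s = 1 := by rw [← abs_mul_abs_self, hs, one_mul]
  have hj : japanese (β ^ 2 - -(s * c)) = japanese (s * β ^ 2 + c) := by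
    unfold japanese
    rw [show s * β ^ 2 + c = s * (β ^ 2 - -(s * c)) by linear_combination (-c) * hss, abs_mul, hs,
      one_mul]
  rw [hj]
  set x := japanese (s * β ^ 2 + c) with hx
  have hx1 : 1 ≤ x := one_le_japanese _
  have hx0 : 0 < x := by linarith
  have h1 : x ^ (-p) ≤ x ^ (1 / 2 - p) := Real.rpow_le_rpow_of_exponent_le hx1 (by linarith)
  have h2 : 0 < x ^ (1 / 2 - p) := Real.rpow_pos_of_pos hx0 _
  unfold japanese
  linarith [add_mul 1 |β| (x ^ (-p))]

/-- Here `x` and `y` are the weights of the distances of a frequency to two points, and `x + y`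
bounds that of the distance between the points. For `d > 0`, that is for `b < 1/2`, what is left of
the decay is more than integrable. -/
lemma rpow_add_mul_rpow_mul_rpow_le {x y d : ℝ} (hx : 1 ≤ x) (hy : 1 ≤ y) (hd : 0 < d)
    (hd1 : d ≤ 1 / 4) :
    (x + y) ^ (1 - 4 * d) * (x ^ (d - 1) * y ^ (d - 1)) ≤
      2 * (x ^ (-(1 + 2 * d)) + y ^ (-(1 + 2 * d))) := by
  wlog h : x ≤ y generalizing x y
  · have := this hy hx (le_of_not_ge h)
    rw [add_comm x, mul_comm (x ^ _), add_comm (x ^ _)]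
    exact this
  have hx0 : 0 < x := by linarith
  have hy0 : 0 < y := by linarith
  have h1 : (x + y) ^ (1 - 4 * d) ≤ 2 * y ^ (1 - 4 * d) := by
    calc (x + y) ^ (1 - 4 * d) ≤ (2 * y) ^ (1 - 4 * d) :=
          Real.rpow_le_rpow (by linarith) (by linarith) (by linarith)
      _ = 2 ^ (1 - 4 * d) * y ^ (1 - 4 * d) := Real.mul_rpow (by norm_num) hy0.le
      _ ≤ 2 * y ^ (1 - 4 * d) := by
          gcongr
          calc (2 : ℝ) ^ (1 - 4 * d) ≤ 2 ^ (1 : ℝ) :=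
                Real.rpow_le_rpow_of_exponent_le (by norm_num) (by linarith)
            _ = 2 := Real.rpow_one 2
  calc (x + y) ^ (1 - 4 * d) * (x ^ (d - 1) * y ^ (d - 1))
      ≤ 2 * y ^ (1 - 4 * d) * (x ^ (d - 1) * y ^ (d - 1)) := by gcongr
    _ = 2 * (x ^ (d - 1) * y ^ (-(3 * d))) := by
        rw [show -(3 * d) = (1 - 4 * d) + (d - 1) by ring, Real.rpow_add hy0]; ring
    _ ≤ 2 * (x ^ (d - 1) * x ^ (-(3 * d))) := by
        gcongr 2 * (_ * ?_)
        exact Real.rpow_le_rpow_of_nonpos hx0 h (by linarith)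
    _ = 2 * x ^ (-(1 + 2 * d)) := by
        rw [← Real.rpow_add hx0]; ring_nf
    _ ≤ _ := by
        have := Real.rpow_pos_of_pos hy0 (-(1 + 2 * d))
        linarith

/-- The kernel dominating the time Fourier transform, at the (rescaled) frequency `θ`, of the
truncated Duhamel term of the plane wave with frequency `z = (ξ, μ)`, weighted by
`⟨μ + ξ²⟩^b`. Frequencies are rescaled according to the time `T = r²`. -/
def traceKernel (r b θ : ℝ) (z : ℝ × ℝ) : ℝ :=
  japanese (r ^ 2 * z.2 + (r * z.1) ^ 2) ^ b *
    ((japanese (θ + (r * z.1) ^ 2))⁻¹ * (japanese (θ - r ^ 2 * z.2))⁻¹)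

lemma traceKernel_nonneg (r b θ : ℝ) (z : ℝ × ℝ) : 0 ≤ traceKernel r b θ z :=
  mul_nonneg (Real.rpow_nonneg (japanese_pos _).le _)
    (mul_nonneg (inv_nonneg.mpr (japanese_pos _).le) (inv_nonneg.mpr (japanese_pos _).le))

/-- The constant of the trace estimate, for `b = (1 - 4d) / 2`. -/
def traceConstant (d : ℝ) : ℝ≥0∞ :=
  (traceIntegralBound (1 + d) * japaneseIntegral (1 + d)) * (4 * traceIntegralBound (1 + 2 * d))

lemma traceConstant_lt_top {d : ℝ} (hd : 0 < d) : traceConstant d < ⊤ := by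
  have := traceIntegralBound_lt_top (p := 1 + d) (by linarith)
  have := traceIntegralBound_lt_top (p := 1 + 2 * d) (by linarith)
  have := japaneseIntegral_lt_top (p := 1 + d) (by linarith)
  unfold traceConstant
  finiteness

/-- The kernel of the boundary trace, in the variable `β` with `τ = ±β²`, maps `L²` of the
space-time frequencies to `L²` with the weight `(1 + r|β|)²`. The condition `b < 1/2` is what allows
the kernel to be shared between the two halves of Schur's test. -/
lemma lintegral_sq_traceKernel_le {r b d s : ℝ} (hr : 0 < r) (hd : 0 < d) (hd1 : d ≤ 1 / 4)
    (hb : 2 * b = 1 - 4 * d) (hs : |s| = 1) {h : ℝ × ℝ → ℝ≥0∞} (hh : Measurable h) :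
    ∫⁻ β : ℝ, (∫⁻ z, ENNReal.ofReal (japanese (r * β) * traceKernel r b (s * (r * β) ^ 2) z) *
      h z) ^ 2 ≤ traceConstant d * ENNReal.ofReal (r ^ 4)⁻¹ * ∫⁻ z, h z ^ 2 := by
  -- the decay is split into `-(1 + d)/2`, which is square-integrable in `z` for fixed `β`, and
  -- `-(1 - d)/2`, which has to absorb the growing weight of exponent `b` for fixed `z`
  set a : ℝ → ℝ × ℝ → ℝ≥0∞ := fun β z => ENNReal.ofReal
    (japanese (r * β) ^ (1 / 2 : ℝ) * (japanese (s * (r * β) ^ 2 + (r * z.1) ^ 2) ^ (-(1 + d) / 2) *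
      japanese (s * (r * β) ^ 2 - r ^ 2 * z.2) ^ (-(1 + d) / 2))) with ha
  set c : ℝ → ℝ × ℝ → ℝ≥0∞ := fun β z => ENNReal.ofReal
    (japanese (r * β) ^ (1 / 2 : ℝ) * (japanese (r ^ 2 * z.2 + (r * z.1) ^ 2) ^ b *
      (japanese (s * (r * β) ^ 2 + (r * z.1) ^ 2) ^ ((d - 1) / 2) *
      japanese (s * (r * β) ^ 2 - r ^ 2 * z.2) ^ ((d - 1) / 2)))) with hc
  have hsq : ∀ x : ℝ, 0 < x → ∀ e : ℝ, (x ^ (e / 2)) ^ 2 = x ^ e := by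
    intro x hx e
    rw [← Real.rpow_natCast, ← Real.rpow_mul hx.le]; norm_num
  have hA : ∀ β, ∫⁻ z, a β z ^ 2 ≤ (traceIntegralBound (1 + d) * ENNReal.ofReal r⁻¹) *
      (japaneseIntegral (1 + d) * ENNReal.ofReal (r ^ 2)⁻¹) := by
    intro β
    have h1 : ∀ z : ℝ × ℝ, a β z ^ 2 =
        ENNReal.ofReal (japanese (r * β) *
          japanese (s * (r * β) ^ 2 + (r * z.1) ^ 2) ^ (-(1 + d))) *
        ENNReal.ofReal (japanese (s * (r * β) ^ 2 - r ^ 2 * z.2) ^ (-(1 + d))) := by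
      intro z
      have := japanese_pos (r * β)
      have := japanese_pos (s * (r * β) ^ 2 + (r * z.1) ^ 2)
      have := japanese_pos (s * (r * β) ^ 2 - r ^ 2 * z.2)
      rw [ha, ← ENNReal.ofReal_pow (by positivity), ← ENNReal.ofReal_mul (by positivity)]
      congr 1
      rw [mul_pow, mul_pow, hsq _ (japanese_pos _), hsq _ (japanese_pos _),
        hsq _ (japanese_pos _), Real.rpow_one, mul_assoc]
    simp_rw [h1]
    rw [Measure.volume_eq_prod, lintegral_prod_mul (f := fun ξ => ENNReal.ofReal (japanese (r * β) *
          japanese (s * (r * β) ^ 2 + (r * ξ) ^ 2) ^ (-(1 + d)))) (g := fun μ => ENNReal.ofReal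
        (japanese (s * (r * β) ^ 2 - r ^ 2 * μ) ^ (-(1 + d)))) (by fun_prop) (by fun_prop),
      lintegral_comp_mul_left hr fun ξ => ENNReal.ofReal (japanese (r * β) *
          japanese (s * (r * β) ^ 2 + ξ ^ 2) ^ (-(1 + d))),
      lintegral_comp_mul_left (pow_pos hr 2) fun μ => ENNReal.ofReal
        (japanese (s * (r * β) ^ 2 - μ) ^ (-(1 + d))), lintegral_japanese_sub,
      mul_comm (ENNReal.ofReal r⁻¹), mul_comm (ENNReal.ofReal (r ^ 2)⁻¹)]
    gcongr
    exact lintegral_japanese_mul_right_le (by linarith) hs _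
  have hB : ∀ z, ∫⁻ β, c β z ^ 2 ≤ (4 * traceIntegralBound (1 + 2 * d)) * ENNReal.ofReal r⁻¹ := by
    intro z
    set X := (r * z.1) ^ 2
    set M := r ^ 2 * z.2
    have hcz : ∀ β, c β z = ENNReal.ofReal
        (japanese (r * β) ^ (1 / 2 : ℝ) * (japanese (M + X) ^ b *
          (japanese (s * (r * β) ^ 2 + X) ^ ((d - 1) / 2) *
          japanese (s * (r * β) ^ 2 - M) ^ ((d - 1) / 2)))) := fun _ => rfl
    clear_value X M
    have h1 : ∀ β, c β z ^ 2 ≤ 2 * (ENNReal.ofReal (japanese (r * β) *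
          japanese (s * (r * β) ^ 2 + X) ^ (-(1 + 2 * d))) +
        ENNReal.ofReal (japanese (r * β) *
          japanese (s * (r * β) ^ 2 + -M) ^ (-(1 + 2 * d)))) := by
      intro β
      have h0 := japanese_pos (r * β)
      have h1 := japanese_pos (s * (r * β) ^ 2 + X)
      have h2 := japanese_pos (s * (r * β) ^ 2 - M)
      have h3 := japanese_pos (M + X)
      rw [hcz, ← ENNReal.ofReal_pow (by positivity), show (2 : ℝ≥0∞) = ENNReal.ofReal 2 by simp,
        ← ENNReal.ofReal_add (by positivity) (by rw [← sub_eq_add_neg]; positivity),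
        ← ENNReal.ofReal_mul (by norm_num)]
      refine ENNReal.ofReal_le_ofReal ?_
      rw [← sub_eq_add_neg, show b = (1 - 4 * d) / 2 by linarith, mul_pow, mul_pow, mul_pow,
        hsq _ h0, hsq _ h1, hsq _ h2, hsq _ h3, Real.rpow_one, ← mul_add]
      have h4 : japanese (M + X) ≤
          japanese (s * (r * β) ^ 2 + X) + japanese (s * (r * β) ^ 2 - M) := by
        rw [japanese_sub_comm _ M, show M + X =
          (s * (r * β) ^ 2 + X) + (M - s * (r * β) ^ 2) by ring]
        exact japanese_add_le_add _ _
      have h5 := rpow_add_mul_rpow_mul_rpow_le (one_le_japanese (s * (r * β) ^ 2 + X))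
        (one_le_japanese (s * (r * β) ^ 2 - M)) hd hd1
      calc japanese (r * β) * (japanese (M + X) ^ (1 - 4 * d) * _)
          ≤ japanese (r * β) * ((japanese (s * (r * β) ^ 2 + X) +
              japanese (s * (r * β) ^ 2 - M)) ^ (1 - 4 * d) * _) := by
            gcongr
            linarith
        _ ≤ _ := (mul_le_mul_of_nonneg_left h5 h0.le).trans (le_of_eq (by ring))
    refine (lintegral_mono h1).trans ?_
    have hm : ∀ y : ℝ, Measurable fun β : ℝ => ENNReal.ofReal (japanese (r * β) *
          japanese (s * (r * β) ^ 2 + y) ^ (-(1 + 2 * d))) := fun y => by fun_prop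
    rw [lintegral_const_mul' _ _ (by simp), lintegral_add_left (hm _)]
    have h2 : ∀ y : ℝ, ∫⁻ β : ℝ, ENNReal.ofReal (japanese (r * β) *
        japanese (s * (r * β) ^ 2 + y) ^ (-(1 + 2 * d))) ≤
        traceIntegralBound (1 + 2 * d) * ENNReal.ofReal r⁻¹ := by
      intro y
      rw [lintegral_comp_mul_left hr fun β => ENNReal.ofReal (japanese β *
        japanese (s * β ^ 2 + y) ^ (-(1 + 2 * d))), mul_comm]
      gcongr
      exact lintegral_japanese_mul_left_le (by linarith) hs _
    calc _ ≤ 2 * (traceIntegralBound (1 + 2 * d) * ENNReal.ofReal r⁻¹ +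
          traceIntegralBound (1 + 2 * d) * ENNReal.ofReal r⁻¹) := by
          gcongr <;> exact h2 _
      _ = _ := by ring
  have hk : ∀ β z, ENNReal.ofReal (japanese (r * β) * traceKernel r b (s * (r * β) ^ 2) z) ≤
      a β z * c β z := by
    intro β z
    have h0 := japanese_pos (r * β)
    have h1 := japanese_pos (s * (r * β) ^ 2 + (r * z.1) ^ 2)
    have h2 := japanese_pos (s * (r * β) ^ 2 - r ^ 2 * z.2)
    have h3 := japanese_pos (r ^ 2 * z.2 + (r * z.1) ^ 2)
    rw [ha, hc, ← ENNReal.ofReal_mul (by positivity)]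
    refine ENNReal.ofReal_le_ofReal (le_of_eq ?_)
    have e0 : japanese (r * β) =
        japanese (r * β) ^ (1 / 2 : ℝ) * japanese (r * β) ^ (1 / 2 : ℝ) := by
      rw [← Real.rpow_add h0]; norm_num
    have e : ∀ x : ℝ, 0 < x → x⁻¹ = x ^ (-(1 + d) / 2) * x ^ ((d - 1) / 2) := by
      intro x hx
      rw [← Real.rpow_add hx, ← Real.rpow_neg_one]; ring_nf
    unfold traceKernel
    rw [e _ h1, e _ h2]
    nth_rewrite 1 [e0]
    ring
  have := lintegral_sq_lintegral_le (μ := volume) (ν := volume) (k := fun β z =>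
    ENNReal.ofReal (japanese (r * β) * traceKernel r b (s * (r * β) ^ 2) z)) (a := a) (c := c)
    (by rw [ha]; unfold Function.uncurry; fun_prop) (by rw [hc]; unfold Function.uncurry; fun_prop)
    hh hk hA (Eventually.of_forall hB)
  refine this.trans (le_of_eq ?_)
  have hr4 : ENNReal.ofReal (r ^ 4)⁻¹ =
      ENNReal.ofReal r⁻¹ * ENNReal.ofReal (r ^ 2)⁻¹ * ENNReal.ofReal r⁻¹ := by
    rw [← ENNReal.ofReal_mul (by positivity), ← ENNReal.ofReal_mul (by positivity)]
    congr 1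
    field_simp
  rw [hr4, traceConstant]
  ring

/-! ### The multiplier of the truncated Duhamel term -/

/-- The oscillation `e^{-itλ}`. -/
def osc (l t : ℝ) : ℂ := Complex.exp (-Complex.I * (t * l : ℝ))

/-- `∫₀ᵗ e^{isσ} ds`, the Duhamel integral of a plane wave at distance `σ` from the
characteristic parabola, with the free oscillation removed. -/
def oscPrimitive (σ t : ℝ) : ℂ := ∫ s in (0 : ℝ)..t, Complex.exp (Complex.I * (s * σ : ℝ))

lemma norm_osc (l t : ℝ) : ‖osc l t‖ = 1 := by
  unfold osc
  rw [show -Complex.I * ((t * l : ℝ) : ℂ) = ((-(t * l) : ℝ) : ℂ) * Complex.I by push_cast; ring,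
    Complex.norm_exp_ofReal_mul_I]

lemma osc_neg (l t : ℝ) : osc (-l) t = Complex.exp (Complex.I * (t * l : ℝ)) := by
  unfold osc; push_cast; ring_nf

lemma osc_add (l l' t : ℝ) : osc (l + l') t = osc l t * osc l' t := by
  unfold osc; rw [← Complex.exp_add]; push_cast; ring_nf

lemma continuous_osc_uncurry : Continuous fun p : ℝ × ℝ => osc p.1 p.2 := by
  unfold osc; fun_prop

@[fun_prop]
lemma continuous_osc (l : ℝ) : Continuous (osc l) := by
  unfold osc; fun_prop

lemma hasDerivAt_osc (l t : ℝ) : HasDerivAt (osc l) (-Complex.I * l * osc l t) t := by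
  unfold osc
  have h : HasDerivAt (fun t : ℝ => -Complex.I * ((t * l : ℝ) : ℂ)) (-Complex.I * l) t := by
    have h1 : HasDerivAt (fun t : ℝ => ((t * l : ℝ) : ℂ)) ((1 * l : ℝ) : ℂ) t :=
      ((hasDerivAt_id t).mul_const l).ofReal_comp
    simpa using h1.const_mul (-Complex.I)
  convert h.cexp using 1
  ring

lemma oscPrimitive_zero (σ : ℝ) : oscPrimitive σ 0 = 0 := by simp [oscPrimitive]

lemma hasDerivAt_oscPrimitive (σ t : ℝ) : HasDerivAt (oscPrimitive σ) (osc (-σ) t) t := by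
  rw [osc_neg]
  exact (show Continuous fun s : ℝ => Complex.exp (Complex.I * (s * σ : ℝ)) by
    fun_prop).integral_hasStrictDerivAt 0 t |>.hasDerivAt

@[fun_prop]
lemma continuous_oscPrimitive (σ : ℝ) : Continuous (oscPrimitive σ) :=
  continuous_iff_continuousAt.mpr fun t => (hasDerivAt_oscPrimitive σ t).continuousAt

lemma norm_oscPrimitive_le (σ t : ℝ) : ‖oscPrimitive σ t‖ ≤ |t| := by
  have h := intervalIntegral.norm_integral_le_of_norm_le_const (a := 0) (b := t) (C := 1)
    (f := fun s : ℝ => Complex.exp (Complex.I * (s * σ : ℝ)))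
    (fun s _ => by rw [← osc_neg, norm_osc])
  simpa [oscPrimitive] using h

lemma oscPrimitive_mul_osc (σ t : ℝ) : oscPrimitive σ t * osc σ t = oscPrimitive (-σ) t := by
  unfold oscPrimitive
  have h := intervalIntegral.integral_comp_sub_left (a := 0) (b := t)
    (fun s : ℝ => Complex.exp (Complex.I * (s * -σ : ℝ))) t
  simp only [sub_self, sub_zero] at h
  rw [← h, ← intervalIntegral.integral_mul_const]
  refine intervalIntegral.integral_congr fun s _ => ?_
  simp only [osc, ← Complex.exp_add]
  congr 1
  push_cast
  ring

lemma oscPrimitive_mul (σ T t : ℝ) : oscPrimitive σ (T * t) = T * oscPrimitive (T * σ) t := by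
  unfold oscPrimitive
  have h := intervalIntegral.smul_integral_comp_mul_left (a := 0) (b := t)
    (fun s : ℝ => Complex.exp (Complex.I * (s * σ : ℝ))) T
  simp only [mul_zero, Complex.real_smul] at h
  rw [← h]
  congr 1
  refine intervalIntegral.integral_congr fun s _ => ?_
  push_cast
  ring_nf

/-- Integration by parts against `e^{-itλ}` for an amplitude vanishing at the upper endpoint. -/
lemma integral_mul_osc_by_parts {u u' : ℝ → ℂ} (hu : ∀ t, HasDerivAt u (u' t) t)
    (hu' : Continuous u') {a : ℝ} (ha : u a = 0) (l : ℝ) :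
    Complex.I * l * ∫ t in (0 : ℝ)..a, u t * osc l t =
      u 0 + ∫ t in (0 : ℝ)..a, u' t * osc l t := by
  have hcu : Continuous u := continuous_iff_continuousAt.mpr fun t => (hu t).continuousAt
  have h := intervalIntegral.integral_eq_sub_of_hasDerivAt (a := 0) (b := a)
    (fun t _ => (hu t).mul (hasDerivAt_osc l t))
    (Continuous.intervalIntegrable (by fun_prop) _ _)
  rw [intervalIntegral.integral_add (Continuous.intervalIntegrable (by fun_prop) _ _)
    (Continuous.intervalIntegrable (by fun_prop) _ _)] at h
  have h2 : ∫ t in (0 : ℝ)..a, u t * (-Complex.I * l * osc l t) =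
      -(Complex.I * l * ∫ t in (0 : ℝ)..a, u t * osc l t) := by
    rw [← intervalIntegral.integral_const_mul, ← intervalIntegral.integral_neg]
    refine intervalIntegral.integral_congr fun t _ => ?_
    ring
  rw [h2] at h
  simp only [Pi.mul_apply, ha, zero_mul, zero_sub] at h
  have h0 : osc l 0 = 1 := by simp [osc]
  rw [h0, mul_one] at h
  linear_combination -h

lemma norm_integral_mul_osc_le {u : ℝ → ℂ} {a K : ℝ} (l : ℝ)
    (hK : ∀ t, |t| ≤ |a| → ‖u t‖ ≤ K) : ‖∫ t in (0 : ℝ)..a, u t * osc l t‖ ≤ K * |a| := by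
  have h := intervalIntegral.norm_integral_le_of_norm_le_const (a := 0) (b := a) (C := K)
    (f := fun t => u t * osc l t) fun t ht => by
      rw [norm_mul, norm_osc, mul_one]
      refine hK t ?_
      rcases le_total 0 a with h | h
      · rw [uIoc_of_le h] at ht
        rw [abs_of_pos ht.1, abs_of_nonneg h]
        exact ht.2
      · rw [uIoc_of_ge h] at ht
        rw [abs_of_nonpos ht.2, abs_of_nonpos h]
        linarith [ht.1]
  simpa using h

lemma mul_japanese_le {x l K K' : ℝ} (h0 : x ≤ K) (h1 : |l| * x ≤ K') :
    x * japanese l ≤ K + K' := by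
  unfold japanese; linarith

lemma norm_I_mul_mul (l : ℝ) (z : ℂ) : ‖Complex.I * l * z‖ = |l| * ‖z‖ := by simp

section

variable {θ θ' θ'' : ℝ → ℝ} {K a : ℝ}

lemma norm_integral_cutoff_mul_osc_le (hθ : ∀ t, HasDerivAt θ (θ' t) t) (hc : Continuous θ')
    (hK : ∀ t, |θ t| ≤ K) (hK' : ∀ t, |θ' t| ≤ K) (ha : θ a = 0) (l : ℝ) :
    ‖∫ t in (0 : ℝ)..a, (θ t : ℂ) * osc l t‖ * japanese l ≤ K * |a| + (K + K * |a|) := by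
  refine mul_japanese_le (norm_integral_mul_osc_le l fun t _ => by simpa using hK t) ?_
  rw [← norm_I_mul_mul, integral_mul_osc_by_parts (u' := fun t => (θ' t : ℂ))
    (fun t => (hθ t).ofReal_comp) (by fun_prop) (by simp [ha])]
  exact (norm_add_le _ _).trans (add_le_add (by simpa using hK 0)
    (norm_integral_mul_osc_le l fun t _ => by simpa using hK' t))

lemma norm_integral_cutoff_mul_oscPrimitive_le (hθ : ∀ t, HasDerivAt θ (θ' t) t)
    (hc : Continuous θ') (hK : ∀ t, |θ t| ≤ K) (hK' : ∀ t, |θ' t| ≤ K) (ha : θ a = 0)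
    (σ l : ℝ) :
    ‖∫ t in (0 : ℝ)..a, ((θ t : ℂ) * oscPrimitive σ t) * osc l t‖ * japanese (l - σ) ≤
      K * |a| * |a| + (K * |a| + K) * |a| := by
  have hcθ : Continuous θ := continuous_iff_continuousAt.mpr fun t => (hθ t).continuousAt
  have hK0 : 0 ≤ K := (abs_nonneg _).trans (hK 0)
  have heq : ∀ t, ((θ t : ℂ) * oscPrimitive σ t) * osc l t =
      ((θ t : ℂ) * oscPrimitive (-σ) t) * osc (l - σ) t := by
    intro t
    rw [← oscPrimitive_mul_osc, show l = σ + (l - σ) by ring, osc_add]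
    ring_nf
  have hE : ∀ t, |t| ≤ |a| → ‖oscPrimitive (-σ) t‖ ≤ |a| :=
    fun t ht => (norm_oscPrimitive_le _ _).trans ht
  simp_rw [heq]
  refine mul_japanese_le (norm_integral_mul_osc_le _ fun t ht => ?_) ?_
  · rw [norm_mul, Complex.norm_real]
    exact mul_le_mul (hK t) (hE t ht) (norm_nonneg _) hK0
  · rw [← norm_I_mul_mul, integral_mul_osc_by_parts
      (u := fun t => (θ t : ℂ) * oscPrimitive (-σ) t)
      (u' := fun t => (θ' t : ℂ) * oscPrimitive (-σ) t + (θ t : ℂ) * osc (- -σ) t)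
      (fun t => (hθ t).ofReal_comp.mul (hasDerivAt_oscPrimitive (-σ) t))
      (by fun_prop) (by simp [ha]), oscPrimitive_zero, mul_zero, zero_add]
    refine norm_integral_mul_osc_le _ fun t ht => ?_
    refine (norm_add_le _ _).trans (add_le_add ?_ ?_)
    · rw [norm_mul, Complex.norm_real]
      exact mul_le_mul (hK' t) (hE t ht) (norm_nonneg _) hK0
    · rw [norm_mul, Complex.norm_real, norm_osc, mul_one]
      exact hK t

/-- The time Fourier transform of the truncated Duhamel integral of a plane wave decays in both the
distance `λ` to the parabola and the distance `λ - σ` to the frequency of the plane wave. The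
sharp cut-off at `t = 0` is harmless because the Duhamel integral vanishes there. -/
lemma norm_duhamelMultiplier_le (hθ : ∀ t, HasDerivAt θ (θ' t) t)
    (hθ' : ∀ t, HasDerivAt θ' (θ'' t) t) (hc : Continuous θ'') (hK : ∀ t, |θ t| ≤ K)
    (hK' : ∀ t, |θ' t| ≤ K) (hK'' : ∀ t, |θ'' t| ≤ K) (ha : θ a = 0) (ha' : θ' a = 0) (σ l : ℝ) :
    ‖∫ t in (0 : ℝ)..a, ((θ t : ℂ) * oscPrimitive σ t) * osc l t‖ * japanese l *
        japanese (l - σ) ≤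
      2 * (K * |a| * |a| + (K * |a| + K) * |a|) + (K * |a| + (K + K * |a|)) := by
  have hc' : Continuous θ' := continuous_iff_continuousAt.mpr fun t => (hθ' t).continuousAt
  have hcθ : Continuous θ := continuous_iff_continuousAt.mpr fun t => (hθ t).continuousAt
  set m := ∫ t in (0 : ℝ)..a, ((θ t : ℂ) * oscPrimitive σ t) * osc l t with hm
  have h1 := norm_integral_cutoff_mul_oscPrimitive_le hθ hc' hK hK' ha σ l
  have h2 := norm_integral_cutoff_mul_oscPrimitive_le hθ' hc hK' hK'' ha' σ l
  have h3 := norm_integral_cutoff_mul_osc_le hθ hc' hK hK' ha (l - σ)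
  have hj := japanese_pos (l - σ)
  -- a derivative falling on the Duhamel integral leaves the plain oscillation of frequency `λ - σ`;
  -- one falling on the cut-off leaves an integral of the same kind
  have key : |l| * ‖m‖ ≤ ‖∫ t in (0 : ℝ)..a, ((θ' t : ℂ) * oscPrimitive σ t) * osc l t‖ +
      ‖∫ t in (0 : ℝ)..a, (θ t : ℂ) * osc (l - σ) t‖ := by
    rw [← norm_I_mul_mul, hm, integral_mul_osc_by_parts
      (u := fun t => (θ t : ℂ) * oscPrimitive σ t)
      (u' := fun t => (θ' t : ℂ) * oscPrimitive σ t + (θ t : ℂ) * osc (-σ) t)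
      (fun t => (hθ t).ofReal_comp.mul (hasDerivAt_oscPrimitive σ t))
      (by fun_prop) (by simp [ha]), oscPrimitive_zero, mul_zero, zero_add]
    have : ∀ t, ((θ' t : ℂ) * oscPrimitive σ t + (θ t : ℂ) * osc (-σ) t) * osc l t =
        ((θ' t : ℂ) * oscPrimitive σ t) * osc l t + (θ t : ℂ) * osc (l - σ) t := by
      intro t
      rw [show l - σ = -σ + l by ring, osc_add]
      ring
    simp_rw [this]
    rw [intervalIntegral.integral_add (Continuous.intervalIntegrable (by fun_prop) _ _)
      (Continuous.intervalIntegrable (by fun_prop) _ _)]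
    exact norm_add_le _ _
  have h4 := mul_le_mul_of_nonneg_right key hj.le
  rw [← hm] at h1
  calc ‖m‖ * japanese l * japanese (l - σ)
      = ‖m‖ * japanese (l - σ) + |l| * ‖m‖ * japanese (l - σ) := by
        rw [show japanese l = 1 + |l| from rfl]; ring
    _ ≤ _ := by rw [add_mul] at h4; linarith

end

lemma integral_rescaled_cutoff (θ : ℝ → ℝ) {T : ℝ} (hT : 0 < T) (a σ l : ℝ) :
    ∫ t in (0 : ℝ)..T * a, ((θ (t / T) : ℂ) * oscPrimitive σ t) * osc l t =
      (T : ℂ) ^ 2 * ∫ t in (0 : ℝ)..a, ((θ t : ℂ) * oscPrimitive (T * σ) t) * osc (T * l) t := by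
  have h := intervalIntegral.smul_integral_comp_mul_left (a := 0) (b := a)
    (fun t : ℝ => ((θ (t / T) : ℂ) * oscPrimitive σ t) * osc l t) T
  simp only [mul_zero, Complex.real_smul] at h
  rw [← h, sq, mul_assoc]
  congr 1
  rw [← intervalIntegral.integral_const_mul]
  refine intervalIntegral.integral_congr fun t _ => ?_
  rw [oscPrimitive_mul, mul_div_cancel_left₀ _ hT.ne']
  have : osc l (T * t) = osc (T * l) t := by unfold osc; ring_nf
  rw [this]
  ring

/-- The bound on the multiplier for a smooth cut-off `η(t / T)`, on the half lines `a = ±2`. -/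
lemma exists_norm_duhamelMultiplier_le {η : ℝ → ℝ} (hη : ContDiff ℝ ∞ η)
    (hη_supp : tsupport η ⊆ Icc (-2 : ℝ) 2) :
    ∃ K : ℝ, 0 ≤ K ∧ ∀ a : ℝ, |a| = 2 → ∀ T : ℝ, 0 < T → ∀ σ l : ℝ,
      ‖∫ t in (0 : ℝ)..T * a, ((η (t / T) : ℂ) * oscPrimitive σ t) * osc l t‖ ≤
        K * T ^ 2 * ((japanese (T * l))⁻¹ * (japanese (T * (l - σ)))⁻¹) := by
  have hcs : HasCompactSupport η := HasCompactSupport.of_support_subset_isCompact isCompact_Icc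
    ((subset_tsupport η).trans hη_supp)
  have hd1 : ContDiff ℝ ∞ (deriv η) := (contDiff_infty_iff_deriv.mp hη).2
  have hd2 : ContDiff ℝ ∞ (deriv (deriv η)) := (contDiff_infty_iff_deriv.mp hd1).2
  have hcs1 : HasCompactSupport (deriv η) := hcs.deriv
  have hcs2 : HasCompactSupport (deriv (deriv η)) := hcs1.deriv
  obtain ⟨K0, hK0⟩ := hcs.exists_bound_of_continuous hη.continuous
  obtain ⟨K1, hK1⟩ := hcs1.exists_bound_of_continuous hd1.continuous
  obtain ⟨K2, hK2⟩ := hcs2.exists_bound_of_continuous hd2.continuous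
  set K := max K0 (max K1 K2)
  have hzero : ∀ f : ℝ → ℝ, Continuous f → tsupport f ⊆ Icc (-2 : ℝ) 2 →
      ∀ a : ℝ, |a| = 2 → f a = 0 := by
    intro f hf hfs a ha
    -- the support of a continuous function is open, hence contained in the open interval
    have hsub : Function.support f ⊆ interior (Icc (-2 : ℝ) 2) :=
      interior_maximal ((subset_tsupport f).trans hfs) hf.isOpen_support
    by_contra hne
    have := hsub hne
    rw [interior_Icc, mem_Ioo, ← abs_lt] at this
    exact this.ne ha
  refine ⟨2 * (K * 2 * 2 + (K * 2 + K) * 2) + (K * 2 + (K + K * 2)), ?_, fun a ha T hT σ l => ?_⟩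
  · have : 0 ≤ K := (norm_nonneg (η 0)).trans ((hK0 0).trans (le_max_left _ _))
    positivity
  have h := norm_duhamelMultiplier_le (θ := η) (θ' := deriv η) (θ'' := deriv (deriv η)) (K := K)
    (a := a) (fun t => ((hη.differentiable (by simp)) t).hasDerivAt)
    (fun t => ((hd1.differentiable (by simp)) t).hasDerivAt) hd2.continuous
    (fun t => (hK0 t).trans (le_max_left _ _))
    (fun t => (hK1 t).trans ((le_max_left _ _).trans (le_max_right _ _)))
    (fun t => (hK2 t).trans ((le_max_right _ _).trans (le_max_right _ _)))
    (hzero _ hη.continuous hη_supp a ha)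
    (hzero _ hd1.continuous (tsupport_deriv_subset.trans hη_supp) a ha) (T * σ) (T * l)
  rw [integral_rescaled_cutoff η hT, norm_mul, norm_pow, Complex.norm_real, Real.norm_eq_abs,
    abs_of_pos hT, mul_comm _ (T ^ 2), mul_assoc (T ^ 2)]
  refine mul_le_mul_of_nonneg_left ?_ (by positivity)
  rw [ha, ← mul_sub] at h
  rw [← mul_inv, ← div_eq_mul_inv, le_div_iff₀ (mul_pos (japanese_pos _) (japanese_pos _)),
    ← mul_assoc]
  exact h

/-! ### The Fourier transform of square-integrable functions -/

section

variable {E : Type*} [NormedAddCommGroup E] [InnerProductSpace ℝ E] [FiniteDimensional ℝ E]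
  [MeasurableSpace E] [BorelSpace E]

lemma continuous_fourierInv {v : E → ℂ} (hv : Integrable v) : Continuous (𝓕⁻ v) := by
  rw [Real.fourierInv_eq_fourier_comp_neg]
  exact VectorFourier.fourierIntegral_continuous Real.continuous_fourierChar
    (by simpa using! continuous_inner) hv.comp_neg

lemma integral_schwartz_mul_fourierInv {v : E → ℂ} (hv : Integrable v) (φ : 𝓢(E, ℂ)) :
    ∫ x, (𝓕⁻ φ) x • v x = ∫ x, φ x • (𝓕⁻ v) x := by
  have h := VectorFourier.integral_fourierIntegral_smul_eq_flip (L := -innerₗ E) (μ := volume)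
    (ν := volume) (f := φ) (g := v) Real.continuous_fourierChar
    (by simpa using! continuous_inner.neg) φ.integrable hv
  have h1 : ∀ x, VectorFourier.fourierIntegral 𝐞 volume (-innerₗ E) (⇑φ) x = (𝓕⁻ φ) x := by
    intro x
    rw [SchwartzMap.fourierInv_coe, Real.fourierInv_eq]
    simp [VectorFourier.fourierIntegral]
  have h2 : ∀ x, VectorFourier.fourierIntegral 𝐞 volume (-innerₗ E).flip v x = (𝓕⁻ v) x := by
    intro x
    rw [Real.fourierInv_eq]
    simp [VectorFourier.fourierIntegral, real_inner_comm]
  simp_rw [h1, h2] at h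
  exact h

/-- On integrable functions the inverse Fourier transform of `L²` is given by the integral. -/
lemma fourierInv_toLp_ae_eq {v : E → ℂ} (hv : Integrable v) (hv2 : MemLp v 2) :
    ((𝓕⁻ (hv2.toLp v) : Lp ℂ 2 (volume : Measure E)) : E → ℂ) =ᵐ[volume] 𝓕⁻ v := by
  set g : Lp ℂ 2 (volume : Measure E) := 𝓕⁻ (hv2.toLp v)
  refine ae_eq_of_integral_contDiff_smul_eq ((Lp.memLp g).locallyIntegrable (by norm_num))
    (continuous_fourierInv hv).locallyIntegrable fun φ hφ hφc => ?_
  have h1 : HasCompactSupport (Complex.ofRealCLM ∘ φ) := hφc.comp_left rfl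
  have h2 : ContDiff ℝ ∞ (Complex.ofRealCLM ∘ φ) := by fun_prop
  set ψ : 𝓢(E, ℂ) := h1.toSchwartzMap h2
  have hψ : ∀ x, ψ x = φ x := fun x => rfl
  have e1 : Lp.toTemperedDistribution g ψ = ∫ x, φ x • g x := by
    simp [hψ]
  have e2 : Lp.toTemperedDistribution g ψ = ∫ x, (𝓕⁻ ψ) x • v x := by
    rw [← Lp.fourierInv_toTemperedDistribution_eq, TemperedDistribution.fourierInv_apply,
      Lp.toTemperedDistribution_apply]
    refine integral_congr_ae ?_
    filter_upwards [hv2.coeFn_toLp] with x hx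
    rw [hx]
  rw [← e1, e2, integral_schwartz_mul_fourierInv hv]
  simp [hψ]

/-- Plancherel's theorem for integrable functions. -/
lemma eLpNorm_fourierInv {v : E → ℂ} (hv : Integrable v) (hv2 : MemLp v 2) :
    eLpNorm (𝓕⁻ v) 2 = eLpNorm v 2 := by
  rw [← eLpNorm_congr_ae (fourierInv_toLp_ae_eq hv hv2), ← eLpNorm_congr_ae hv2.coeFn_toLp,
    ← Lp.enorm_def, ← Lp.enorm_def]
  rw [← ofReal_norm, ← ofReal_norm]
  congr 1
  exact (Lp.fourierTransformₗᵢ E ℂ).symm.norm_map _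

lemma memLp_comp_smul {v : E → ℂ} {c : ℝ} (hc : c ≠ 0) (hv : MemLp v 2) :
    MemLp (fun k => v (c • k)) 2 := by
  have hm : Measurable fun k : E => c • k := by fun_prop
  refine MemLp.comp_of_map ?_ hm.aemeasurable
  rw [Measure.map_addHaar_smul _ hc]
  exact hv.smul_measure (by simp)

lemma ae_comp_smul_iff {c : ℝ} (hc : c ≠ 0) {P : E → Prop} :
    (∀ᵐ k : E, P (c • k)) ↔ ∀ᵐ k : E, P k := by
  have he : MeasurableEmbedding fun k : E => c • k :=
    (Homeomorph.smulOfNeZero c hc).measurableEmbedding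
  have h := he.ae_map_iff (μ := volume) (p := P)
  rw [← h, Measure.map_addHaar_smul _ hc, Measure.ae_ennreal_smul_measure_iff]
  simp [hc]

end

/-! ### Fourier transforms that are functions -/

lemma two_pi_ne_zero' : (2 * Real.pi : ℝ) ≠ 0 := by positivity

lemma HasFourierFunction.locallyIntegrable {F : 𝓢'(Plane, ℂ)} {f : Plane → ℂ}
    (hf : HasFourierFunction F f) : LocallyIntegrable (fun k => f ((2 * Real.pi) • k)) := by
  intro x
  set φ : ContDiffBump x := ⟨1, 2, one_pos, one_lt_two⟩
  have h1 : HasCompactSupport (Complex.ofRealCLM ∘ φ) := φ.hasCompactSupport.comp_left rfl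
  have h2 : ContDiff ℝ ∞ (Complex.ofRealCLM ∘ φ) := Complex.ofRealCLM.contDiff.comp φ.contDiff
  refine ⟨Metric.closedBall x 1, Metric.closedBall_mem_nhds x one_pos, ?_⟩
  refine (hf (h1.toSchwartzMap h2)).1.integrableOn.congr_fun (fun k hk => ?_)
    measurableSet_closedBall
  simp [φ.one_of_mem_closedBall hk]

lemma HasFourierFunction.ae_eq {F : 𝓢'(Plane, ℂ)} {f g : Plane → ℂ}
    (hf : HasFourierFunction F f) (hg : HasFourierFunction F g) : f =ᵐ[volume] g := by
  rw [EventuallyEq, ← ae_comp_smul_iff two_pi_ne_zero']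
  refine ae_eq_of_integral_contDiff_smul_eq hf.locallyIntegrable hg.locallyIntegrable
    fun φ hφ hφc => ?_
  have h1 : HasCompactSupport (Complex.ofRealCLM ∘ φ) := hφc.comp_left rfl
  have h2 : ContDiff ℝ ∞ (Complex.ofRealCLM ∘ φ) := by fun_prop
  have h := (hf (h1.toSchwartzMap h2)).2.symm.trans (hg (h1.toSchwartzMap h2)).2
  simpa using h

/-- The infimum in the definition of the Bourgain norm is attained by every function representing
the Fourier transform. -/
lemma HasFourierFunction.xNorm_eq {F : 𝓢'(Plane, ℂ)} {f : Plane → ℂ}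
    (hf : HasFourierFunction F f) (s b : ℝ) :
    xNorm s b F = eLpNorm (fun k : Plane =>
      ((bracket k.fst ^ s * bracket (k.snd + k.fst ^ 2) ^ b : ℝ) : ℂ) * f k) 2 volume := by
  refine le_antisymm (iInf₂_le f hf) (le_iInf₂ fun g hg => le_of_eq (eLpNorm_congr_ae ?_))
  filter_upwards [hf.ae_eq hg] with k hk
  rw [hk]

lemma exists_hasFourierFunction_of_xNorm_lt_top {F : 𝓢'(Plane, ℂ)} {s b : ℝ}
    (h : xNorm s b F < ⊤) : ∃ f, HasFourierFunction F f := by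
  by_contra! hne
  have : xNorm s b F = ⊤ := by
    unfold xNorm
    simp [hne]
  exact h.ne this

lemma HasFourierFunction.aestronglyMeasurable {F : 𝓢'(Plane, ℂ)} {f : Plane → ℂ}
    (hf : HasFourierFunction F f) : AEStronglyMeasurable f volume := by
  have h := hf.locallyIntegrable.aestronglyMeasurable
  have hq : Measure.QuasiMeasurePreserving (fun k : Plane => (2 * Real.pi)⁻¹ • k) volume
      volume := by
    refine ⟨by fun_prop, ?_⟩
    rw [Measure.map_addHaar_smul _ (inv_ne_zero two_pi_ne_zero')]
    exact Measure.smul_absolutelyContinuous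
  refine (h.comp_quasiMeasurePreserving hq).congr (Eventually.of_forall fun k => ?_)
  rw [Function.comp_apply, smul_smul, mul_inv_cancel₀ two_pi_ne_zero', one_smul]

/-- The `L²` function with Fourier transform `V`, in the normalisation `∫ e^{-i⟨·,·⟩}`. -/
def inverseFourierLp {V : Plane → ℂ} (hV : MemLp V 2) : Lp ℂ 2 (volume : Measure Plane) :=
  𝓕⁻ ((memLp_comp_smul two_pi_ne_zero' hV).toLp fun k => V ((2 * Real.pi) • k))

lemma hasFourierFunction_inverseFourierLp {V : Plane → ℂ} (hV : MemLp V 2) :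
    HasFourierFunction (inverseFourierLp hV : 𝓢'(Plane, ℂ)) V := by
  intro φ
  have hv := memLp_comp_smul two_pi_ne_zero' hV
  refine ⟨(φ.memLp 2 volume).integrable_mul hv, ?_⟩
  rw [inverseFourierLp, Lp.fourier_toTemperedDistribution_eq,
    FourierTransform.fourier_fourierInv_eq, Lp.toTemperedDistribution_apply]
  refine integral_congr_ae ?_
  filter_upwards [hv.coeFn_toLp] with k hk
  rw [hk, smul_eq_mul]

/-! ### The truncated Duhamel term at a point, as an operator on frequency amplitudes -/

lemma sq_eLpNorm_two {α : Type*} [MeasurableSpace α] {μ : Measure α} {E : Type*}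
    [NormedAddCommGroup E] (f : α → E) : eLpNorm f 2 μ ^ 2 = ∫⁻ x, ‖f x‖ₑ ^ 2 ∂μ := by
  have := eLpNorm_nnreal_pow_eq_lintegral (μ := μ) (f := f) (p := 2) (by norm_num)
  simpa using this

lemma continuous_oscPrimitive_uncurry : Continuous fun p : ℝ × ℝ => oscPrimitive p.1 p.2 := by
  unfold oscPrimitive
  refine intervalIntegral.continuous_parametric_intervalIntegral_of_continuous
    (f := fun (p : ℝ × ℝ) (s : ℝ) => Complex.exp (Complex.I * (s * p.1 : ℝ))) ?_ continuous_snd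
  unfold Function.uncurry
  fun_prop

lemma mul_oscPrimitive (σ t : ℝ) : Complex.I * σ * oscPrimitive σ t = osc (-σ) t - 1 := by
  have h := intervalIntegral.integral_eq_sub_of_hasDerivAt (a := 0) (b := t)
    (fun s _ => hasDerivAt_osc (-σ) s) (Continuous.intervalIntegrable (by fun_prop) _ _)
  rw [intervalIntegral.integral_const_mul] at h
  have h0 : osc (-σ) 0 = 1 := by simp [osc]
  rw [h0] at h
  rw [← h]
  unfold oscPrimitive
  simp_rw [← osc_neg]
  push_cast
  ring

lemma norm_oscPrimitive_le_mul_inv (σ t : ℝ) :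
    ‖oscPrimitive σ t‖ ≤ (|t| + 2) * (japanese σ)⁻¹ := by
  rw [← div_eq_mul_inv, le_div_iff₀ (japanese_pos _)]
  refine mul_japanese_le (norm_oscPrimitive_le σ t) ?_
  rw [← norm_I_mul_mul, mul_oscPrimitive]
  refine (norm_sub_le _ _).trans ?_
  rw [norm_osc]
  norm_num

/-- The amplitudes `v(ξ, μ)` for which the Duhamel integral converges absolutely. -/
def IsDuhamelIntegrable (v : ℝ × ℝ → ℂ) : Prop :=
  Integrable fun z : ℝ × ℝ => (japanese (z.2 + z.1 ^ 2))⁻¹ • v z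

/-- The integrand, over the frequencies `z = (ξ, μ)`, of the truncated Duhamel term. -/
def traceIntegrand (η : ℝ → ℝ) (T x : ℝ) (v : ℝ × ℝ → ℂ) (t : ℝ) (z : ℝ × ℝ) : ℂ :=
  ((η (t / T) : ℂ) * oscPrimitive (z.2 + z.1 ^ 2) t) * osc (z.1 ^ 2) t *
    (Complex.exp (Complex.I * (x * z.1 : ℝ)) * v z)

/-- The truncated Duhamel term at the point `x`, as a function of time, for the space-time
frequency amplitude `v`. -/
def traceOp (η : ℝ → ℝ) (T x : ℝ) (v : ℝ × ℝ → ℂ) (t : ℝ) : ℂ :=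
  (((2 * Real.pi : ℝ) : ℂ)⁻¹) ^ 2 * ∫ z, traceIntegrand η T x v t z

section

variable {η : ℝ → ℝ} {T : ℝ} {v : ℝ × ℝ → ℂ}

lemma IsDuhamelIntegrable.aestronglyMeasurable (hv : IsDuhamelIntegrable v) :
    AEStronglyMeasurable v volume := by
  have h : AEStronglyMeasurable (fun z : ℝ × ℝ => japanese (z.2 + z.1 ^ 2) •
      ((japanese (z.2 + z.1 ^ 2))⁻¹ • v z)) volume :=
    (show Continuous fun z : ℝ × ℝ => japanese (z.2 + z.1 ^ 2) by
      fun_prop).aestronglyMeasurable.smul (Integrable.aestronglyMeasurable hv)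
  refine h.congr (Eventually.of_forall fun z => ?_)
  simp only [smul_smul, mul_inv_cancel₀ (japanese_pos (z.2 + z.1 ^ 2)).ne', one_smul]

lemma norm_exp_I_mul (y : ℝ) : ‖Complex.exp (Complex.I * (y : ℂ))‖ = 1 := by
  rw [mul_comm, Complex.norm_exp_ofReal_mul_I]

lemma norm_traceIntegrand (x t : ℝ) (z : ℝ × ℝ) :
    ‖traceIntegrand η T x v t z‖ = |η (t / T)| * ‖oscPrimitive (z.2 + z.1 ^ 2) t‖ * ‖v z‖ := by
  unfold traceIntegrand
  rw [norm_mul, norm_mul, norm_mul, norm_mul, norm_osc, norm_exp_I_mul, Complex.norm_real]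
  simp

lemma eta_div_eq_zero (hη_supp : tsupport η ⊆ Icc (-2 : ℝ) 2) (hT : 0 < T)
    {t : ℝ} (ht : 2 * T < |t|) : η (t / T) = 0 := by
  by_contra hne
  have := hη_supp (subset_tsupport η hne)
  rw [mem_Icc, ← abs_le, abs_div, abs_of_pos hT, div_le_iff₀ hT] at this
  linarith

lemma exists_abs_eta_le (hη : Continuous η) (hη_supp : tsupport η ⊆ Icc (-2 : ℝ) 2) :
    ∃ K : ℝ, 0 ≤ K ∧ ∀ t, |η t| ≤ K := by
  have hcs : HasCompactSupport η := HasCompactSupport.of_support_subset_isCompact isCompact_Icc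
    ((subset_tsupport η).trans hη_supp)
  obtain ⟨K, hK⟩ := hcs.exists_bound_of_continuous hη
  exact ⟨K, (norm_nonneg _).trans (hK 0), hK⟩

lemma exists_norm_traceIntegrand_le (hη : Continuous η)
    (hη_supp : tsupport η ⊆ Icc (-2 : ℝ) 2) (hT : 0 < T) :
    ∃ K : ℝ, 0 ≤ K ∧ ∀ (v : ℝ × ℝ → ℂ) (x t : ℝ) (z : ℝ × ℝ),
      ‖traceIntegrand η T x v t z‖ ≤ K * ‖(japanese (z.2 + z.1 ^ 2))⁻¹ • v z‖ := by
  obtain ⟨K, hK0, hK⟩ := exists_abs_eta_le hη hη_supp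
  refine ⟨K * (2 * T + 2), by positivity, fun v x t z => ?_⟩
  rw [norm_traceIntegrand, norm_smul, Real.norm_of_nonneg (inv_nonneg.mpr (japanese_pos _).le),
    ← mul_assoc]
  refine mul_le_mul_of_nonneg_right ?_ (norm_nonneg _)
  have hj := inv_pos.mpr (japanese_pos (z.2 + z.1 ^ 2))
  by_cases ht : 2 * T < |t|
  · rw [eta_div_eq_zero hη_supp hT ht, abs_zero, zero_mul]
    positivity
  · rw [mul_assoc]
    refine mul_le_mul (hK _) ((norm_oscPrimitive_le_mul_inv _ _).trans ?_) (norm_nonneg _) hK0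
    gcongr
    linarith

lemma continuous_traceIntegrand_uncurry (hη : Continuous η) (T x : ℝ) :
    Continuous fun p : ℝ × (ℝ × ℝ) =>
      ((η (p.1 / T) : ℂ) * oscPrimitive (p.2.2 + p.2.1 ^ 2) p.1) * osc (p.2.1 ^ 2) p.1 *
        Complex.exp (Complex.I * (x * p.2.1 : ℝ)) := by
  have h1 : Continuous fun p : ℝ × (ℝ × ℝ) => oscPrimitive (p.2.2 + p.2.1 ^ 2) p.1 :=
    continuous_oscPrimitive_uncurry.comp
      (show Continuous fun p : ℝ × (ℝ × ℝ) => (p.2.2 + p.2.1 ^ 2, p.1) by fun_prop)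
  have h2 : Continuous fun p : ℝ × (ℝ × ℝ) => osc (p.2.1 ^ 2) p.1 :=
    continuous_osc_uncurry.comp
      (show Continuous fun p : ℝ × (ℝ × ℝ) => (p.2.1 ^ 2, p.1) by fun_prop)
  have h3 : Continuous fun p : ℝ × (ℝ × ℝ) => η (p.1 / T) :=
    hη.comp (continuous_fst.div_const T)
  fun_prop

lemma integrable_traceIntegrand (hη : Continuous η)
    (hη_supp : tsupport η ⊆ Icc (-2 : ℝ) 2) (hT : 0 < T) (hv : IsDuhamelIntegrable v) (x t : ℝ) :
    Integrable (traceIntegrand η T x v t) := by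
  obtain ⟨K, -, hK⟩ := exists_norm_traceIntegrand_le hη hη_supp hT
  refine Integrable.mono' (hv.norm.const_mul K) ?_ (Eventually.of_forall fun z => hK v x t z)
  have h1 := ((continuous_traceIntegrand_uncurry hη T x).comp
    (show Continuous fun z : ℝ × ℝ => (t, z) by fun_prop)).aestronglyMeasurable (μ := volume)
  refine (h1.mul hv.aestronglyMeasurable).congr (Eventually.of_forall fun z => ?_)
  simp only [traceIntegrand, Pi.mul_apply, Function.comp_apply]
  ring

lemma continuous_traceOp (hη : Continuous η) (hη_supp : tsupport η ⊆ Icc (-2 : ℝ) 2) (hT : 0 < T)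
    (hv : IsDuhamelIntegrable v) (x : ℝ) :
    Continuous (traceOp η T x v) := by
  obtain ⟨K, -, hK⟩ := exists_norm_traceIntegrand_le hη hη_supp hT
  unfold traceOp
  refine continuous_const.mul (continuous_of_dominated
    (fun t => (integrable_traceIntegrand hη hη_supp hT hv x t).aestronglyMeasurable)
    (fun t => Eventually.of_forall fun z => hK v x t z) (hv.norm.const_mul K)
    (Eventually.of_forall fun z => ?_))
  have h1 := (continuous_traceIntegrand_uncurry hη T x).comp
    (show Continuous fun t : ℝ => (t, z) by fun_prop)
  refine (h1.mul (continuous_const (y := v z))).congr fun t => ?_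
  simp only [traceIntegrand, Pi.mul_apply, Function.comp_apply]
  ring

lemma traceOp_eq_zero (hη_supp : tsupport η ⊆ Icc (-2 : ℝ) 2) (hT : 0 < T)
    (v : ℝ × ℝ → ℂ) (x : ℝ) {t : ℝ} (ht : 2 * T < |t|) :
    traceOp η T x v t = 0 := by
  simp [traceOp, traceIntegrand, eta_div_eq_zero hη_supp hT ht]

lemma hasCompactSupport_traceOp (hη_supp : tsupport η ⊆ Icc (-2 : ℝ) 2) (hT : 0 < T)
    (v : ℝ × ℝ → ℂ) (x : ℝ) :
    HasCompactSupport (traceOp η T x v) := by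
  refine HasCompactSupport.of_support_subset_isCompact (isCompact_Icc (a := -(2 * T))
    (b := 2 * T)) fun t ht => ?_
  rw [mem_Icc, ← abs_le]
  by_contra! h
  exact ht (traceOp_eq_zero hη_supp hT v x h)

lemma traceOp_sub (hη : Continuous η) (hη_supp : tsupport η ⊆ Icc (-2 : ℝ) 2) (hT : 0 < T)
    {v' : ℝ × ℝ → ℂ} (hv : IsDuhamelIntegrable v) (hv' : IsDuhamelIntegrable v')
    (x t : ℝ) : traceOp η T x v t - traceOp η T x v' t = traceOp η T x (v - v') t := by
  unfold traceOp
  rw [← mul_sub, ← integral_sub (integrable_traceIntegrand hη hη_supp hT hv x t)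
    (integrable_traceIntegrand hη hη_supp hT hv' x t)]
  congr 2
  funext z
  simp only [traceIntegrand, Pi.sub_apply]
  ring

/-- The time Fourier transform of the truncated Duhamel term over a half line. -/
lemma integral_traceOp_mul_osc (hη : Continuous η)
    (hη_supp : tsupport η ⊆ Icc (-2 : ℝ) 2) (hT : 0 < T) (hv : IsDuhamelIntegrable v) (x a τ : ℝ) :
    ∫ t in (0 : ℝ)..T * a, traceOp η T x v t * osc τ t =
      (((2 * Real.pi : ℝ) : ℂ)⁻¹) ^ 2 * ∫ z : ℝ × ℝ,
        (∫ t in (0 : ℝ)..T * a, ((η (t / T) : ℂ) * oscPrimitive (z.2 + z.1 ^ 2) t) *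
          osc (z.1 ^ 2 + τ) t) * (Complex.exp (Complex.I * (x * z.1 : ℝ)) * v z) := by
  obtain ⟨K, -, hK⟩ := exists_norm_traceIntegrand_le hη hη_supp hT
  have hmeas : AEStronglyMeasurable (Function.uncurry fun t z =>
      traceIntegrand η T x v t z * osc τ t)
      ((volume.restrict (uIoc 0 (T * a))).prod (volume : Measure (ℝ × ℝ))) := by
    have h1 := (continuous_traceIntegrand_uncurry hη T x).aestronglyMeasurable
      (μ := (volume.restrict (uIoc 0 (T * a))).prod (volume : Measure (ℝ × ℝ)))
    have h2 : AEStronglyMeasurable (fun p : ℝ × (ℝ × ℝ) => osc τ p.1)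
        ((volume.restrict (uIoc 0 (T * a))).prod (volume : Measure (ℝ × ℝ))) :=
      ((continuous_osc τ).comp continuous_fst).aestronglyMeasurable
    refine ((h1.mul (hv.aestronglyMeasurable.comp_snd)).mul h2).congr
      (Eventually.of_forall fun p => ?_)
    simp only [traceIntegrand, Pi.mul_apply, Function.uncurry]
    ring
  have hint : Integrable (Function.uncurry fun t z => traceIntegrand η T x v t z * osc τ t)
      ((volume.restrict (uIoc 0 (T * a))).prod (volume : Measure (ℝ × ℝ))) := by
    have h1 : Integrable (fun _ : ℝ => K) (volume.restrict (uIoc 0 (T * a))) := by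
      have : IsFiniteMeasure (volume.restrict (uIoc 0 (T * a))) := ⟨by simp [uIoc]⟩
      exact integrable_const K
    refine Integrable.mono' (h1.mul_prod hv.norm) hmeas (Eventually.of_forall fun p => ?_)
    simp only [Function.uncurry, norm_mul, norm_osc, mul_one]
    exact hK v x p.1 p.2
  unfold traceOp
  simp_rw [mul_assoc (_ ^ 2), ← integral_mul_const]
  rw [intervalIntegral.integral_const_mul, intervalIntegral_integral_swap hint]
  congr 2
  funext z
  rw [← intervalIntegral.integral_mul_const]
  refine intervalIntegral.integral_congr fun t _ => ?_
  simp only [traceIntegrand]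
  rw [osc_add]
  ring

end

/-! ### Estimates for the trace -/

/-- The square of the norm of the amplitude `v` in `L²` with the weight `⟨μ + ξ²⟩^{-2b}`. -/
def amplitudeEnergy (b : ℝ) (v : ℝ × ℝ → ℂ) : ℝ≥0∞ :=
  ∫⁻ z : ℝ × ℝ, (ENNReal.ofReal (bracket (z.2 + z.1 ^ 2) ^ (-b)) * ‖v z‖ₑ) ^ 2

lemma amplitudeEnergy_mono {b : ℝ} {v v' : ℝ × ℝ → ℂ} (h : ∀ z, ‖v z‖ ≤ ‖v' z‖) :
    amplitudeEnergy b v ≤ amplitudeEnergy b v' := by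
  refine lintegral_mono fun z => ?_
  gcongr
  exact enorm_le_iff_norm_le.mpr (h z)

lemma amplitudeEnergy_congr {b : ℝ} {v v' : ℝ × ℝ → ℂ} (h : v =ᵐ[volume] v') :
    amplitudeEnergy b v = amplitudeEnergy b v' := by
  refine lintegral_congr_ae ?_
  filter_upwards [h] with z hz
  rw [hz]

/-- Amplitudes of finite energy that are supported in a bounded set of spatial frequencies give
rise to absolutely convergent Duhamel integrals. -/
lemma isDuhamelIntegrable_indicator {b : ℝ} (hb : 0 ≤ b) (hb2 : b < 1 / 2) {v : ℝ × ℝ → ℂ}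
    (hvm : AEStronglyMeasurable v volume) (hv : amplitudeEnergy b v < ⊤) (R : ℝ) :
    IsDuhamelIntegrable ((Prod.fst ⁻¹' Ioc (-R) R).indicator v) := by
  have hms : MeasurableSet (Prod.fst ⁻¹' Ioc (-R) R : Set (ℝ × ℝ)) :=
    measurable_fst measurableSet_Ioc
  have hmi := hvm.indicator hms
  refine ⟨(show Continuous fun z : ℝ × ℝ => (japanese (z.2 + z.1 ^ 2))⁻¹ from
    Continuous.inv₀ (by fun_prop) fun z => (japanese_pos _).ne').aestronglyMeasurable.smul hmi, ?_⟩
  set f : ℝ × ℝ → ℝ≥0∞ := fun z => (Ioc (-R) R).indicator 1 z.1 *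
    ENNReal.ofReal (japanese (z.2 + z.1 ^ 2) ^ (b - 1)) with hf
  set g : ℝ × ℝ → ℝ≥0∞ := fun z =>
    ENNReal.ofReal (bracket (z.2 + z.1 ^ 2) ^ (-b)) * ‖v z‖ₑ with hg
  have hfm : Measurable f := by
    refine Measurable.mul ?_ (by fun_prop)
    exact (measurable_one.indicator measurableSet_Ioc).comp measurable_fst
  have hgm : AEMeasurable g volume := by
    refine AEMeasurable.mul ?_ hvm.enorm
    exact (Continuous.rpow_const (by fun_prop)
      fun z => Or.inl (bracket_pos _).ne').measurable.ennreal_ofReal.aemeasurable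
  have hle : ∀ z : ℝ × ℝ, ‖(japanese (z.2 + z.1 ^ 2))⁻¹ •
      (Prod.fst ⁻¹' Ioc (-R) R).indicator v z‖ₑ ≤ f z * g z := by
    intro z
    by_cases hz : z ∈ Prod.fst ⁻¹' Ioc (-R) R
    · rw [indicator_of_mem hz, hf, hg]
      simp only
      rw [indicator_of_mem (show z.1 ∈ Ioc (-R) R from hz), Pi.one_apply, one_mul, ← mul_assoc,
        enorm_smul]
      gcongr
      have hj := japanese_pos (z.2 + z.1 ^ 2)
      have hbr := bracket_pos (z.2 + z.1 ^ 2)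
      rw [Real.enorm_of_nonneg (inv_nonneg.mpr hj.le),
        ← ENNReal.ofReal_mul (Real.rpow_nonneg hj.le _)]
      refine ENNReal.ofReal_le_ofReal ?_
      rw [Real.rpow_sub hj, Real.rpow_one, Real.rpow_neg hbr.le, div_eq_mul_inv]
      have h1 : bracket (z.2 + z.1 ^ 2) ^ b ≤ japanese (z.2 + z.1 ^ 2) ^ b :=
        Real.rpow_le_rpow hbr.le (bracket_le_japanese _) hb
      have h2 : 0 < bracket (z.2 + z.1 ^ 2) ^ b := Real.rpow_pos_of_pos hbr _
      rw [mul_right_comm]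
      refine le_mul_of_one_le_left (inv_nonneg.mpr hj.le) ?_
      rw [← div_eq_mul_inv, one_le_div h2]
      exact h1
    · rw [indicator_of_notMem hz]
      simp
  have hf2 : ∫⁻ z, f z ^ 2 < ⊤ := by
    have h1 : ∀ z : ℝ × ℝ, f z ^ 2 = (Ioc (-R) R).indicator 1 z.1 *
        ENNReal.ofReal (japanese (z.2 + z.1 ^ 2) ^ (-(2 - 2 * b))) := by
      intro z
      rw [hf, mul_pow, ← ENNReal.ofReal_pow (Real.rpow_nonneg (japanese_pos _).le _),
        ← Real.rpow_natCast, ← Real.rpow_mul (japanese_pos _).le]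
      congr 2
      · by_cases hz : z.1 ∈ Ioc (-R) R <;> simp [hz]
      · push_cast; ring_nf
    have hm2 : Measurable fun z : ℝ × ℝ => (Ioc (-R) R).indicator (1 : ℝ → ℝ≥0∞) z.1 *
        ENNReal.ofReal (japanese (z.2 + z.1 ^ 2) ^ (-(2 - 2 * b))) := by
      refine Measurable.mul ?_ (by fun_prop)
      exact (measurable_one.indicator measurableSet_Ioc).comp measurable_fst
    simp_rw [h1]
    rw [Measure.volume_eq_prod, lintegral_prod _ hm2.aemeasurable]
    have h3 : ∀ ξ : ℝ, ∫⁻ μ : ℝ, ENNReal.ofReal (japanese (μ + ξ ^ 2) ^ (-(2 - 2 * b))) =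
        japaneseIntegral (2 - 2 * b) := fun ξ =>
      lintegral_add_right_eq_self (fun μ => ENNReal.ofReal (japanese μ ^ (-(2 - 2 * b)))) _
    have h4 : ∀ ξ : ℝ, ∫⁻ μ : ℝ, (Ioc (-R) R).indicator (1 : ℝ → ℝ≥0∞) ξ *
        ENNReal.ofReal (japanese (μ + ξ ^ 2) ^ (-(2 - 2 * b))) =
        (Ioc (-R) R).indicator (1 : ℝ → ℝ≥0∞) ξ * japaneseIntegral (2 - 2 * b) := by
      intro ξ
      rw [lintegral_const_mul _ (by fun_prop), h3]
    simp_rw [h4]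
    have hJ := japaneseIntegral_lt_top (p := 2 - 2 * b) (by linarith)
    rw [lintegral_mul_const _ (measurable_one.indicator measurableSet_Ioc),
      lintegral_indicator_one measurableSet_Ioc, Real.volume_Ioc]
    finiteness
  have h := sq_lintegral_mul_le hfm.aemeasurable hgm (ν := volume)
  have hfin : (∫⁻ z, f z * g z) ^ 2 < ⊤ :=
    h.trans_lt (ENNReal.mul_lt_top hf2 hv)
  refine (lintegral_mono hle).trans_lt ?_
  by_contra hne
  rw [not_lt, top_le_iff] at hne
  rw [hne] at hfin
  simp at hfin

/-- Passing from the bracket to its rescaled version costs a power of `T`. -/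
lemma japanese_rpow_neg_le {T T₀ b : ℝ} (hT : 0 < T) (hT₀ : T ≤ T₀) (hb : 0 ≤ b) (y : ℝ) :
    japanese (T * y) ^ (-b) ≤ (max 1 T₀ / T) ^ b * bracket y ^ (-b) := by
  have hj := japanese_pos (T * y)
  have hbr := bracket_pos y
  have hM : 0 < max 1 T₀ := lt_max_of_lt_left one_pos
  have h1 : bracket y ≤ max 1 T₀ / T * japanese (T * y) := by
    refine (bracket_le_japanese y).trans ?_
    rw [div_mul_eq_mul_div, le_div_iff₀ hT]
    unfold japanese
    rw [abs_mul, abs_of_pos hT]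
    have h2 : T ≤ max 1 T₀ := hT₀.trans (le_max_right _ _)
    have h3 : 1 ≤ max 1 T₀ := le_max_left _ _
    nlinarith [mul_nonneg hT.le (abs_nonneg y)]
  have h2 := Real.rpow_le_rpow hbr.le h1 hb
  rw [Real.mul_rpow (by positivity) hj.le] at h2
  rw [Real.rpow_neg hj.le, Real.rpow_neg hbr.le, ← div_eq_mul_inv,
    le_div_iff₀ (Real.rpow_pos_of_pos hbr _), inv_mul_le_iff₀ (Real.rpow_pos_of_pos hj _), mul_comm]
  exact h2.trans (le_of_eq (mul_comm _ _)) |>.trans (le_of_eq (mul_comm _ _))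

lemma bracket_rpow_le {T T₀ b : ℝ} (hT : 0 < T) (hT₀ : T ≤ T₀) (hb : 0 ≤ b) (y : ℝ) :
    bracket y ^ b ≤ (max 1 T₀ / T) ^ b * japanese (T * y) ^ b := by
  have h := japanese_rpow_neg_le hT hT₀ hb y
  have hj := Real.rpow_pos_of_pos (japanese_pos (T * y)) b
  have hbr := Real.rpow_pos_of_pos (bracket_pos y) b
  rw [Real.rpow_neg (japanese_pos _).le, Real.rpow_neg (bracket_pos _).le, ← div_eq_mul_inv,
    le_div_iff₀ hbr, inv_mul_le_iff₀ hj, mul_comm] at h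
  linarith

section

variable {η : ℝ → ℝ}

/-- The trace estimate: on both half lines `τ = ±β²`, the Fourier transform of the truncated
Duhamel term, restricted to positive or to negative times, is controlled in `L²` with the weight
`(1 + √T|β|)²`. -/
lemma exists_lintegral_sq_traceOp_le (hη : ContDiff ℝ ∞ η) (hη_supp : tsupport η ⊆ Icc (-2 : ℝ) 2)
    {b : ℝ} (hb : 0 ≤ b) (hb2 : b < 1 / 2) (T₀ : ℝ) :
    ∃ C : ℝ≥0∞, C < ⊤ ∧ ∀ r : ℝ, 0 < r → r ^ 2 ≤ T₀ → ∀ v : ℝ × ℝ → ℂ, IsDuhamelIntegrable v →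
      ∀ x a s : ℝ, |a| = 2 → |s| = 1 →
      ∫⁻ β : ℝ, (ENNReal.ofReal (japanese (r * β)) *
        ‖∫ t in (0 : ℝ)..r ^ 2 * a, traceOp η (r ^ 2) x v t * osc (s * β ^ 2) t‖ₑ) ^ 2 ≤
      C * ENNReal.ofReal ((r ^ 2) ^ (2 - 2 * b)) * amplitudeEnergy b v := by
  obtain ⟨K, hK0, hK⟩ := exists_norm_duhamelMultiplier_le hη hη_supp
  -- chosen so that `2b = 1 - 4d`
  set d := (1 - 2 * b) / 4 with hd
  set c : ℂ := (((2 * Real.pi : ℝ) : ℂ)⁻¹) ^ 2 with hc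
  set M := max 1 T₀ with hM
  have hM0 : 0 < M := lt_max_of_lt_left one_pos
  have hCd := traceConstant_lt_top (d := d) (by rw [hd]; linarith)
  refine ⟨traceConstant d * ENNReal.ofReal ((‖c‖ * K * M ^ b) ^ 2), by finiteness, ?_⟩
  intro r hr hrT v hv x a s ha hs
  have hr2 : 0 < r ^ 2 := by positivity
  obtain ⟨v', hv'm, hvv'⟩ := hv.aestronglyMeasurable
  set h : ℝ × ℝ → ℝ≥0∞ := fun z =>
    ENNReal.ofReal (bracket (z.2 + z.1 ^ 2) ^ (-b)) * ‖v' z‖ₑ with hh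
  have hhm : Measurable h := by
    refine Measurable.mul ?_ hv'm.enorm
    exact (Continuous.rpow_const (by fun_prop)
      fun z => Or.inl (bracket_pos _).ne').measurable.ennreal_ofReal
  set A : ℝ := ‖c‖ * K * (r ^ 2) ^ 2 * (M / r ^ 2) ^ b with hA
  have hA0 : 0 ≤ A := by positivity
  have hpt : ∀ β, ENNReal.ofReal (japanese (r * β)) *
        ‖∫ t in (0 : ℝ)..r ^ 2 * a, traceOp η (r ^ 2) x v t * osc (s * β ^ 2) t‖ₑ ≤
      ENNReal.ofReal A * ∫⁻ z,
        ENNReal.ofReal (japanese (r * β) * traceKernel r b (s * (r * β) ^ 2) z) * h z := by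
    intro β
    rw [integral_traceOp_mul_osc hη.continuous hη_supp hr2 hv, ← hc, enorm_mul,
      ← lintegral_const_mul' _ _ (by simp)]
    have h1 := enorm_integral_le_lintegral_enorm (μ := volume) fun z : ℝ × ℝ =>
      (∫ t in (0 : ℝ)..r ^ 2 * a, ((η (t / r ^ 2) : ℂ) * oscPrimitive (z.2 + z.1 ^ 2) t) *
          osc (z.1 ^ 2 + s * β ^ 2) t) * (Complex.exp (Complex.I * (x * z.1 : ℝ)) * v z)
    refine (mul_le_mul_right (mul_le_mul_right h1 _) _).trans ?_
    rw [← mul_assoc, ← lintegral_const_mul' _ _ (by finiteness)]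
    refine lintegral_mono_ae ?_
    filter_upwards [hvv'] with z hz
    simp only [hh]
    rw [← hz]
    have hj0 := japanese_pos (r * β)
    have hj1 := Real.rpow_pos_of_pos (japanese_pos (r ^ 2 * (z.2 + z.1 ^ 2))) b
    have hbr := Real.rpow_pos_of_pos (bracket_pos (z.2 + z.1 ^ 2)) (-b)
    have h2 := hK a ha (r ^ 2) hr2 (z.2 + z.1 ^ 2) (z.1 ^ 2 + s * β ^ 2)
    have h3 := japanese_rpow_neg_le hr2 hrT hb (z.2 + z.1 ^ 2)
    rw [Real.rpow_neg (japanese_pos _).le, inv_le_iff_one_le_mul₀' hj1] at h3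
    simp only [← ofReal_norm]
    rw [← ENNReal.ofReal_mul hj0.le, ← ENNReal.ofReal_mul (by positivity),
      ← ENNReal.ofReal_mul hbr.le,
      ← ENNReal.ofReal_mul (mul_nonneg hj0.le (traceKernel_nonneg _ _ _ _)),
      ← ENNReal.ofReal_mul hA0]
    refine ENNReal.ofReal_le_ofReal ?_
    rw [norm_mul, norm_mul, norm_exp_I_mul, one_mul]
    unfold traceKernel
    have e1 : r ^ 2 * z.2 + (r * z.1) ^ 2 = r ^ 2 * (z.2 + z.1 ^ 2) := by ring
    have e2 : s * (r * β) ^ 2 + (r * z.1) ^ 2 = r ^ 2 * (z.1 ^ 2 + s * β ^ 2) := by ring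
    have e3 : s * (r * β) ^ 2 - r ^ 2 * z.2 =
        r ^ 2 * (z.1 ^ 2 + s * β ^ 2 - (z.2 + z.1 ^ 2)) := by ring
    rw [e1, e2, e3, hA]
    set D := (japanese (r ^ 2 * (z.1 ^ 2 + s * β ^ 2)))⁻¹ *
      (japanese (r ^ 2 * (z.1 ^ 2 + s * β ^ 2 - (z.2 + z.1 ^ 2))))⁻¹ with hD
    have hD0 : 0 ≤ D := mul_nonneg (inv_nonneg.mpr (japanese_pos _).le)
      (inv_nonneg.mpr (japanese_pos _).le)
    set m := ‖∫ t in (0 : ℝ)..r ^ 2 * a, ((η (t / r ^ 2) : ℂ) * oscPrimitive (z.2 + z.1 ^ 2) t) *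
          osc (z.1 ^ 2 + s * β ^ 2) t‖
    set P := japanese (r ^ 2 * (z.2 + z.1 ^ 2)) ^ b
    set Q := bracket (z.2 + z.1 ^ 2) ^ (-b)
    calc japanese (r * β) * ‖c‖ * (m * ‖v z‖)
        ≤ japanese (r * β) * ‖c‖ * ((K * (r ^ 2) ^ 2 * D) * ‖v z‖) := by gcongr
      _ = (japanese (r * β) * ‖c‖ * ((K * (r ^ 2) ^ 2 * D) * ‖v z‖)) * 1 := by rw [mul_one]
      _ ≤ (japanese (r * β) * ‖c‖ * ((K * (r ^ 2) ^ 2 * D) * ‖v z‖)) *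
          (P * ((M / r ^ 2) ^ b * Q)) := by
          refine mul_le_mul_of_nonneg_left h3 (by positivity)
      _ = _ := by ring
  calc _ ≤ ∫⁻ β : ℝ, ENNReal.ofReal A ^ 2 * (∫⁻ z,
        ENNReal.ofReal (japanese (r * β) * traceKernel r b (s * (r * β) ^ 2) z) * h z) ^ 2 := by
        refine lintegral_mono fun β => ?_
        rw [← mul_pow]
        exact pow_le_pow_left' (hpt β) 2
    _ = ENNReal.ofReal A ^ 2 * ∫⁻ β : ℝ, (∫⁻ z,
        ENNReal.ofReal (japanese (r * β) * traceKernel r b (s * (r * β) ^ 2) z) * h z) ^ 2 :=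
        lintegral_const_mul' _ _ (by finiteness)
    _ ≤ ENNReal.ofReal A ^ 2 *
        (traceConstant d * ENNReal.ofReal (r ^ 4)⁻¹ * ∫⁻ z, h z ^ 2) := by
        gcongr
        exact lintegral_sq_traceKernel_le hr (by rw [hd]; linarith) (by rw [hd]; linarith)
          (by rw [hd]; ring) hs hhm
    _ = _ := by
        have e1 : ∫⁻ z, h z ^ 2 = amplitudeEnergy b v := (amplitudeEnergy_congr hvv').symm
        have e2 : ENNReal.ofReal A ^ 2 * ENNReal.ofReal (r ^ 4)⁻¹ =
            ENNReal.ofReal ((‖c‖ * K * M ^ b) ^ 2) * ENNReal.ofReal ((r ^ 2) ^ (2 - 2 * b)) := by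
          rw [← ENNReal.ofReal_pow hA0, ← ENNReal.ofReal_mul (by positivity),
            ← ENNReal.ofReal_mul (by positivity)]
          congr 1
          rw [hA, Real.div_rpow hM0.le hr2.le, Real.rpow_sub hr2, show 2 * b = b * 2 by ring,
            Real.rpow_mul hr2.le, Real.rpow_two, Real.rpow_two]
          have := Real.rpow_pos_of_pos hr2 b
          field_simp
        rw [e1]
        calc _ = (ENNReal.ofReal A ^ 2 * ENNReal.ofReal (r ^ 4)⁻¹) *
              (traceConstant d * amplitudeEnergy b v) := by ring
          _ = _ := by rw [e2]; ring

end

section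

variable {η : ℝ → ℝ} {v : ℝ × ℝ → ℂ}

lemma continuous_integral_mul_osc {q : ℝ → ℂ} (hq : Continuous q) (a : ℝ) :
    Continuous fun τ => ∫ t in (0 : ℝ)..a, q t * osc τ t := by
  refine intervalIntegral.continuous_parametric_intervalIntegral_of_continuous'
    (f := fun τ t => q t * osc τ t) ?_ 0 a
  exact (hq.comp continuous_snd).mul continuous_osc_uncurry

lemma enorm_sub_sq_le (a c : ℂ) : ‖a - c‖ₑ ^ 2 ≤ 2 * (‖a‖ₑ ^ 2 + ‖c‖ₑ ^ 2) := by
  have h : ‖a - c‖ ^ 2 ≤ 2 * (‖a‖ ^ 2 + ‖c‖ ^ 2) := by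
    have := norm_sub_le a c
    nlinarith [norm_nonneg (a - c), sq_nonneg (‖a‖ - ‖c‖)]
  simp only [← ofReal_norm]
  rw [← ENNReal.ofReal_pow (norm_nonneg _), ← ENNReal.ofReal_pow (norm_nonneg _),
    ← ENNReal.ofReal_pow (norm_nonneg _), ← ENNReal.ofReal_add (by positivity) (by positivity),
    show (2 : ℝ≥0∞) = ENNReal.ofReal 2 by simp, ← ENNReal.ofReal_mul (by norm_num)]
  exact ENNReal.ofReal_le_ofReal h

/-- The weight `(1 + r|β|)²` on the half lines `τ = ±β²` dominates the `L²` norm on the line. -/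
lemma lintegral_le_lintegral_weighted {r : ℝ} (hr : 0 < r) (A : ℝ → ℂ) :
    ∫⁻ τ, ‖A τ‖ₑ ^ 2 ≤ ENNReal.ofReal r⁻¹ *
      ((∫⁻ β : ℝ, (ENNReal.ofReal (japanese (r * β)) * ‖A (1 * β ^ 2)‖ₑ) ^ 2) +
        ∫⁻ β : ℝ, (ENNReal.ofReal (japanese (r * β)) * ‖A (-1 * β ^ 2)‖ₑ) ^ 2) := by
  rw [lintegral_eq_lintegral_abs_mul_comp_sq, mul_add]
  have hw : ∀ β : ℝ, ENNReal.ofReal |β| ≤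
      ENNReal.ofReal r⁻¹ * ENNReal.ofReal (japanese (r * β)) ^ 2 := by
    intro β
    rw [← ENNReal.ofReal_pow (japanese_pos _).le, ← ENNReal.ofReal_mul (by positivity)]
    refine ENNReal.ofReal_le_ofReal ?_
    rw [inv_mul_eq_div, le_div_iff₀ hr]
    unfold japanese
    rw [abs_mul, abs_of_pos hr]
    nlinarith [mul_nonneg hr.le (abs_nonneg β)]
  rw [← lintegral_const_mul' _ _ (by simp), ← lintegral_const_mul' _ _ (by simp)]
  refine add_le_add (lintegral_mono fun β => ?_) (lintegral_mono fun β => ?_)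
  · rw [mul_pow, ← mul_assoc, one_mul]
    exact mul_le_mul_left (hw β) _
  · rw [mul_pow, ← mul_assoc, neg_one_mul]
    exact mul_le_mul_left (hw β) _

/-- The truncated Duhamel term at a point is bounded in `L²` of time by the energy. -/
lemma exists_eLpNorm_traceOp_le (hη : ContDiff ℝ ∞ η) (hη_supp : tsupport η ⊆ Icc (-2 : ℝ) 2)
    {b : ℝ} (hb : 0 ≤ b) (hb2 : b < 1 / 2) {T : ℝ} (hT : 0 < T) :
    ∃ C : ℝ≥0∞, C < ⊤ ∧ ∀ v : ℝ × ℝ → ℂ, IsDuhamelIntegrable v → ∀ x : ℝ,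
      eLpNorm (traceOp η T x v) 2 volume ^ 2 ≤ C * amplitudeEnergy b v := by
  obtain ⟨r, hr, rfl⟩ : ∃ r : ℝ, 0 < r ∧ r ^ 2 = T :=
    ⟨√T, Real.sqrt_pos.mpr hT, Real.sq_sqrt hT.le⟩
  obtain ⟨C, hC, h⟩ := exists_lintegral_sq_traceOp_le hη hη_supp hb hb2 (r ^ 2)
  set C' := C * ENNReal.ofReal ((r ^ 2) ^ (2 - 2 * b)) with hC'
  refine ⟨ENNReal.ofReal (2 * Real.pi)⁻¹ * (2 * (2 * (ENNReal.ofReal r⁻¹ * (2 * C')))),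
    by finiteness, fun v hv x => ?_⟩
  set q := traceOp η (r ^ 2) x v with hq
  have hqc : Continuous q := continuous_traceOp hη.continuous hη_supp hT hv x
  have hqs : HasCompactSupport q := hasCompactSupport_traceOp hη_supp hT v x
  have hqi : Integrable q := hqc.integrable_of_hasCompactSupport hqs
  have hq2 : MemLp q 2 := hqc.memLp_of_hasCompactSupport hqs
  set A : ℝ → ℝ → ℂ := fun a τ => ∫ t in (0 : ℝ)..r ^ 2 * a, q t * osc τ t with hA
  have hAc : ∀ a, Continuous (A a) := fun a => continuous_integral_mul_osc hqc _
  have hAb : ∀ a, |a| = 2 → ∫⁻ τ, ‖A a τ‖ₑ ^ 2 ≤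
      ENNReal.ofReal r⁻¹ * (2 * C') * amplitudeEnergy b v := by
    intro a ha
    refine (lintegral_le_lintegral_weighted hr (A a)).trans ?_
    rw [mul_assoc, two_mul, add_mul]
    gcongr
    · exact h r hr le_rfl v hv x a 1 ha (by simp)
    · exact h r hr le_rfl v hv x a (-1) ha (by simp)
  -- the integral is split at `t = 0`, since the multiplier bound is for half lines
  have hF : ∀ s, (𝓕⁻ q) s = A 2 (-(2 * Real.pi * s)) - A (-2) (-(2 * Real.pi * s)) := by
    intro s
    have hoc : Continuous fun t => q t * osc (-(2 * Real.pi * s)) t :=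
      hqc.mul (continuous_osc _)
    rw [hA]
    simp only
    rw [intervalIntegral.integral_interval_sub_left (hoc.intervalIntegrable _ _)
      (hoc.intervalIntegrable _ _), intervalIntegral.integral_of_le (by nlinarith),
      ← integral_Icc_eq_integral_Ioc, setIntegral_eq_integral_of_forall_compl_eq_zero,
      Real.fourierInv_eq']
    · refine integral_congr_ae (Eventually.of_forall fun t => ?_)
      simp only [smul_eq_mul, RCLike.inner_apply, conj_trivial, osc]
      rw [mul_comm (q t)]
      congr 2
      push_cast
      ring
    · intro t ht
      rw [mem_Icc, show r ^ 2 * -2 = -(2 * r ^ 2) by ring, show r ^ 2 * 2 = 2 * r ^ 2 by ring,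
        ← abs_le, not_le] at ht
      rw [hq, traceOp_eq_zero hη_supp hT v x ht, zero_mul]
  rw [← eLpNorm_fourierInv hqi hq2, sq_eLpNorm_two]
  have hG : Measurable fun τ => ‖A 2 τ‖ₑ ^ 2 := by
    have := (hAc 2).measurable
    fun_prop
  calc ∫⁻ s, ‖(𝓕⁻ q) s‖ₑ ^ 2
      ≤ ∫⁻ s, (fun τ => 2 * (‖A 2 (-τ)‖ₑ ^ 2 + ‖A (-2) (-τ)‖ₑ ^ 2)) (2 * Real.pi * s) := by
        refine lintegral_mono fun s => ?_
        rw [hF]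
        exact enorm_sub_sq_le _ _
    _ = ENNReal.ofReal (2 * Real.pi)⁻¹ * ∫⁻ τ, 2 * (‖A 2 (-τ)‖ₑ ^ 2 + ‖A (-2) (-τ)‖ₑ ^ 2) :=
        lintegral_comp_mul_left (r := 2 * Real.pi) (by positivity)
          (fun τ => 2 * (‖A 2 (-τ)‖ₑ ^ 2 + ‖A (-2) (-τ)‖ₑ ^ 2))
    _ = ENNReal.ofReal (2 * Real.pi)⁻¹ * (2 * (∫⁻ τ, ‖A 2 τ‖ₑ ^ 2 + ‖A (-2) τ‖ₑ ^ 2)) := by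
        rw [lintegral_const_mul' _ _ (by simp)]
        congr 2
        exact lintegral_neg_eq_self (fun τ => ‖A 2 τ‖ₑ ^ 2 + ‖A (-2) τ‖ₑ ^ 2)
    _ ≤ ENNReal.ofReal (2 * Real.pi)⁻¹ * (2 * (2 * (ENNReal.ofReal r⁻¹ * (2 * C') *
          amplitudeEnergy b v))) := by
        gcongr
        rw [lintegral_add_left hG, two_mul]
        exact add_le_add (hAb 2 (by norm_num)) (hAb (-2) (by norm_num))
    _ = _ := by ring

/-- The amplitude `v` with the spatial frequencies restricted to `-R < ξ ≤ R`. -/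
def truncateAmplitude (v : ℝ × ℝ → ℂ) (R : ℝ) : ℝ × ℝ → ℂ :=
  (Prod.fst ⁻¹' Ioc (-R) R).indicator v

lemma norm_truncateAmplitude_le (R : ℝ) (z : ℝ × ℝ) : ‖truncateAmplitude v R z‖ ≤ ‖v z‖ :=
  norm_indicator_le_norm_self _ _

lemma amplitudeEnergy_truncate_le (b R : ℝ) :
    amplitudeEnergy b (truncateAmplitude v R) ≤ amplitudeEnergy b v :=
  amplitudeEnergy_mono fun z => norm_truncateAmplitude_le R z

lemma tendsto_amplitudeEnergy_sub_truncate {b : ℝ} (hvm : AEStronglyMeasurable v volume)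
    (hv : amplitudeEnergy b v < ⊤) :
    Tendsto (fun R => amplitudeEnergy b (v - truncateAmplitude v R)) atTop (𝓝 0) := by
  wlog hvs : StronglyMeasurable v generalizing v
  · obtain ⟨v', hv'm, hvv'⟩ := hvm
    have h1 : ∀ R, amplitudeEnergy b (v - truncateAmplitude v R) =
        amplitudeEnergy b (v' - truncateAmplitude v' R) := by
      refine fun R => amplitudeEnergy_congr ?_
      filter_upwards [hvv'] with z hz
      by_cases hzR : z ∈ Prod.fst ⁻¹' Ioc (-R) R <;> simp [truncateAmplitude, hzR, hz]
    simp_rw [h1]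
    rw [amplitudeEnergy_congr hvv'] at hv
    exact this hv'm.aestronglyMeasurable hv hv'm
  have h0 : (0 : ℝ≥0∞) = ∫⁻ _ : ℝ × ℝ, 0 := by simp
  rw [h0]
  refine tendsto_lintegral_filter_of_dominated_convergence
    (fun z : ℝ × ℝ => (ENNReal.ofReal (bracket (z.2 + z.1 ^ 2) ^ (-b)) * ‖v z‖ₑ) ^ 2)
    ?_ ?_ hv.ne ?_
  · refine Eventually.of_forall fun R => ?_
    have h1 : Measurable fun z : ℝ × ℝ => ENNReal.ofReal (bracket (z.2 + z.1 ^ 2) ^ (-b)) :=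
      (Continuous.rpow_const (by fun_prop)
        fun z => Or.inl (bracket_pos _).ne').measurable.ennreal_ofReal
    have h2 : StronglyMeasurable (v - truncateAmplitude v R) :=
      hvs.sub (hvs.indicator (measurable_fst measurableSet_Ioc))
    exact (h1.mul h2.enorm).pow_const 2
  · refine Eventually.of_forall fun R => Eventually.of_forall fun z => ?_
    gcongr
    refine enorm_le_iff_norm_le.mpr ?_
    by_cases hz : z ∈ Prod.fst ⁻¹' Ioc (-R) R <;> simp [truncateAmplitude, hz]
  · refine Eventually.of_forall fun z => ?_
    refine tendsto_const_nhds.congr' ?_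
    filter_upwards [eventually_gt_atTop |z.1|] with R hR
    rw [abs_lt] at hR
    have hz : z ∈ Prod.fst ⁻¹' Ioc (-R) R := ⟨hR.1, hR.2.le⟩
    simp [truncateAmplitude, hz]

lemma amplitudeEnergy_truncate_sub_truncate_le (b : ℝ) {R R' : ℝ} (h : R ≤ R') :
    amplitudeEnergy b (truncateAmplitude v R' - truncateAmplitude v R) ≤
      amplitudeEnergy b (v - truncateAmplitude v R) := by
  refine amplitudeEnergy_mono fun z => ?_
  by_cases hz : z ∈ Prod.fst ⁻¹' Ioc (-R) R
  · have hz' : z ∈ Prod.fst ⁻¹' Ioc (-R') R' := ⟨by linarith [hz.1], hz.2.trans h⟩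
    simp [truncateAmplitude, hz, hz']
  · by_cases hz' : z ∈ Prod.fst ⁻¹' Ioc (-R') R' <;> simp [truncateAmplitude, hz, hz']

/-- The iterated integral defining the truncated Duhamel term is an integral over the plane, by
Fubini's theorem. -/
lemma duhamelPartial_eq_traceOp (hη : Continuous η)
    (hη_supp : tsupport η ⊆ Icc (-2 : ℝ) 2) {T : ℝ} (hT : 0 < T) {f : Plane → ℂ} {R : ℝ}
    (hR : 0 ≤ R) (hf : IsDuhamelIntegrable (truncateAmplitude (fun z => f (WithLp.toLp 2 z)) R))
    (x t : ℝ) : duhamelPartial η T f R x t =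
      traceOp η T x (truncateAmplitude (fun z => f (WithLp.toLp 2 z)) R) t := by
  have hint := integrable_traceIntegrand hη hη_supp hT hf x t
  have hD : ∀ ξ, duhamelFourier f ξ t = ((2 * Real.pi : ℝ) : ℂ)⁻¹ *
      ∫ μ : ℝ, osc (ξ ^ 2) t * oscPrimitive (μ + ξ ^ 2) t * f (WithLp.toLp 2 (ξ, μ)) := by
    intro ξ
    unfold duhamelFourier
    congr 2
    funext μ
    congr 1
    unfold oscPrimitive osc
    rw [← intervalIntegral.integral_const_mul]
    refine intervalIntegral.integral_congr fun s _ => ?_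
    simp only [← Complex.exp_add]
    congr 1
    push_cast
    ring
  unfold traceOp duhamelPartial
  rw [Measure.volume_eq_prod] at hint ⊢
  rw [integral_prod _ hint, intervalIntegral.integral_of_le (by linarith),
    ← integral_indicator measurableSet_Ioc, sq, mul_assoc, mul_left_comm]
  congr 1
  rw [← integral_const_mul, ← integral_const_mul]
  congr 1
  funext ξ
  by_cases hξ : ξ ∈ Ioc (-R) R
  · have h1 : ∀ μ, truncateAmplitude (fun z => f (WithLp.toLp 2 z)) R (ξ, μ) =
        f (WithLp.toLp 2 (ξ, μ)) := fun μ =>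
      indicator_of_mem (show (ξ, μ) ∈ Prod.fst ⁻¹' Ioc (-R) R from hξ) _
    have h2 : ∫ μ, traceIntegrand η T x (truncateAmplitude (fun z => f (WithLp.toLp 2 z)) R) t
        (ξ, μ) = (η (t / T) : ℂ) * Complex.exp (Complex.I * (x * ξ : ℝ)) *
        ∫ μ : ℝ, osc (ξ ^ 2) t * oscPrimitive (μ + ξ ^ 2) t * f (WithLp.toLp 2 (ξ, μ)) := by
      rw [← integral_const_mul]
      congr 1
      funext μ
      simp only [traceIntegrand, h1]
      ring
    rw [indicator_of_mem hξ, hD, h2]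
    ring
  · have h1 : ∀ μ, truncateAmplitude (fun z => f (WithLp.toLp 2 z)) R (ξ, μ) = 0 := fun μ =>
      indicator_of_notMem (show (ξ, μ) ∉ Prod.fst ⁻¹' Ioc (-R) R from hξ) _
    rw [indicator_of_notMem hξ]
    simp [traceIntegrand, h1]

end

/-! ### Existence of the trace and its Fourier transform -/

section

variable {η : ℝ → ℝ} {v : ℝ × ℝ → ℂ} {b T : ℝ}

lemma tendsto_zero_of_sq {ι : Type*} {l : Filter ι} {g : ι → ℝ≥0∞}
    (h : Tendsto (fun i => g i ^ 2) l (𝓝 0)) : Tendsto g l (𝓝 0) := by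
  have h2 := (ENNReal.continuous_rpow_const (y := (1 / 2 : ℝ))).tendsto 0 |>.comp h
  have h0 : (0 : ℝ≥0∞) ^ (1 / 2 : ℝ) = 0 := ENNReal.zero_rpow_of_pos (by norm_num)
  rw [h0] at h2
  refine h2.congr fun i => ?_
  simp only [Function.comp_apply]
  rw [← ENNReal.rpow_natCast, ← ENNReal.rpow_mul]
  norm_num

/-- The truncated Duhamel terms with spatial frequencies `|ξ| ≤ R` converge in `L²` of time. -/
lemma exists_tendsto_traceOp (hη : ContDiff ℝ ∞ η) (hη_supp : tsupport η ⊆ Icc (-2 : ℝ) 2)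
    (hb : 0 ≤ b) (hb2 : b < 1 / 2) (hT : 0 < T) (hvm : AEStronglyMeasurable v volume)
    (hv : amplitudeEnergy b v < ⊤) (x : ℝ) :
    ∃ g : Lp ℂ 2 (volume : Measure ℝ), Tendsto (fun R : ℝ => eLpNorm
      (fun t => g t - traceOp η T x (truncateAmplitude v R) t) 2 volume) atTop (𝓝 0) := by
  have hadm : ∀ R, IsDuhamelIntegrable (truncateAmplitude v R) := fun R =>
    isDuhamelIntegrable_indicator hb hb2 hvm hv R
  obtain ⟨C, hC, hCv⟩ := exists_eLpNorm_traceOp_le hη hη_supp hb hb2 hT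
  set q : ℝ → ℝ → ℂ := fun R => traceOp η T x (truncateAmplitude v R) with hq
  have hq2 : ∀ R, MemLp (q R) 2 := fun R =>
    (continuous_traceOp hη.continuous hη_supp hT (hadm R) x).memLp_of_hasCompactSupport
      (hasCompactSupport_traceOp hη_supp hT _ x)
  have hdiff : ∀ R R', R ≤ R' → eLpNorm (q R' - q R) 2 volume ^ 2 ≤
      C * amplitudeEnergy b (v - truncateAmplitude v R) := by
    intro R R' hRR'
    have h1 : q R' - q R = traceOp η T x (truncateAmplitude v R' - truncateAmplitude v R) := by
      funext t
      exact traceOp_sub hη.continuous hη_supp hT (hadm R') (hadm R) x t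
    rw [h1]
    refine (hCv _ ?_ x).trans (by gcongr; exact amplitudeEnergy_truncate_sub_truncate_le b hRR')
    have h2 := Integrable.sub (hadm R') (hadm R)
    refine h2.congr (Eventually.of_forall fun z => ?_)
    simp [mul_sub]
  have hlim : Tendsto (fun R => C * amplitudeEnergy b (v - truncateAmplitude v R)) atTop (𝓝 0) := by
    have := ENNReal.Tendsto.const_mul (a := C)
      (tendsto_amplitudeEnergy_sub_truncate hvm hv) (Or.inr hC.ne)
    simpa using this
  have hcauchy : CauchySeq fun R => (hq2 R).toLp (q R) := by
    rw [EMetric.cauchySeq_iff']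
    intro ε hε
    have hε2 : (0 : ℝ≥0∞) < ε ^ 2 := by positivity
    obtain ⟨N, hN⟩ := (hlim.eventually (gt_mem_nhds hε2)).exists
    refine ⟨N, fun n hn => ?_⟩
    rw [Lp.edist_toLp_toLp]
    by_contra! hle
    exact absurd ((hdiff N n hn).trans_lt hN) (not_lt.mpr (pow_le_pow_left' hle 2))
  obtain ⟨g, hg⟩ := cauchySeq_tendsto_of_complete hcauchy
  refine ⟨g, ?_⟩
  rw [Lp.tendsto_Lp_iff_tendsto_eLpNorm'] at hg
  refine hg.congr fun R => ?_
  rw [← eLpNorm_neg]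
  refine eLpNorm_congr_ae ?_
  filter_upwards [(hq2 R).coeFn_toLp] with t ht
  rw [Pi.neg_apply, Pi.sub_apply, ht, neg_sub]

lemma exists_isTruncatedDuhamel (hη : ContDiff ℝ ∞ η) (hη_supp : tsupport η ⊆ Icc (-2 : ℝ) 2)
    (hb : 0 ≤ b) (hb2 : b < 1 / 2) (hT : 0 < T) {F : 𝓢'(Plane, ℂ)} {f : Plane → ℂ}
    (hf : HasFourierFunction F f)
    (hfe : amplitudeEnergy b (fun z => f (WithLp.toLp 2 z)) < ⊤) :
    ∃ w : ℝ → Lp ℂ 2 (volume : Measure ℝ), IsTruncatedDuhamel η T F w := by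
  have hvm : AEStronglyMeasurable (fun z : ℝ × ℝ => f (WithLp.toLp 2 z)) volume :=
    hf.aestronglyMeasurable.comp_measurePreserving (WithLp.volume_preserving_toLp ℝ ℝ)
  choose w hw using exists_tendsto_traceOp hη hη_supp hb hb2 hT hvm hfe
  refine ⟨w, f, hf, fun x => (hw x).congr' ?_⟩
  filter_upwards [eventually_ge_atTop 0] with R hR
  simp_rw [duhamelPartial_eq_traceOp hη.continuous hη_supp hT hR
    (isDuhamelIntegrable_indicator hb hb2 hvm hfe R)]

lemma ae_eq_zero_of_tendsto {q : ℝ → ℂ} {Q : ℝ → ℝ → ℂ} {S : Set ℝ} (hS : MeasurableSet S)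
    (hqm : AEStronglyMeasurable q volume)
    (h : Tendsto (fun R => eLpNorm (fun t => q t - Q R t) 2 volume) atTop (𝓝 0))
    (hQ : ∀ R, ∀ t ∈ S, Q R t = 0) : ∀ᵐ t, t ∈ S → q t = 0 := by
  rw [← ae_restrict_iff' hS]
  have h0 : eLpNorm q 2 (volume.restrict S) = 0 := by
    refine le_antisymm (ge_of_tendsto' h fun R => ?_) zero_le
    have : eLpNorm q 2 (volume.restrict S) =
        eLpNorm (fun t => q t - Q R t) 2 (volume.restrict S) := by
      refine eLpNorm_congr_ae ?_
      filter_upwards [ae_restrict_mem hS] with t ht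
      rw [hQ R t ht, sub_zero]
    rw [this]
    exact eLpNorm_mono_measure _ Measure.restrict_le_self
  exact (eLpNorm_eq_zero_iff hqm.restrict (by norm_num)).mp h0

lemma boundaryFourier_eq {q : ℝ → ℂ} (hT : 0 < T) (hq0 : ∀ᵐ t, 2 * T < |t| → q t = 0)
    (τ : ℝ) : boundaryFourier q τ = ∫ t in (0 : ℝ)..T * 2, q t * osc τ t := by
  rw [intervalIntegral.integral_of_le (by positivity), ← integral_Icc_eq_integral_Ioc]
  unfold boundaryFourier
  have h1 : ∫ t in Ici (0 : ℝ), Complex.exp (-Complex.I * (t * τ : ℝ)) * q t =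
      ∫ t in Icc (0 : ℝ) (T * 2), Complex.exp (-Complex.I * (t * τ : ℝ)) * q t := by
    refine setIntegral_eq_of_subset_of_ae_sdiff_eq_zero measurableSet_Ici.nullMeasurableSet
      Icc_subset_Ici_self ?_
    filter_upwards [hq0] with t ht hmem
    have h0 : (0 : ℝ) ≤ t := hmem.1
    have h2 : 2 * T < |t| := by
      rw [abs_of_nonneg h0]
      by_contra! h3
      exact hmem.2 ⟨h0, by linarith⟩
    rw [ht h2, mul_zero]
  rw [h1]
  refine integral_congr_ae (Eventually.of_forall fun t => ?_)
  simp only [osc]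
  ring

/-- On a bounded time interval, convergence in `L²` implies pointwise convergence of the Fourier
transforms. -/
lemma tendsto_integral_mul_osc {q : ℝ → ℂ} {Q : ℝ → ℝ → ℂ} (hT : 0 < T) (hq : MemLp q 2)
    (hQ : ∀ R, MemLp (Q R) 2)
    (h : Tendsto (fun R => eLpNorm (fun t => q t - Q R t) 2 volume) atTop (𝓝 0)) (τ : ℝ) :
    Tendsto (fun R => ∫ t in (0 : ℝ)..T * 2, Q R t * osc τ t) atTop
      (𝓝 (∫ t in (0 : ℝ)..T * 2, q t * osc τ t)) := by
  simp_rw [intervalIntegral.integral_of_le (show (0 : ℝ) ≤ T * 2 by positivity)]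
  set μ : Measure ℝ := volume.restrict (Ioc 0 (T * 2))
  have : IsFiniteMeasure μ := ⟨by simp [μ]⟩
  have hosc : ∀ {p : ℝ → ℂ}, MemLp p 2 → Integrable (fun t => p t * osc τ t) μ := by
    intro p hp
    have h1 : Integrable p μ := (hp.restrict _).integrable (by norm_num)
    refine h1.mul_bdd (c := 1) (continuous_osc τ).aestronglyMeasurable
      (Eventually.of_forall fun t => (norm_osc τ t).le)
  refine tendsto_integral_of_L1' _ (hosc hq).aestronglyMeasurable
    (Eventually.of_forall fun R => hosc (hQ R)) ?_
  have hbound : ∀ R, eLpNorm ((fun t => Q R t * osc τ t) - fun t => q t * osc τ t) 1 μ ≤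
      eLpNorm (fun t => q t - Q R t) 2 volume * μ univ ^ (1 / (1 : ℝ) - 1 / 2) := by
    intro R
    have h1 : eLpNorm ((fun t => Q R t * osc τ t) - fun t => q t * osc τ t) 1 μ =
        eLpNorm (fun t => q t - Q R t) 1 μ := by
      refine eLpNorm_congr_norm_ae (Eventually.of_forall fun t => ?_)
      rw [Pi.sub_apply, ← sub_mul, norm_mul, norm_osc, mul_one, norm_sub_rev]
    rw [h1]
    have h2 := eLpNorm_le_eLpNorm_mul_rpow_measure_univ (μ := μ) (p := 1) (q := 2)
      (f := fun t => q t - Q R t) (by norm_num)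
      (hq.aestronglyMeasurable.sub (hQ R).aestronglyMeasurable).restrict
    refine h2.trans ?_
    simp only [ENNReal.toReal_one, ENNReal.toReal_ofNat]
    gcongr
    exact Measure.restrict_le_self
  refine tendsto_of_tendsto_of_tendsto_of_le_of_le tendsto_const_nhds ?_
    (fun _ => zero_le) hbound
  have hfin : μ univ ^ (1 / (1 : ℝ) - 1 / 2) ≠ ⊤ :=
    ENNReal.rpow_ne_top_of_nonneg (by norm_num) (measure_ne_top μ _)
  simpa using ENNReal.Tendsto.mul_const h (Or.inr hfin)

/-- The square of the norm of `p` in `L²` with the weight `(1 + r|β|)²`. For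
`p(β) = (χ g)^(±β²)` it controls the square of the `H^{1/4}` norm of `χ g`, and more at low
frequencies. -/
def dataEnergy (r : ℝ) (p : ℝ → ℂ) : ℝ≥0∞ :=
  ∫⁻ β : ℝ, (ENNReal.ofReal (japanese (r * β)) * ‖p β‖ₑ) ^ 2

/-- The estimate for the trace of the Duhamel term on the boundary. -/
lemma exists_dataEnergy_boundaryFourier_le (hη : ContDiff ℝ ∞ η)
    (hη_supp : tsupport η ⊆ Icc (-2 : ℝ) 2)
    (hb : 0 ≤ b) (hb2 : b < 1 / 2) (T₀ : ℝ) :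
    ∃ C : ℝ≥0∞, C < ⊤ ∧ ∀ r : ℝ, 0 < r → r ^ 2 ≤ T₀ → ∀ f : Plane → ℂ,
      AEStronglyMeasurable f volume →
      amplitudeEnergy b (fun z => f (WithLp.toLp 2 z)) < ⊤ → ∀ g : Lp ℂ 2 (volume : Measure ℝ),
      Tendsto (fun R : ℝ => eLpNorm
        (fun t : ℝ => g t - duhamelPartial η (r ^ 2) f R 0 t) 2 volume) atTop (𝓝 0) →
      (∀ᵐ t, 2 * r ^ 2 < |t| → g t = 0) ∧
      ∀ s : ℝ, |s| = 1 → dataEnergy r (fun β => boundaryFourier g (s * β ^ 2)) ≤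
        C * ENNReal.ofReal ((r ^ 2) ^ (2 - 2 * b)) *
          amplitudeEnergy b (fun z => f (WithLp.toLp 2 z)) := by
  obtain ⟨C, hC, hCv⟩ := exists_lintegral_sq_traceOp_le hη hη_supp hb hb2 T₀
  refine ⟨C, hC, fun r hr hrT f hfm hfe g hg => ?_⟩
  have hr2 : 0 < r ^ 2 := by positivity
  have hvm : AEStronglyMeasurable (fun z : ℝ × ℝ => f (WithLp.toLp 2 z)) volume :=
    hfm.comp_measurePreserving (WithLp.volume_preserving_toLp ℝ ℝ)
  set v : ℝ × ℝ → ℂ := fun z => f (WithLp.toLp 2 z)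
  have hadm : ∀ R, IsDuhamelIntegrable (truncateAmplitude v R) := fun R =>
    isDuhamelIntegrable_indicator hb hb2 hvm hfe R
  set Q : ℝ → ℝ → ℂ := fun R => traceOp η (r ^ 2) 0 (truncateAmplitude v R) with hQ
  have hQc : ∀ R, Continuous (Q R) := fun R =>
    continuous_traceOp hη.continuous hη_supp hr2 (hadm R) 0
  have hQ2 : ∀ R, MemLp (Q R) 2 := fun R => (hQc R).memLp_of_hasCompactSupport
      (hasCompactSupport_traceOp hη_supp hr2 _ 0)
  have hg' : Tendsto (fun R : ℝ => eLpNorm (fun t : ℝ => g t - Q R t) 2 volume) atTop (𝓝 0) := by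
    refine hg.congr' ?_
    filter_upwards [eventually_ge_atTop 0] with R hR
    simp_rw [duhamelPartial_eq_traceOp hη.continuous hη_supp hr2 hR (hadm R)]
    rfl
  have hg0 : ∀ᵐ t, 2 * r ^ 2 < |t| → g t = 0 :=
    ae_eq_zero_of_tendsto (S := {t | 2 * r ^ 2 < |t|})
      (measurableSet_lt measurable_const (by fun_prop)) (Lp.aestronglyMeasurable g) hg'
      fun R t ht => traceOp_eq_zero hη_supp hr2 _ _ ht
  refine ⟨hg0, fun s hs => ?_⟩
  set A : ℝ → ℝ → ℂ := fun R τ => ∫ t in (0 : ℝ)..r ^ 2 * 2, Q R t * osc τ t with hA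
  have hlim : ∀ τ, Tendsto (fun n : ℕ => A n τ) atTop (𝓝 (boundaryFourier g τ)) := by
    intro τ
    rw [boundaryFourier_eq hr2 hg0]
    exact (tendsto_integral_mul_osc hr2 (Lp.memLp g) hQ2 hg' τ).comp tendsto_natCast_atTop_atTop
  have hlim2 : ∀ β : ℝ, Tendsto (fun n : ℕ =>
      (ENNReal.ofReal (japanese (r * β)) * ‖A n (s * β ^ 2)‖ₑ) ^ 2) atTop
      (𝓝 ((ENNReal.ofReal (japanese (r * β)) * ‖boundaryFourier g (s * β ^ 2)‖ₑ) ^ 2)) := by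
    intro β
    have h1 := ENNReal.Tendsto.const_mul (a := ENNReal.ofReal (japanese (r * β)))
      (hlim (s * β ^ 2)).enorm (Or.inr (by simp))
    exact ((ENNReal.continuous_pow 2).tendsto _).comp h1
  -- Fatou's lemma, along integer truncations
  unfold dataEnergy
  simp_rw [fun β => (hlim2 β).liminf_eq.symm]
  refine (lintegral_liminf_le' fun n => ?_).trans ?_
  · have hAc : Continuous (A n) := continuous_integral_mul_osc (hQc n) _
    have : Measurable fun β : ℝ => ‖A n (s * β ^ 2)‖ₑ :=
      (hAc.comp (by fun_prop : Continuous fun β : ℝ => s * β ^ 2)).measurable.enorm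
    fun_prop
  · refine liminf_le_of_frequently_le' (Frequently.of_forall fun n => ?_)
    refine (hCv r hr hrT _ (hadm n) 0 2 s (by norm_num) hs).trans ?_
    gcongr
    exact amplitudeEnergy_truncate_le b n

end

/-! ### Symbols of the boundary flow -/

/-- The profile `e^{-y} ρ(y)` is a Schwartz function. -/
lemma exists_schwartz_exp_neg_mul {ρ : ℝ → ℝ} (hρ : ContDiff ℝ ∞ ρ)
    (hρ_one : ∀ y : ℝ, 0 ≤ y → ρ y = 1) (hρ_supp : BddBelow (Function.support ρ)) :
    ∃ φ : 𝓢(ℝ, ℂ), ∀ y, φ y = ((Real.exp (-y) * ρ y : ℝ) : ℂ) := by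
  set g : ℝ → ℝ := fun y => Real.exp (-y) * ρ y with hg
  have hgs : ContDiff ℝ ∞ g := by fun_prop
  obtain ⟨a, ha⟩ := hρ_supp
  have hlow : ∀ y < a, ∀ n, iteratedFDeriv ℝ n g y = 0 := by
    intro y hy n
    have h1 : g =ᶠ[𝓝 y] fun _ => 0 := by
      filter_upwards [Iio_mem_nhds hy] with z hz
      have : ρ z = 0 := by
        by_contra hne
        exact absurd (ha hne) (not_le.mpr hz)
      simp [hg, this]
    rw [(h1.iteratedFDeriv ℝ n).self_of_nhds]
    exact congrFun (iteratedFDeriv_fun_zero (𝕜 := ℝ) (E := ℝ) (F := ℝ) (n := n)) y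
  have hup : ∀ y > 0, ∀ n, ‖iteratedFDeriv ℝ n g y‖ = Real.exp (-y) := by
    intro y hy n
    have h1 : g =ᶠ[𝓝 y] fun z => Real.exp (-z) := by
      filter_upwards [Ioi_mem_nhds hy] with z hz
      simp [hg, hρ_one z (le_of_lt hz)]
    rw [(h1.iteratedFDeriv ℝ n).self_of_nhds, norm_iteratedFDeriv_eq_norm_iteratedDeriv,
      iteratedDeriv_comp_neg, iteratedDeriv_eq_iterate, Real.iter_deriv_exp, norm_smul]
    simp
  have hdecay : ∀ k n : ℕ, ∃ C : ℝ, ∀ y : ℝ, ‖y‖ ^ k * ‖iteratedFDeriv ℝ n g y‖ ≤ C := by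
    intro k n
    have hc : Continuous fun y : ℝ => ‖y‖ ^ k * ‖iteratedFDeriv ℝ n g y‖ :=
      (continuous_norm.pow k).mul
        (hgs.continuous_iteratedFDeriv (by exact_mod_cast le_top)).norm
    obtain ⟨C, hC⟩ := (isCompact_Icc (a := a) (b := 0)).exists_bound_of_continuousOn hc.continuousOn
    refine ⟨max C k.factorial, fun y => ?_⟩
    rcases lt_or_ge y a with hya | hya
    · rw [hlow y hya, norm_zero, mul_zero]
      exact le_max_of_le_right (by positivity)
    rcases le_or_gt y 0 with hy0 | hy0
    · exact le_max_of_le_left ((le_abs_self _).trans (hC y ⟨hya, hy0⟩))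
    · refine le_max_of_le_right ?_
      rw [hup y hy0, Real.norm_of_nonneg hy0.le, Real.exp_neg, ← div_eq_mul_inv,
        div_le_iff₀ (Real.exp_pos y)]
      have := Real.pow_div_factorial_le_exp y hy0.le k
      rw [div_le_iff₀ (by positivity)] at this
      linarith
  refine ⟨⟨fun y => ((g y : ℝ) : ℂ), Complex.ofRealCLM.contDiff.comp hgs, fun k n => ?_⟩,
    fun y => rfl⟩
  obtain ⟨C, hC⟩ := hdecay k n
  refine ⟨C, fun y => ?_⟩
  have h1 : ‖iteratedFDeriv ℝ n (fun y => ((g y : ℝ) : ℂ)) y‖ = ‖iteratedFDeriv ℝ n g y‖ :=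
    Complex.ofRealLI.norm_iteratedFDeriv_comp_left (f := g)
      (hgs.contDiffAt.of_le (by exact_mod_cast le_top)) le_rfl
  rw [h1]
  exact hC y

/-- `n` is a rapidly decaying function whose inverse Fourier transform is `h`:
`h(t) = (2π)⁻¹ ∫ e^{iyt} n(y) dy`. Only cubic decay is recorded. -/
structure IsSymbol (n h : ℝ → ℂ) (K : ℝ) : Prop where
  continuous : Continuous n
  norm_le : ∀ y, ‖n y‖ ≤ K * japanese y ^ (-3 : ℝ)
  integral_eq : ∀ t, ∫ y : ℝ, Complex.exp (Complex.I * (y * t : ℝ)) * n y = 2 * Real.pi * h t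

lemma exists_isSymbol (φ : 𝓢(ℝ, ℂ)) : ∃ (n : ℝ → ℂ) (K : ℝ), 0 ≤ K ∧ IsSymbol n φ K := by
  set ψ : 𝓢(ℝ, ℂ) := 𝓕 φ with hψ
  obtain ⟨C0, hC0, h0⟩ := ψ.decay 0 0
  obtain ⟨C3, hC3, h3⟩ := ψ.decay 3 0
  refine ⟨fun y => ψ (y / (2 * Real.pi)), 4 * C0 + 4 * (2 * Real.pi) ^ 3 * C3, by positivity,
    ψ.continuous.comp (by fun_prop), fun y => ?_, fun t => ?_⟩
  · have h0' := h0 (y / (2 * Real.pi))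
    have h3' := h3 (y / (2 * Real.pi))
    simp only [norm_iteratedFDeriv_zero, pow_zero, one_mul] at h0' h3'
    rw [norm_div, div_pow, Real.norm_of_nonneg (r := 2 * Real.pi) (by positivity),
      Real.norm_eq_abs, div_mul_eq_mul_div, div_le_iff₀ (by positivity)] at h3'
    rw [Real.rpow_neg (japanese_pos _).le, ← div_eq_mul_inv,
      le_div_iff₀ (Real.rpow_pos_of_pos (japanese_pos _) _)]
    have hj : japanese y ^ (3 : ℝ) ≤ 4 + 4 * |y| ^ 3 := by
      rw [show (3 : ℝ) = ((3 : ℕ) : ℝ) by norm_num, Real.rpow_natCast]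
      unfold japanese
      have := abs_nonneg y
      nlinarith [mul_nonneg (add_nonneg zero_le_one this) (sq_nonneg (1 - |y|))]
    calc ‖ψ (y / (2 * Real.pi))‖ * japanese y ^ (3 : ℝ)
        ≤ ‖ψ (y / (2 * Real.pi))‖ * (4 + 4 * |y| ^ 3) := by gcongr
      _ ≤ _ := by linarith
  · have h1 := Measure.integral_comp_div
      (fun u : ℝ => Complex.exp (2 * Real.pi * Complex.I * (u * t)) * ψ u) (2 * Real.pi)
    have h2 : ∫ u : ℝ, Complex.exp (2 * Real.pi * Complex.I * (u * t)) * ψ u = φ t := by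
      have h3 : (𝓕⁻ ψ) t = φ t := by rw [hψ, FourierTransform.fourierInv_fourier_eq]
      rw [← h3, SchwartzMap.fourierInv_coe, Real.fourierInv_eq']
      refine integral_congr_ae (Eventually.of_forall fun u => ?_)
      simp only [smul_eq_mul, RCLike.inner_apply, conj_trivial]
      congr 2
      push_cast
      ring
    rw [h2, abs_of_pos (by positivity), Complex.real_smul] at h1
    push_cast at h1
    rw [← h1]
    refine integral_congr_ae (Eventually.of_forall fun y => ?_)
    simp only
    congr 2
    push_cast
    have : (Real.pi : ℂ) ≠ 0 := by exact_mod_cast Real.pi_ne_zero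
    field_simp

namespace IsSymbol

variable {n h : ℝ → ℂ} {K : ℝ}

lemma integrable (hn : IsSymbol n h K) : Integrable n := by
  have h1 : Integrable fun y : ℝ => K * japanese y ^ (-3 : ℝ) := by
    have := integrable_one_add_norm (E := ℝ) (μ := volume) (r := 3) (by norm_num)
    exact this.const_mul K
  exact h1.mono' hn.continuous.aestronglyMeasurable (Eventually.of_forall hn.norm_le)

/-- The inverse Fourier transform of a translated and dilated symbol. -/
lemma integral_comp (hn : IsSymbol n h K) {T : ℝ} (hT : 0 < T) (c t : ℝ) :
    ∫ τ : ℝ, Complex.exp (Complex.I * (τ * t : ℝ)) * (T * n (T * (τ + c))) =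
      Complex.exp (-Complex.I * (c * t : ℝ)) * (2 * Real.pi * h (t / T)) := by
  have h1 := integral_add_right_eq_self (μ := (volume : Measure ℝ))
    (fun τ : ℝ => Complex.exp (Complex.I * ((τ - c) * t : ℝ)) * (T * n (T * τ))) c
  simp only [add_sub_cancel_right] at h1
  have h2 := Measure.integral_comp_mul_left
    (fun y : ℝ => Complex.exp (Complex.I * (y * (t / T) : ℝ)) * n y) T
  rw [hn.integral_eq, abs_of_pos (inv_pos.mpr hT), Complex.real_smul] at h2
  rw [h1]
  have h3 : ∀ τ : ℝ, Complex.exp (Complex.I * ((τ - c) * t : ℝ)) * (T * n (T * τ)) =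
      (Complex.exp (-Complex.I * (c * t : ℝ)) * T) *
        (Complex.exp (Complex.I * (T * τ * (t / T) : ℝ)) * n (T * τ)) := by
    intro τ
    rw [show T * τ * (t / T) = τ * t by field_simp, show Complex.I * ((τ - c) * t : ℝ) =
      -Complex.I * (c * t : ℝ) + Complex.I * (τ * t : ℝ) by push_cast; ring, Complex.exp_add]
    ring
  simp_rw [h3]
  rw [integral_const_mul, h2, mul_assoc]
  congr 1
  rw [← mul_assoc, ← Complex.ofReal_mul, mul_inv_cancel₀ hT.ne', Complex.ofReal_one, one_mul]

end IsSymbol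

/-! ### The boundary flow on the Fourier side -/

/-- The space-time Fourier transform of the oscillating part of the truncated boundary flow: a free
Schrödinger wave with spatial Fourier transform `2ξ p(ξ)`, where `n` is the Fourier transform of the
time cut-off. -/
def waveFourier (n : ℝ → ℂ) (T : ℝ) (p : ℝ → ℂ) (z : ℝ × ℝ) : ℂ :=
  2 * z.1 * p z.1 * (T * n (T * (z.2 + z.1 ^ 2)))

/-- The integrand of `evanescentFourier`. -/
def evanescentIntegrand (n κ : ℝ → ℂ) (T : ℝ) (m : ℝ → ℂ) (z : ℝ × ℝ) (β : ℝ) : ℂ :=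
  (T * n (T * (z.2 + -β ^ 2))) * κ (z.1 / β) * m β

/-- The space-time Fourier transform of the evanescent part of the truncated boundary flow, where
`n` and `κ` are the Fourier transforms of the time cut-off and of the profile `e^{-y} ρ(y)`. -/
def evanescentFourier (n κ : ℝ → ℂ) (T : ℝ) (m : ℝ → ℂ) (z : ℝ × ℝ) : ℂ :=
  (Real.pi : ℂ)⁻¹ * ∫ β : ℝ, evanescentIntegrand n κ T m z β

/-- The square of the `X^{0,b}` norm of the function with Fourier transform `V`. -/
def flowEnergy (b : ℝ) (V : ℝ × ℝ → ℂ) : ℝ≥0∞ :=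
  ∫⁻ z : ℝ × ℝ, (ENNReal.ofReal (bracket (z.2 + z.1 ^ 2) ^ b) * ‖V z‖ₑ) ^ 2

section

variable {n h κ k : ℝ → ℂ} {K K' b T₀ r : ℝ} {p m : ℝ → ℂ}

lemma measurable_bracket_rpow (b : ℝ) :
    Measurable fun z : ℝ × ℝ => ENNReal.ofReal (bracket (z.2 + z.1 ^ 2) ^ b) :=
  (Continuous.rpow_const (by fun_prop)
    fun z => Or.inl (bracket_pos _).ne').measurable.ennreal_ofReal

lemma measurable_waveFourier (hn : Continuous n) (T : ℝ) (hp : Measurable p) :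
    Measurable (waveFourier n T p) := by
  unfold waveFourier
  have h1 : Measurable fun z : ℝ × ℝ => n (T * (z.2 + z.1 ^ 2)) :=
    (hn.comp (by fun_prop)).measurable
  fun_prop

lemma measurable_evanescentIntegrand (hn : Continuous n) (hκ : Continuous κ) (T : ℝ)
    (hm : Measurable m) : Measurable (Function.uncurry (evanescentIntegrand n κ T m)) := by
  unfold evanescentIntegrand Function.uncurry
  have h1 : Measurable fun q : (ℝ × ℝ) × ℝ => n (T * (q.1.2 + -q.2 ^ 2)) :=
    (hn.comp (by fun_prop)).measurable
  have h2 : Measurable fun q : (ℝ × ℝ) × ℝ => κ (q.1.1 / q.2) :=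
    hκ.measurable.comp (by fun_prop)
  fun_prop

lemma measurable_evanescentFourier (hn : Continuous n) (hκ : Continuous κ) (T : ℝ)
    (hm : Measurable m) : Measurable (evanescentFourier n κ T m) := by
  have h1 := (measurable_evanescentIntegrand hn hκ T hm).stronglyMeasurable.integral_prod_right'
    (ν := (volume : Measure ℝ))
  exact h1.measurable.const_mul _

lemma lintegral_japanese_mul_add {T : ℝ} (hT : 0 < T) (q c : ℝ) :
    ∫⁻ τ : ℝ, ENNReal.ofReal (japanese (T * (τ + c)) ^ (-q)) =
      ENNReal.ofReal T⁻¹ * japaneseIntegral q := by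
  rw [lintegral_add_right_eq_self (fun τ => ENNReal.ofReal (japanese (T * τ) ^ (-q))) c,
    lintegral_comp_mul_left hT fun τ => ENNReal.ofReal (japanese τ ^ (-q))]
  rfl

/-- The constant in the bounds for the boundary flow. -/
def flowConstant (b T₀ K K' : ℝ) : ℝ≥0∞ :=
  ENNReal.ofReal (4 * (K * max 1 T₀ ^ b) ^ 2) * japaneseIntegral 2 +
    ENNReal.ofReal ((K * K' * max 1 T₀ ^ b) ^ 2) * japaneseIntegral 2 ^ 3

lemma flowConstant_lt_top : flowConstant b T₀ K K' < ⊤ := by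
  have := japaneseIntegral_lt_top (p := 2) (by norm_num)
  unfold flowConstant
  finiteness

lemma sq_max_div_rpow_mul {r T₀ b : ℝ} (hr : 0 < r) (c : ℝ) :
    (c * (max 1 T₀ / r ^ 2) ^ b) ^ 2 = (c * max 1 T₀ ^ b) ^ 2 * (r ^ 2) ^ (-(2 * b)) := by
  have hr2 : 0 < r ^ 2 := by positivity
  have hM : 0 < max 1 T₀ := lt_max_of_lt_left one_pos
  have h1 := Real.rpow_pos_of_pos hr2 b
  rw [Real.div_rpow hM.le hr2.le, Real.rpow_neg hr2.le, mul_comm 2 b, Real.rpow_mul hr2.le,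
    Real.rpow_two]
  field_simp

/-- The oscillating part of the flow is bounded in `X^{0,b}` by the energy of the data. -/
lemma flowEnergy_waveFourier_le (hb : 0 ≤ b) (hb2 : b < 1 / 2) (hn : IsSymbol n h K) (hK : 0 ≤ K)
    (K' : ℝ) (hr : 0 < r) (hrT : r ^ 2 ≤ T₀) (hp : Measurable p) :
    flowEnergy b (waveFourier n (r ^ 2) p) ≤
      flowConstant b T₀ K K' * ENNReal.ofReal ((r ^ 2) ^ (-(2 * b))) * dataEnergy r p := by
  have hr2 : 0 < r ^ 2 := by positivity
  have hM : 0 < max 1 T₀ := lt_max_of_lt_left one_pos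
  set c : ℝ := K * (max 1 T₀ / r ^ 2) ^ b with hc
  have hc0 : 0 ≤ c := by positivity
  have hpt : ∀ z : ℝ × ℝ,
      (ENNReal.ofReal (bracket (z.2 + z.1 ^ 2) ^ b) * ‖waveFourier n (r ^ 2) p z‖ₑ) ^ 2 ≤
      (ENNReal.ofReal (4 * c ^ 2 * r ^ 2) *
        (ENNReal.ofReal (japanese (r * z.1)) * ‖p z.1‖ₑ) ^ 2) *
        ENNReal.ofReal (japanese (r ^ 2 * (z.2 + z.1 ^ 2)) ^ (-2 : ℝ)) := by
    intro z
    set y := z.2 + z.1 ^ 2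
    have hj := japanese_pos (r ^ 2 * y)
    have hj' := japanese_pos (r * z.1)
    have hbr := Real.rpow_pos_of_pos (bracket_pos y) b
    have h1 := bracket_rpow_le hr2 hrT hb y
    have h2 := hn.norm_le (r ^ 2 * y)
    have h3 : r * |z.1| ≤ japanese (r * z.1) := by
      unfold japanese; rw [abs_mul, abs_of_pos hr]; linarith
    simp only [← ofReal_norm]
    rw [← ENNReal.ofReal_mul hbr.le, ← ENNReal.ofReal_mul hj'.le,
      ← ENNReal.ofReal_pow (by positivity), ← ENNReal.ofReal_pow (by positivity),
      ← ENNReal.ofReal_mul (by positivity), ← ENNReal.ofReal_mul (by positivity)]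
    refine ENNReal.ofReal_le_ofReal ?_
    have h4 : ‖waveFourier n (r ^ 2) p z‖ = 2 * |z.1| * ‖p z.1‖ * (r ^ 2 * ‖n (r ^ 2 * y)‖) := by
      unfold waveFourier
      simp [y]
    have h5 : bracket y ^ b * ‖waveFourier n (r ^ 2) p z‖ ≤
        2 * c * r * (japanese (r * z.1) * ‖p z.1‖) * japanese (r ^ 2 * y) ^ (-1 : ℝ) := by
      calc bracket y ^ b * ‖waveFourier n (r ^ 2) p z‖
          ≤ ((max 1 T₀ / r ^ 2) ^ b * japanese (r ^ 2 * y) ^ b) *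
            (2 * |z.1| * ‖p z.1‖ * (r ^ 2 * (K * japanese (r ^ 2 * y) ^ (-3 : ℝ)))) := by
            rw [h4]; gcongr
        _ = 2 * c * r * ((r * |z.1|) * ‖p z.1‖) *
            (japanese (r ^ 2 * y) ^ b * japanese (r ^ 2 * y) ^ (-3 : ℝ)) := by rw [hc]; ring
        _ = 2 * c * r * ((r * |z.1|) * ‖p z.1‖) * japanese (r ^ 2 * y) ^ (b + -3) := by
            rw [Real.rpow_add hj]
        _ ≤ _ := by
            gcongr
            · exact one_le_japanese _
            · linarith
    refine (pow_le_pow_left₀ (by positivity) h5 2).trans (le_of_eq ?_)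
    have h6 : (japanese (r ^ 2 * y) ^ (-1 : ℝ)) ^ 2 = japanese (r ^ 2 * y) ^ (-2 : ℝ) := by
      rw [← Real.rpow_natCast, ← Real.rpow_mul hj.le]; norm_num
    rw [mul_pow, h6]
    ring
  refine (lintegral_mono hpt).trans ?_
  have hD : Measurable fun ξ : ℝ => ENNReal.ofReal (4 * c ^ 2 * r ^ 2) *
      (ENNReal.ofReal (japanese (r * ξ)) * ‖p ξ‖ₑ) ^ 2 := by fun_prop
  rw [Measure.volume_eq_prod, lintegral_prod _ (by fun_prop)]
  have h1 : ∀ ξ : ℝ, ∫⁻ τ : ℝ, (ENNReal.ofReal (4 * c ^ 2 * r ^ 2) *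
      (ENNReal.ofReal (japanese (r * ξ)) * ‖p ξ‖ₑ) ^ 2) *
      ENNReal.ofReal (japanese (r ^ 2 * (τ + ξ ^ 2)) ^ (-2 : ℝ)) =
      (ENNReal.ofReal (4 * c ^ 2 * r ^ 2) *
      (ENNReal.ofReal (japanese (r * ξ)) * ‖p ξ‖ₑ) ^ 2) *
      (ENNReal.ofReal (r ^ 2)⁻¹ * japaneseIntegral 2) := by
    intro ξ
    rw [lintegral_const_mul _ (by fun_prop), lintegral_japanese_mul_add hr2 2]
  simp_rw [h1]
  rw [lintegral_mul_const _ hD, lintegral_const_mul' _ _ (by simp)]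
  have h2 : ENNReal.ofReal (4 * c ^ 2 * r ^ 2) * ENNReal.ofReal (r ^ 2)⁻¹ =
      ENNReal.ofReal (4 * (K * max 1 T₀ ^ b) ^ 2) * ENNReal.ofReal ((r ^ 2) ^ (-(2 * b))) := by
    rw [← ENNReal.ofReal_mul (by positivity), ← ENNReal.ofReal_mul (by positivity), hc,
      sq_max_div_rpow_mul hr]
    congr 1
    field_simp
  calc _ = (ENNReal.ofReal (4 * c ^ 2 * r ^ 2) * ENNReal.ofReal (r ^ 2)⁻¹) *
        (japaneseIntegral 2 * dataEnergy r p) := by unfold dataEnergy; ring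
    _ = (ENNReal.ofReal (4 * (K * max 1 T₀ ^ b) ^ 2) * japaneseIntegral 2) *
        ENNReal.ofReal ((r ^ 2) ^ (-(2 * b))) * dataEnergy r p := by rw [h2]; ring
    _ ≤ _ := by
        gcongr
        exact le_self_add

/-- The evanescent part of the flow is bounded in `X^{0,b}` by the energy of the data, even when
the `β`-integral is taken with absolute values inside. -/
lemma lintegral_sq_evanescentIntegrand_le (hb : 0 ≤ b) (hb2 : b < 1 / 2) (hn : IsSymbol n h K)
    (hK : 0 ≤ K) (hκ : IsSymbol κ k K') (hK' : 0 ≤ K') (hr : 0 < r) (hrT : r ^ 2 ≤ T₀)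
    (hm : Measurable m) :
    ∫⁻ z : ℝ × ℝ, (ENNReal.ofReal (bracket (z.2 + z.1 ^ 2) ^ b) *
        ∫⁻ β : ℝ, ‖evanescentIntegrand n κ (r ^ 2) m z β‖ₑ) ^ 2 ≤
      flowConstant b T₀ K K' * ENNReal.ofReal ((r ^ 2) ^ (-(2 * b))) * dataEnergy r m := by
  have hr2 : 0 < r ^ 2 := by positivity
  have hM : 0 < max 1 T₀ := lt_max_of_lt_left one_pos
  set c : ℝ := K * K' * (max 1 T₀ / r ^ 2) ^ b with hc
  have hc0 : 0 ≤ c := by positivity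
  -- Schur's test: the powers `|β|^{±1/2}` are the density of the substitution `y = β²` and the
  -- Jacobian of `ξ ↦ ξ / β`
  set g : ℝ → ℝ≥0∞ := fun β => ENNReal.ofReal (japanese (r * β)) * ‖m β‖ₑ with hg
  have hgm : Measurable g := by fun_prop
  set a : ℝ × ℝ → ℝ → ℝ≥0∞ := fun z β => ENNReal.ofReal
    (|β| ^ (1 / 2 : ℝ) * japanese (r ^ 2 * (z.2 + -β ^ 2)) ^ (-1 : ℝ)) with ha
  set e : ℝ × ℝ → ℝ → ℝ≥0∞ := fun z β => ENNReal.ofReal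
    (c * r ^ 2 * (|β| ^ (-(1 / 2) : ℝ) * (japanese (r ^ 2 * (z.2 + -β ^ 2)) ^ (-1 : ℝ) *
      japanese (z.1 / β) ^ (-1 : ℝ)))) with he
  have hsq : ∀ x : ℝ, 0 ≤ x → (x ^ (-1 : ℝ)) ^ 2 = x ^ (-2 : ℝ) := by
    intro x hx
    rw [← Real.rpow_natCast, ← Real.rpow_mul hx]; norm_num
  have hA : ∀ z, ∫⁻ β, a z β ^ 2 ≤ ENNReal.ofReal (r ^ 2)⁻¹ * japaneseIntegral 2 := by
    intro z
    have h1 : ∀ β, a z β ^ 2 = ENNReal.ofReal r⁻¹ *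
        ENNReal.ofReal (|r * β| * japanese ((r * β) ^ 2 - r ^ 2 * z.2) ^ (-2 : ℝ)) := by
      intro β
      rw [ha, ← ENNReal.ofReal_pow (mul_nonneg (by positivity)
        (Real.rpow_nonneg (japanese_pos _).le _)), ← ENNReal.ofReal_mul (by positivity)]
      congr 1
      rw [mul_pow, hsq _ (japanese_pos _).le, ← Real.sqrt_eq_rpow, Real.sq_sqrt (abs_nonneg _),
        abs_mul, abs_of_pos hr, japanese_sub_comm,
        show r ^ 2 * z.2 - (r * β) ^ 2 = r ^ 2 * (z.2 + -β ^ 2) by ring]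
      field_simp
    simp_rw [h1]
    rw [lintegral_const_mul' _ _ (by simp), lintegral_comp_mul_left hr fun β => ENNReal.ofReal
      (|β| * japanese (β ^ 2 - r ^ 2 * z.2) ^ (-2 : ℝ)), ← mul_assoc,
      ← ENNReal.ofReal_mul (by positivity), ← mul_inv, ← sq]
    gcongr
    exact lintegral_abs_mul_japanese_sq_sub_le 2 _
  have hB : ∀ᵐ β : ℝ, ∫⁻ z, e z β ^ 2 ≤
      ENNReal.ofReal (c ^ 2 * r ^ 2) * japaneseIntegral 2 ^ 2 := by
    have hne : ∀ᵐ β : ℝ, β ≠ 0 := by simp [ae_iff, measure_singleton]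
    filter_upwards [hne] with β hβ
    have hβ0 : 0 < |β| := abs_pos.mpr hβ
    have h1 : ∀ z : ℝ × ℝ, e z β ^ 2 = (ENNReal.ofReal ((c * r ^ 2) ^ 2 * |β|⁻¹) *
        ENNReal.ofReal (japanese (|β|⁻¹ * z.1) ^ (-2 : ℝ))) *
        ENNReal.ofReal (japanese (r ^ 2 * (z.2 + -β ^ 2)) ^ (-2 : ℝ)) := by
      intro z
      have hj := japanese_pos (r ^ 2 * (z.2 + -β ^ 2))
      have hj' := japanese_pos (z.1 / β)
      have hj'' := japanese_pos (|β|⁻¹ * z.1)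
      have h2 : japanese (|β|⁻¹ * z.1) = japanese (z.1 / β) := by
        unfold japanese; rw [abs_mul, abs_div, abs_inv, abs_abs, inv_mul_eq_div]
      have h3 : (|β| ^ (-(1 / 2) : ℝ)) ^ 2 = |β|⁻¹ := by
        rw [← Real.rpow_natCast, ← Real.rpow_mul hβ0.le, ← Real.rpow_neg_one]; norm_num
      rw [he, ← ENNReal.ofReal_pow (by positivity), ← ENNReal.ofReal_mul (by positivity),
        ← ENNReal.ofReal_mul (by positivity), h2]
      congr 1
      clear_value c
      simp only [mul_pow, h3, hsq _ hj.le, hsq _ hj'.le]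
      ring
    simp_rw [h1]
    rw [Measure.volume_eq_prod, lintegral_prod_mul (f := fun ξ : ℝ =>
        ENNReal.ofReal ((c * r ^ 2) ^ 2 * |β|⁻¹) *
        ENNReal.ofReal (japanese (|β|⁻¹ * ξ) ^ (-2 : ℝ))) (g := fun τ : ℝ =>
        ENNReal.ofReal (japanese (r ^ 2 * (τ + -β ^ 2)) ^ (-2 : ℝ))) (by fun_prop) (by fun_prop),
      lintegral_const_mul' _ _ (by simp), lintegral_japanese_mul_add hr2 2,
      lintegral_comp_mul_left (inv_pos.mpr hβ0) fun ξ => ENNReal.ofReal (japanese ξ ^ (-2 : ℝ)),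
      inv_inv]
    have h4 : ∫⁻ ξ, ENNReal.ofReal (japanese ξ ^ (-2 : ℝ)) = japaneseIntegral 2 := rfl
    rw [h4]
    refine le_of_eq ?_
    calc _ = (ENNReal.ofReal ((c * r ^ 2) ^ 2 * |β|⁻¹) * ENNReal.ofReal |β| *
          ENNReal.ofReal (r ^ 2)⁻¹) * japaneseIntegral 2 ^ 2 := by ring
      _ = _ := by
        rw [← ENNReal.ofReal_mul (by positivity), ← ENNReal.ofReal_mul (by positivity)]
        congr 2
        field_simp
  have hk : ∀ (z : ℝ × ℝ) (β : ℝ), β ≠ 0 → ENNReal.ofReal (bracket (z.2 + z.1 ^ 2) ^ b) *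
      ‖evanescentIntegrand n κ (r ^ 2) m z β‖ₑ ≤ a z β * e z β * g β := by
    intro z β hβ
    have hβ0 : 0 < |β| := abs_pos.mpr hβ
    set y := r ^ 2 * (z.2 + -β ^ 2) with hy
    set w := z.1 / β with hw
    have hj := japanese_pos y
    have hj' := japanese_pos w
    have hj'' := japanese_pos (r * β)
    have hbr := Real.rpow_pos_of_pos (bracket_pos (z.2 + z.1 ^ 2)) b
    have h1 := bracket_rpow_le hr2 hrT hb (z.2 + z.1 ^ 2)
    have h2 := hn.norm_le y
    have h3 := hκ.norm_le w
    -- `τ + ξ² = (τ - β²) + β² (1 + (ξ/β)²)`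
    have h4 : japanese (r ^ 2 * (z.2 + z.1 ^ 2)) ≤
        japanese y * (japanese (r * β) ^ 2 * japanese w ^ 2) := by
      have e1 : r ^ 2 * (z.2 + z.1 ^ 2) = y + (r * β) ^ 2 * (1 + w ^ 2) := by
        rw [hy, hw]; field_simp; ring
      rw [e1]
      refine (japanese_add_le_mul _ _).trans (mul_le_mul_of_nonneg_left ?_ hj.le)
      have e2 : 1 + w ^ 2 ≤ japanese w ^ 2 := by
        unfold japanese; nlinarith [sq_abs w, abs_nonneg w]
      have e3 : 1 + (r * β) ^ 2 ≤ japanese (r * β) ^ 2 := by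
        unfold japanese; nlinarith [sq_abs (r * β), abs_nonneg (r * β)]
      have e4 : japanese ((r * β) ^ 2 * (1 + w ^ 2)) = 1 + (r * β) ^ 2 * (1 + w ^ 2) := by
        unfold japanese; rw [abs_of_nonneg (by positivity)]
      rw [e4]
      calc 1 + (r * β) ^ 2 * (1 + w ^ 2) ≤ (1 + (r * β) ^ 2) * (1 + w ^ 2) := by
            nlinarith [sq_nonneg w]
        _ ≤ _ := by gcongr
    -- as `2b < 1`, the squares become first powers
    have h5 : japanese (r ^ 2 * (z.2 + z.1 ^ 2)) ^ b ≤
        japanese y ^ (1 : ℝ) * (japanese (r * β) * japanese w) := by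
      refine (Real.rpow_le_rpow (japanese_pos _).le h4 hb).trans ?_
      rw [Real.mul_rpow hj.le (by positivity), ← mul_pow]
      have e1 := one_le_japanese (r * β)
      have e2 := one_le_japanese w
      gcongr ?_ * ?_
      · exact Real.rpow_le_rpow_of_exponent_le (one_le_japanese y) (by linarith)
      · calc ((japanese (r * β) * japanese w) ^ 2) ^ b
            = (japanese (r * β) * japanese w) ^ (2 * b) := by
              rw [← Real.rpow_natCast, ← Real.rpow_mul (by positivity)]; norm_num
          _ ≤ (japanese (r * β) * japanese w) ^ (1 : ℝ) :=
              Real.rpow_le_rpow_of_exponent_le (by nlinarith) (by linarith)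
          _ = _ := Real.rpow_one _
    rw [ha, he, hg]
    simp only [← ofReal_norm]
    rw [← ENNReal.ofReal_mul hbr.le, ← ENNReal.ofReal_mul (by positivity),
      ← ENNReal.ofReal_mul (by positivity), ← ENNReal.ofReal_mul (by positivity)]
    refine ENNReal.ofReal_le_ofReal ?_
    have h6 : ‖evanescentIntegrand n κ (r ^ 2) m z β‖ = r ^ 2 * ‖n y‖ * ‖κ w‖ * ‖m β‖ := by
      unfold evanescentIntegrand
      simp [hy, hw]
    have h7 : |β| ^ (1 / 2 : ℝ) * |β| ^ (-(1 / 2) : ℝ) = 1 := by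
      rw [← Real.rpow_add hβ0]; norm_num
    have h8 : japanese y ^ (1 : ℝ) * japanese y ^ (-3 : ℝ) =
        japanese y ^ (-1 : ℝ) * japanese y ^ (-1 : ℝ) := by
      rw [← Real.rpow_add hj, ← Real.rpow_add hj]; norm_num
    have h9 : japanese w * japanese w ^ (-3 : ℝ) ≤ japanese w ^ (-1 : ℝ) := by
      calc japanese w * japanese w ^ (-3 : ℝ) = japanese w ^ ((1 : ℝ) + -3) := by
            rw [Real.rpow_add hj', Real.rpow_one]
        _ ≤ japanese w ^ (-1 : ℝ) :=
            Real.rpow_le_rpow_of_exponent_le (one_le_japanese w) (by norm_num)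
    calc bracket (z.2 + z.1 ^ 2) ^ b * ‖evanescentIntegrand n κ (r ^ 2) m z β‖
        ≤ ((max 1 T₀ / r ^ 2) ^ b * (japanese y ^ (1 : ℝ) * (japanese (r * β) * japanese w))) *
          (r ^ 2 * (K * japanese y ^ (-3 : ℝ)) * (K' * japanese w ^ (-3 : ℝ)) * ‖m β‖) := by
          rw [h6]
          gcongr
          exact h1.trans (by gcongr)
      _ = c * r ^ 2 * (japanese y ^ (1 : ℝ) * japanese y ^ (-3 : ℝ)) *
          (japanese w * japanese w ^ (-3 : ℝ)) * (japanese (r * β) * ‖m β‖) := by rw [hc]; ring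
      _ ≤ c * r ^ 2 * (japanese y ^ (-1 : ℝ) * japanese y ^ (-1 : ℝ)) *
          japanese w ^ (-1 : ℝ) * (japanese (r * β) * ‖m β‖) := by
          rw [h8]; gcongr
      _ = (|β| ^ (1 / 2 : ℝ) * |β| ^ (-(1 / 2) : ℝ)) * (c * r ^ 2 *
          (japanese y ^ (-1 : ℝ) * japanese y ^ (-1 : ℝ)) *
          japanese w ^ (-1 : ℝ) * (japanese (r * β) * ‖m β‖)) := by rw [h7, one_mul]
      _ = _ := by ring
  have hne : ∀ᵐ β : ℝ, β ≠ 0 := by simp [ae_iff, measure_singleton]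
  have ham : Measurable (Function.uncurry a) := by
    rw [ha]; unfold Function.uncurry; fun_prop
  have hem : Measurable (Function.uncurry e) := by
    rw [he]; unfold Function.uncurry; fun_prop
  calc _ ≤ ∫⁻ z : ℝ × ℝ, (∫⁻ β : ℝ, a z β * e z β * g β) ^ 2 := by
        refine lintegral_mono fun z => ?_
        rw [← lintegral_const_mul' _ _ (by simp)]
        refine pow_le_pow_left' (lintegral_mono_ae ?_) 2
        filter_upwards [hne] with β hβ
        exact hk z β hβ
    _ ≤ (ENNReal.ofReal (r ^ 2)⁻¹ * japaneseIntegral 2) *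
        (ENNReal.ofReal (c ^ 2 * r ^ 2) * japaneseIntegral 2 ^ 2) * ∫⁻ β, g β ^ 2 :=
        lintegral_sq_lintegral_le (k := fun z β => a z β * e z β) ham hem hgm
          (fun _ _ => le_rfl) hA hB
    _ = (ENNReal.ofReal (r ^ 2)⁻¹ * ENNReal.ofReal (c ^ 2 * r ^ 2)) *
        japaneseIntegral 2 ^ 3 * dataEnergy r m := by unfold dataEnergy; rw [hg]; ring
    _ = (ENNReal.ofReal ((K * K' * max 1 T₀ ^ b) ^ 2) * japaneseIntegral 2 ^ 3) *
        ENNReal.ofReal ((r ^ 2) ^ (-(2 * b))) * dataEnergy r m := by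
        have h2 : ENNReal.ofReal (r ^ 2)⁻¹ * ENNReal.ofReal (c ^ 2 * r ^ 2) =
            ENNReal.ofReal ((K * K' * max 1 T₀ ^ b) ^ 2) *
              ENNReal.ofReal ((r ^ 2) ^ (-(2 * b))) := by
          rw [← ENNReal.ofReal_mul (by positivity), ← ENNReal.ofReal_mul (by positivity), hc,
            sq_max_div_rpow_mul hr]
          congr 1
          field_simp
        rw [h2]; ring
    _ ≤ _ := by
        gcongr
        exact le_add_self

end

/-! ### Fourier inversion for the boundary flow -/

section

variable {n h κ k : ℝ → ℂ} {K K' b T : ℝ} {p m : ℝ → ℂ}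

/-- The kernel of the Fourier inversion integral on `ℝ × ℝ`. -/
def wave (x t : ℝ) (z : ℝ × ℝ) : ℂ := Complex.exp (Complex.I * (z.1 * x + z.2 * t : ℝ))

lemma wave_eq_mul (x t : ℝ) (z : ℝ × ℝ) :
    wave x t z =
      Complex.exp (Complex.I * (z.1 * x : ℝ)) * Complex.exp (Complex.I * (z.2 * t : ℝ)) := by
  rw [wave, ← Complex.exp_add]
  congr 1
  push_cast
  ring

lemma norm_wave (x t : ℝ) (z : ℝ × ℝ) : ‖wave x t z‖ = 1 := norm_exp_I_mul _

lemma continuous_wave (x t : ℝ) : Continuous (wave x t) := by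
  unfold wave; fun_prop

lemma IsSymbol.integrable_comp (hn : IsSymbol n h K) (hT : 0 < T) (c : ℝ) :
    Integrable fun τ : ℝ => (T : ℂ) * n (T * (τ + c)) :=
  ((hn.integrable.comp_mul_left' hT.ne').comp_add_right c).const_mul _

lemma integral_norm_mul_comp_add (T c : ℝ) (n : ℝ → ℂ) :
    ∫ τ : ℝ, ‖(T : ℂ) * n (T * (τ + c))‖ = ∫ τ : ℝ, ‖(T : ℂ) * n (T * τ)‖ :=
  integral_add_right_eq_self (fun τ : ℝ => ‖(T : ℂ) * n (T * τ)‖) c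

lemma IsSymbol.integrable_comp_div (hκ : IsSymbol κ k K') {β : ℝ} (hβ : β ≠ 0) :
    Integrable fun ξ : ℝ => κ (ξ / β) := hκ.integrable.comp_div hβ

/-- The inverse Fourier transform of a symbol dilated by `β`. -/
lemma IsSymbol.integral_comp_div (hκ : IsSymbol κ k K') {β : ℝ} (hβ : 0 < β) (x : ℝ) :
    ∫ ξ : ℝ, Complex.exp (Complex.I * (ξ * x : ℝ)) * κ (ξ / β) =
      β * (2 * Real.pi * k (β * x)) := by
  have h1 := Measure.integral_comp_div
    (fun y : ℝ => Complex.exp (Complex.I * (y * (β * x) : ℝ)) * κ y) β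
  rw [hκ.integral_eq, abs_of_pos hβ, Complex.real_smul] at h1
  rw [← h1]
  refine integral_congr_ae (Eventually.of_forall fun ξ => ?_)
  simp only
  rw [show ξ / β * (β * x) = ξ * x by field_simp]

lemma integrable_waveFourier (hn : IsSymbol n h K) (hT : 0 < T) (hpm : Measurable p)
    (hp : Integrable fun ξ : ℝ => (ξ : ℂ) * p ξ) : Integrable (waveFourier n T p) := by
  rw [Measure.volume_eq_prod, integrable_prod_iff
    (measurable_waveFourier hn.continuous T hpm).aestronglyMeasurable]
  refine ⟨Eventually.of_forall fun ξ => (hn.integrable_comp hT (ξ ^ 2)).const_mul (2 * ξ * p ξ), ?_⟩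
  unfold waveFourier
  simp_rw [norm_mul (2 * _ * p _), integral_const_mul, integral_norm_mul_comp_add]
  refine Integrable.mul_const ?_ _
  refine (hp.norm.const_mul 2).congr (Eventually.of_forall fun ξ => ?_)
  simp [mul_assoc]

lemma integral_wave_mul_waveFourier (hn : IsSymbol n h K) (hT : 0 < T) (hpm : Measurable p)
    (hp : Integrable fun ξ : ℝ => (ξ : ℂ) * p ξ) (x t : ℝ) :
    ∫ z, wave x t z * waveFourier n T p z = (2 * Real.pi * h (t / T)) *
      (2 * ∫ β : ℝ, Complex.exp (Complex.I * (-(β ^ 2 * t) + β * x : ℝ)) * ((β : ℂ) * p β)) := by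
  have hint : Integrable fun z => wave x t z * waveFourier n T p z :=
    (integrable_waveFourier hn hT hpm hp).bdd_mul
      (continuous_wave x t).aestronglyMeasurable
      (Eventually.of_forall fun z => (norm_wave x t z).le)
  rw [Measure.volume_eq_prod] at hint ⊢
  rw [integral_prod _ hint, ← integral_const_mul, ← integral_const_mul]
  refine integral_congr_ae (Eventually.of_forall fun ξ => ?_)
  have h1 : ∀ τ : ℝ, wave x t (ξ, τ) * waveFourier n T p (ξ, τ) =
      (Complex.exp (Complex.I * (ξ * x : ℝ)) * (2 * ξ * p ξ)) *
        (Complex.exp (Complex.I * (τ * t : ℝ)) * (T * n (T * (τ + ξ ^ 2)))) := by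
    intro τ
    rw [wave_eq_mul, waveFourier]
    push_cast
    ring
  simp only [h1]
  rw [integral_const_mul, hn.integral_comp hT]
  rw [show Complex.I * (-(ξ ^ 2 * t) + ξ * x : ℝ) =
    Complex.I * (ξ * x : ℝ) + -Complex.I * (ξ ^ 2 * t : ℝ) by push_cast; ring, Complex.exp_add]
  ring

lemma integrable_uncurry_evanescentIntegrand (hn : IsSymbol n h K) (hκ : IsSymbol κ k K')
    (hT : 0 < T) (hmm : Measurable m) (hm : Integrable fun β : ℝ => (β : ℂ) * m β) :
    Integrable (Function.uncurry (evanescentIntegrand n κ T m)) := by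
  have hne : ∀ᵐ β : ℝ, β ≠ 0 := by simp [ae_iff, measure_singleton]
  have hprod : ∀ β : ℝ, β ≠ 0 → Integrable fun z : ℝ × ℝ =>
      κ (z.1 / β) * ((T : ℂ) * n (T * (z.2 + -β ^ 2))) := fun β hβ =>
    (hκ.integrable_comp_div hβ).mul_prod (hn.integrable_comp hT (-β ^ 2))
  have hE : ∀ (β : ℝ) (z : ℝ × ℝ), evanescentIntegrand n κ T m z β =
      (κ (z.1 / β) * ((T : ℂ) * n (T * (z.2 + -β ^ 2)))) * m β := by
    intro β z
    unfold evanescentIntegrand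
    ring
  rw [Measure.volume_eq_prod, integrable_prod_iff'
    (measurable_evanescentIntegrand hn.continuous hκ.continuous T hmm).aestronglyMeasurable]
  constructor
  · filter_upwards [hne] with β hβ
    simp only [Function.uncurry, hE]
    exact (hprod β hβ).mul_const _
  · refine ((hm.norm.mul_const (∫ y, ‖κ y‖)).mul_const (∫ τ, ‖(T : ℂ) * n (T * τ)‖)).congr ?_
    filter_upwards with β
    simp only [Function.uncurry, hE]
    simp_rw [norm_mul _ (m β)]
    rw [integral_mul_const]
    simp_rw [norm_mul (κ _)]
    rw [Measure.volume_eq_prod, integral_prod_mul (fun ξ : ℝ => ‖κ (ξ / β)‖)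
      (fun τ : ℝ => ‖(T : ℂ) * n (T * (τ + -β ^ 2))‖), integral_norm_mul_comp_add,
      Measure.integral_comp_div (fun y => ‖κ y‖), smul_eq_mul, Complex.norm_real, Real.norm_eq_abs]
    ring

lemma integrable_evanescentFourier (hn : IsSymbol n h K) (hκ : IsSymbol κ k K')
    (hT : 0 < T) (hmm : Measurable m) (hm : Integrable fun β : ℝ => (β : ℂ) * m β) :
    Integrable (evanescentFourier n κ T m) :=
  (integrable_uncurry_evanescentIntegrand hn hκ hT hmm hm).integral_prod_left.const_mul _

lemma integral_wave_mul_evanescentFourier (hn : IsSymbol n h K) (hκ : IsSymbol κ k K')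
    (hT : 0 < T) (hmm : Measurable m) (hm : Integrable fun β : ℝ => (β : ℂ) * m β)
    (hm0 : ∀ β ≤ 0, m β = 0) (x t : ℝ) :
    ∫ z, wave x t z * evanescentFourier n κ T m z = (2 * Real.pi * h (t / T)) *
      (2 * ∫ β : ℝ, Complex.exp (Complex.I * (β ^ 2 * t : ℝ)) * k (β * x) *
        ((β : ℂ) * m β)) := by
  have hint : Integrable (Function.uncurry fun z β =>
      wave x t z * evanescentIntegrand n κ T m z β) (volume.prod volume) :=
    (integrable_uncurry_evanescentIntegrand hn hκ hT hmm hm).bdd_mul (c := 1)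
      ((continuous_wave x t).comp continuous_fst).aestronglyMeasurable
      (Eventually.of_forall fun z => (norm_wave x t z.1).le)
  have hpi : (Real.pi : ℂ) ≠ 0 := by exact_mod_cast Real.pi_ne_zero
  have h1 : ∀ z, wave x t z * evanescentFourier n κ T m z =
      (Real.pi : ℂ)⁻¹ * ∫ β : ℝ, wave x t z * evanescentIntegrand n κ T m z β := by
    intro z
    rw [integral_const_mul, evanescentFourier]
    ring
  simp_rw [h1]
  rw [integral_const_mul, integral_integral_swap hint, ← integral_const_mul,
    ← integral_const_mul, ← integral_const_mul]
  refine integral_congr_ae (Eventually.of_forall fun β => ?_)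
  simp only
  rcases le_or_gt β 0 with hβ | hβ
  · simp [evanescentIntegrand, hm0 β hβ]
  have h2 : ∀ z : ℝ × ℝ, wave x t z * evanescentIntegrand n κ T m z β =
      m β * ((Complex.exp (Complex.I * (z.1 * x : ℝ)) * κ (z.1 / β)) *
        (Complex.exp (Complex.I * (z.2 * t : ℝ)) * (T * n (T * (z.2 + -β ^ 2))))) := by
    intro z
    rw [wave_eq_mul, evanescentIntegrand]
    ring
  simp_rw [h2]
  rw [integral_const_mul, Measure.volume_eq_prod, integral_prod_mul
    (fun ξ : ℝ => Complex.exp (Complex.I * (ξ * x : ℝ)) * κ (ξ / β))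
    (fun τ : ℝ => Complex.exp (Complex.I * (τ * t : ℝ)) * (T * n (T * (τ + -β ^ 2)))),
    hκ.integral_comp_div hβ, hn.integral_comp hT,
    show -Complex.I * (-β ^ 2 * t : ℝ) = Complex.I * (β ^ 2 * t : ℝ) by push_cast; ring]
  field_simp

/-- The inverse Fourier transform on the plane as an integral over `ℝ × ℝ`. -/
lemma fourierInv_comp_smul (V : ℝ × ℝ → ℂ) (P : Plane) :
    𝓕⁻ (fun k : Plane => V (WithLp.ofLp ((2 * Real.pi) • k))) P =
      ((2 * Real.pi : ℂ) ^ 2)⁻¹ * ∫ z, wave P.fst P.snd z * V z := by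
  have h1 := Measure.integral_comp_smul (volume : Measure Plane)
    (fun k : Plane => wave P.fst P.snd (WithLp.ofLp k) * V (WithLp.ofLp k)) (2 * Real.pi)
  have h2 : ∫ k : Plane, wave P.fst P.snd (WithLp.ofLp k) * V (WithLp.ofLp k) =
      ∫ z, wave P.fst P.snd z * V z :=
    (WithLp.volume_preserving_ofLp ℝ ℝ).integral_comp
      (MeasurableEquiv.toLp 2 (ℝ × ℝ)).symm.measurableEmbedding
      (fun z => wave P.fst P.snd z * V z)
  have h3 : Module.finrank ℝ Plane = 2 := by
    rw [LinearEquiv.finrank_eq (WithLp.linearEquiv 2 ℝ (ℝ × ℝ))]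
    simp
  rw [h2, h3, abs_of_pos (by positivity), Complex.real_smul] at h1
  push_cast at h1
  rw [← h1, Real.fourierInv_eq']
  refine integral_congr_ae (Eventually.of_forall fun k => ?_)
  simp only [smul_eq_mul, wave]
  congr 2
  rw [WithLp.prod_inner_apply]
  simp only [WithLp.fst, WithLp.snd, RCLike.inner_apply, conj_trivial, WithLp.ofLp_smul,
    Prod.smul_fst, Prod.smul_snd, smul_eq_mul]
  push_cast
  ring

end

/-! ### The truncated boundary flow as a function in the Bourgain space -/

section

variable {n h κ k : ℝ → ℂ} {K K' b T T₀ r : ℝ} {p p' m m' : ℝ → ℂ}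

/-- The space-time Fourier transform of the truncated boundary flow with boundary data `p` for the
oscillating and `m` for the evanescent part. -/
def flowFourier (n κ : ℝ → ℂ) (T : ℝ) (p m : ℝ → ℂ) (z : ℝ × ℝ) : ℂ :=
  waveFourier n T p z + evanescentFourier n κ T m z

lemma enorm_add_sq_le (a c : ℂ) : ‖a + c‖ₑ ^ 2 ≤ 2 * (‖a‖ₑ ^ 2 + ‖c‖ₑ ^ 2) := by
  simpa using enorm_sub_sq_le a (-c)

lemma measurable_flowFourier (hn : Continuous n) (hκ : Continuous κ) (T : ℝ)
    (hp : Measurable p) (hm : Measurable m) : Measurable (flowFourier n κ T p m) :=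
  (measurable_waveFourier hn T hp).add (measurable_evanescentFourier hn hκ T hm)

lemma flowEnergy_congr {V W : ℝ × ℝ → ℂ} (h : V =ᵐ[volume] W) :
    flowEnergy b V = flowEnergy b W := by
  refine lintegral_congr_ae ?_
  filter_upwards [h] with z hz
  rw [hz]

lemma enorm_evanescentFourier_le (n κ : ℝ → ℂ) (T : ℝ) (m : ℝ → ℂ) (z : ℝ × ℝ) :
    ‖evanescentFourier n κ T m z‖ₑ ≤ ∫⁻ β : ℝ, ‖evanescentIntegrand n κ T m z β‖ₑ := by
  -- the factor `π⁻¹` is only used through `π⁻¹ ≤ 1`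
  have h1 : ‖((Real.pi : ℂ)⁻¹)‖ₑ ≤ 1 := by
    rw [← ofReal_norm, ENNReal.ofReal_le_one, norm_inv, Complex.norm_real,
      Real.norm_of_nonneg Real.pi_pos.le]
    exact inv_le_one_of_one_le₀ (by linarith [Real.pi_gt_three])
  calc ‖evanescentFourier n κ T m z‖ₑ
      = ‖((Real.pi : ℂ)⁻¹)‖ₑ * ‖∫ β : ℝ, evanescentIntegrand n κ T m z β‖ₑ := enorm_mul _ _
    _ ≤ 1 * ∫⁻ β : ℝ, ‖evanescentIntegrand n κ T m z β‖ₑ := by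
        gcongr
        exact enorm_integral_le_lintegral_enorm _
    _ = _ := one_mul _

lemma flowEnergy_flowFourier_le (hb : 0 ≤ b) (hb2 : b < 1 / 2) (hn : IsSymbol n h K)
    (hK : 0 ≤ K) (hκ : IsSymbol κ k K') (hK' : 0 ≤ K') (hr : 0 < r) (hrT : r ^ 2 ≤ T₀)
    (hp : Measurable p) (hm : Measurable m) :
    flowEnergy b (flowFourier n κ (r ^ 2) p m) ≤
      2 * (flowConstant b T₀ K K' * ENNReal.ofReal ((r ^ 2) ^ (-(2 * b)))) *
        (dataEnergy r p + dataEnergy r m) := by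
  have hw := flowEnergy_waveFourier_le hb hb2 hn hK K' hr hrT hp
  have he := lintegral_sq_evanescentIntegrand_le hb hb2 hn hK hκ hK' hr hrT hm
  have hbm := measurable_bracket_rpow b
  have hwm := measurable_waveFourier hn.continuous (r ^ 2) hp
  calc flowEnergy b (flowFourier n κ (r ^ 2) p m)
      ≤ ∫⁻ z : ℝ × ℝ, 2 * ((ENNReal.ofReal (bracket (z.2 + z.1 ^ 2) ^ b) *
          ‖waveFourier n (r ^ 2) p z‖ₑ) ^ 2 + (ENNReal.ofReal (bracket (z.2 + z.1 ^ 2) ^ b) *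
          ∫⁻ β : ℝ, ‖evanescentIntegrand n κ (r ^ 2) m z β‖ₑ) ^ 2) := by
        refine lintegral_mono fun z => ?_
        have h1 : ‖flowFourier n κ (r ^ 2) p m z‖ₑ ^ 2 ≤ 2 * (‖waveFourier n (r ^ 2) p z‖ₑ ^ 2 +
            (∫⁻ β : ℝ, ‖evanescentIntegrand n κ (r ^ 2) m z β‖ₑ) ^ 2) := by
          refine (enorm_add_sq_le _ _).trans ?_
          gcongr
          exact enorm_evanescentFourier_le _ _ _ _ _
        simp only [mul_pow]
        rw [← mul_add, mul_left_comm]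
        gcongr
    _ = 2 * (flowEnergy b (waveFourier n (r ^ 2) p) +
          ∫⁻ z : ℝ × ℝ, (ENNReal.ofReal (bracket (z.2 + z.1 ^ 2) ^ b) *
          ∫⁻ β : ℝ, ‖evanescentIntegrand n κ (r ^ 2) m z β‖ₑ) ^ 2) := by
        rw [lintegral_const_mul' _ _ (by simp), lintegral_add_left (by fun_prop)]
        rfl
    _ ≤ 2 * (flowConstant b T₀ K K' * ENNReal.ofReal ((r ^ 2) ^ (-(2 * b))) * dataEnergy r p +
          flowConstant b T₀ K K' * ENNReal.ofReal ((r ^ 2) ^ (-(2 * b))) * dataEnergy r m) := by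
        gcongr
    _ = _ := by ring

/-- Finite energy of the data makes the integral in the evanescent part converge absolutely for
almost every frequency. -/
lemma ae_integrable_evanescentIntegrand (hn : IsSymbol n h K)
    (hK : 0 ≤ K) (hκ : IsSymbol κ k K') (hK' : 0 ≤ K') (hr : 0 < r)
    (hm : Measurable m) (hme : dataEnergy r m < ⊤) :
    ∀ᵐ z : ℝ × ℝ, Integrable (evanescentIntegrand n κ (r ^ 2) m z) := by
  have he := lintegral_sq_evanescentIntegrand_le (b := 0) le_rfl (by norm_num) hn hK hκ hK' hr
    le_rfl hm
  have hmeas := measurable_evanescentIntegrand hn.continuous hκ.continuous (r ^ 2) hm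
  have hfin : ∫⁻ z : ℝ × ℝ, (∫⁻ β : ℝ, ‖evanescentIntegrand n κ (r ^ 2) m z β‖ₑ) ^ 2 ≠ ⊤ := by
    have hc : flowConstant 0 (r ^ 2) K K' < ⊤ := flowConstant_lt_top
    simp only [Real.rpow_zero, ENNReal.ofReal_one, one_mul] at he
    refine (he.trans_lt ?_).ne
    finiteness
  have hm2 : Measurable fun z : ℝ × ℝ => ∫⁻ β : ℝ, ‖evanescentIntegrand n κ (r ^ 2) m z β‖ₑ :=
    hmeas.enorm.lintegral_prod_right'
  filter_upwards [ae_lt_top (hm2.pow_const 2) hfin] with z hz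
  refine ⟨(hmeas.comp measurable_prodMk_left).aestronglyMeasurable, ?_⟩
  unfold HasFiniteIntegral
  by_contra hne
  rw [not_lt, top_le_iff] at hne
  simp [hne] at hz

lemma flowFourier_sub_ae_eq (hn : IsSymbol n h K)
    (hK : 0 ≤ K) (hκ : IsSymbol κ k K') (hK' : 0 ≤ K') (hr : 0 < r)
    (hm : Measurable m) (hme : dataEnergy r m < ⊤) (hm' : Measurable m')
    (hme' : dataEnergy r m' < ⊤) :
    (fun z => flowFourier n κ (r ^ 2) p m z - flowFourier n κ (r ^ 2) p' m' z) =ᵐ[volume]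
      flowFourier n κ (r ^ 2) (p - p') (m - m') := by
  filter_upwards [ae_integrable_evanescentIntegrand hn hK hκ hK' hr hm hme,
    ae_integrable_evanescentIntegrand hn hK hκ hK' hr hm' hme'] with z h1 h2
  have h3 : evanescentFourier n κ (r ^ 2) (m - m') z =
      evanescentFourier n κ (r ^ 2) m z - evanescentFourier n κ (r ^ 2) m' z := by
    unfold evanescentFourier
    rw [← mul_sub, ← integral_sub h1 h2]
    congr 1
    refine integral_congr_ae (Eventually.of_forall fun β => ?_)
    simp only [evanescentIntegrand, Pi.sub_apply]
    ring
  unfold flowFourier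
  rw [h3]
  simp only [waveFourier, Pi.sub_apply]
  ring

lemma lintegral_comp_ofLp (f : ℝ × ℝ → ℝ≥0∞) :
    ∫⁻ P : Plane, f (WithLp.ofLp P) = ∫⁻ z, f z :=
  (WithLp.volume_preserving_ofLp ℝ ℝ).lintegral_comp_emb
    (MeasurableEquiv.toLp 2 (ℝ × ℝ)).symm.measurableEmbedding f

lemma lintegral_sq_le_flowEnergy (hb : 0 ≤ b) (V : ℝ × ℝ → ℂ) :
    ∫⁻ z, ‖V z‖ₑ ^ 2 ≤ flowEnergy b V := by
  refine lintegral_mono fun z => ?_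
  rw [mul_pow]
  refine le_mul_of_one_le_left' (one_le_pow₀ ?_)
  rw [ENNReal.one_le_ofReal]
  exact Real.one_le_rpow (one_le_bracket _) hb

lemma memLp_of_flowEnergy_lt_top (hb : 0 ≤ b) {V : ℝ × ℝ → ℂ} (hV : Measurable V)
    (hVe : flowEnergy b V < ⊤) : MemLp (fun P : Plane => V (WithLp.ofLp P)) 2 := by
  refine ⟨(hV.comp (by fun_prop)).aestronglyMeasurable, ?_⟩
  have h1 : eLpNorm (fun P : Plane => V (WithLp.ofLp P)) 2 volume ^ 2 < ⊤ := by
    rw [sq_eLpNorm_two, lintegral_comp_ofLp fun z => ‖V z‖ₑ ^ 2]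
    exact (lintegral_sq_le_flowEnergy hb V).trans_lt hVe
  exact (ENNReal.pow_lt_top_iff.mp h1).resolve_right (by norm_num)

/-- Plancherel's theorem in the normalisation of `inverseFourierLp`, with a rough constant. -/
lemma sq_edist_inverseFourierLp_le {V W : ℝ × ℝ → ℂ}
    (hV : MemLp (fun P : Plane => V (WithLp.ofLp P)) 2)
    (hW : MemLp (fun P : Plane => W (WithLp.ofLp P)) 2) :
    edist (inverseFourierLp hV) (inverseFourierLp hW) ^ 2 ≤ ∫⁻ z, ‖V z - W z‖ₑ ^ 2 := by
  have h1 : edist (inverseFourierLp hV) (inverseFourierLp hW) =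
      edist ((memLp_comp_smul two_pi_ne_zero' hV).toLp _)
        ((memLp_comp_smul two_pi_ne_zero' hW).toLp _) :=
    (Lp.fourierTransformₗᵢ Plane ℂ).symm.edist_map _ _
  rw [h1, Lp.edist_toLp_toLp, sq_eLpNorm_two]
  have he : MeasurableEmbedding fun k : Plane => (2 * Real.pi) • k :=
    (Homeomorph.smulOfNeZero (2 * Real.pi) two_pi_ne_zero').measurableEmbedding
  have h2 := he.lintegral_map (μ := volume)
    (fun P : Plane => ‖V (WithLp.ofLp P) - W (WithLp.ofLp P)‖ₑ ^ 2)
  rw [Measure.map_addHaar_smul _ two_pi_ne_zero', lintegral_smul_measure,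
    lintegral_comp_ofLp fun z => ‖V z - W z‖ₑ ^ 2] at h2
  refine h2.symm.le.trans ?_
  rw [smul_eq_mul]
  refine mul_le_of_le_one_left' ?_
  rw [ENNReal.ofReal_le_one, abs_of_pos (by positivity)]
  exact inv_le_one_of_one_le₀ (one_le_pow₀ (by linarith [Real.pi_gt_three]))

lemma sq_xNorm_inverseFourierLp {V : ℝ × ℝ → ℂ}
    (hV : MemLp (fun P : Plane => V (WithLp.ofLp P)) 2) (b : ℝ) :
    xNorm 0 b (inverseFourierLp hV : 𝓢'(Plane, ℂ)) ^ 2 = flowEnergy b V := by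
  rw [(hasFourierFunction_inverseFourierLp hV).xNorm_eq, sq_eLpNorm_two, flowEnergy,
    ← lintegral_comp_ofLp]
  refine lintegral_congr fun P => ?_
  rw [Real.rpow_zero, one_mul, enorm_mul, ← ofReal_norm (_ : ℂ), Complex.norm_real,
    Real.norm_of_nonneg (Real.rpow_nonneg (bracket_pos _).le _)]
  rfl

lemma dataEnergy_indicator_le (r : ℝ) (S : Set ℝ) (p : ℝ → ℂ) :
    dataEnergy r (S.indicator p) ≤ dataEnergy r p := by
  refine lintegral_mono fun β => ?_
  gcongr
  exact enorm_indicator_le_enorm_self _ _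

lemma tendsto_dataEnergy_indicator_Ioi (hp : Measurable p) (hpe : dataEnergy r p < ⊤) :
    Tendsto (fun R : ℝ => dataEnergy r ((Ioi R).indicator p)) atTop (𝓝 0) := by
  have h0 : (0 : ℝ≥0∞) = ∫⁻ _ : ℝ, 0 := by simp
  rw [h0]
  refine tendsto_lintegral_filter_of_dominated_convergence
    (fun β : ℝ => (ENNReal.ofReal (japanese (r * β)) * ‖p β‖ₑ) ^ 2) ?_ ?_ hpe.ne ?_
  · refine Eventually.of_forall fun R => ?_
    have := hp.indicator (measurableSet_Ioi (a := R))
    fun_prop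
  · refine Eventually.of_forall fun R => Eventually.of_forall fun β => ?_
    gcongr
    exact enorm_indicator_le_enorm_self _ _
  · refine Eventually.of_forall fun β => ?_
    refine tendsto_const_nhds.congr' ?_
    filter_upwards [eventually_ge_atTop β] with R hR
    simp [not_lt.mpr hR]

lemma integrable_mul_indicator_of_dataEnergy (hr : 0 < r) (hp : Measurable p)
    (hpe : dataEnergy r p < ⊤) (R : ℝ) :
    Integrable fun β : ℝ => (β : ℂ) * (Ioc 0 R).indicator p β := by
  have h1 : MemLp (fun β : ℝ => (β : ℂ) * p β) 2 := by
    refine ⟨by fun_prop, ?_⟩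
    have h2 : eLpNorm (fun β : ℝ => (β : ℂ) * p β) 2 volume ^ 2 ≤
        ENNReal.ofReal (r⁻¹ ^ 2) * dataEnergy r p := by
      rw [sq_eLpNorm_two, dataEnergy, ← lintegral_const_mul' _ _ (by simp)]
      refine lintegral_mono fun β => ?_
      rw [enorm_mul, ENNReal.ofReal_pow (by positivity), ← mul_pow, ← mul_assoc,
        ← ENNReal.ofReal_mul (by positivity), ← ofReal_norm (β : ℂ), Complex.norm_real,
        Real.norm_eq_abs]
      gcongr
      unfold japanese
      rw [abs_mul, abs_of_pos hr, mul_add, inv_mul_cancel_left₀ hr.ne']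
      linarith [inv_pos.mpr hr]
    have h3 : eLpNorm (fun β : ℝ => (β : ℂ) * p β) 2 volume ^ 2 < ⊤ :=
      h2.trans_lt (ENNReal.mul_lt_top (by simp) hpe)
    exact (ENNReal.pow_lt_top_iff.mp h3).resolve_right (by norm_num)
  have h4 : IntegrableOn (fun β : ℝ => (β : ℂ) * p β) (Ioc 0 R) :=
    (h1.restrict _).integrable (by norm_num)
  refine (h4.integrable_indicator measurableSet_Ioc).congr (Eventually.of_forall fun β => ?_)
  by_cases hβ : β ∈ Ioc 0 R <;> simp [hβ]

end

/-! ### Convergence of the boundary flow -/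

section

variable {η ρ : ℝ → ℝ} {n h κ k : ℝ → ℂ} {K K' b T T₀ r : ℝ} {g : ℝ → ℂ}

/-- The boundary flow with frequencies `β ≤ R` is the inverse Fourier transform of `flowFourier`
for the truncated data. -/
lemma inverseFourierLp_ae_eq_boundaryFlowPartial (hn : IsSymbol n h K) (hκ : IsSymbol κ k K')
    (hh : ∀ t, h t = (η t : ℂ)) (hk : ∀ y, k y = ((Real.exp (-y) * ρ y : ℝ) : ℂ)) (hr : 0 < r)
    (hP : Measurable fun β : ℝ => boundaryFourier g (-β ^ 2))
    (hPe : dataEnergy r (fun β : ℝ => boundaryFourier g (-β ^ 2)) < ⊤)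
    (hM : Measurable fun β : ℝ => boundaryFourier g (β ^ 2))
    (hMe : dataEnergy r (fun β : ℝ => boundaryFourier g (β ^ 2)) < ⊤) {R : ℝ} (hR : 0 ≤ R)
    (hV : MemLp (fun k : Plane => flowFourier n κ (r ^ 2)
      ((Ioc 0 R).indicator fun β : ℝ => boundaryFourier g (-β ^ 2))
      ((Ioc 0 R).indicator fun β : ℝ => boundaryFourier g (β ^ 2)) (WithLp.ofLp k)) 2) :
    (inverseFourierLp hV : Plane → ℂ) =ᵐ[volume] fun P : Plane =>
      (η (P.snd / r ^ 2) : ℂ) * boundaryFlowPartial ρ g R P.fst P.snd := by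
  have hr2 : 0 < r ^ 2 := by positivity
  have hPi := integrable_mul_indicator_of_dataEnergy hr hP hPe R
  have hMi := integrable_mul_indicator_of_dataEnergy hr hM hMe R
  have hPm := hP.indicator (measurableSet_Ioc (a := 0) (b := R))
  have hMm := hM.indicator (measurableSet_Ioc (a := 0) (b := R))
  have hwi := integrable_waveFourier hn hr2 hPm hPi
  have hei := integrable_evanescentFourier hn hκ hr2 hMm hMi
  have hVi : Integrable fun k : Plane => flowFourier n κ (r ^ 2)
      ((Ioc 0 R).indicator fun β : ℝ => boundaryFourier g (-β ^ 2))
      ((Ioc 0 R).indicator fun β : ℝ => boundaryFourier g (β ^ 2)) (WithLp.ofLp k) :=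
    ((WithLp.volume_preserving_ofLp ℝ ℝ).integrable_comp_emb
      (MeasurableEquiv.toLp 2 (ℝ × ℝ)).symm.measurableEmbedding).mpr (hwi.add hei)
  refine (fourierInv_toLp_ae_eq (hVi.comp_smul two_pi_ne_zero')
    (memLp_comp_smul two_pi_ne_zero' hV)).trans (Eventually.of_forall fun P => ?_)
  have hb : ∀ W : ℝ × ℝ → ℂ, Integrable W → Integrable fun z => wave P.fst P.snd z * W z :=
    fun W hW => hW.bdd_mul (continuous_wave _ _).aestronglyMeasurable
      (Eventually.of_forall fun z => (norm_wave P.fst P.snd z).le)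
  have hm0 : ∀ β ≤ 0, (Ioc 0 R).indicator (fun β : ℝ => boundaryFourier g (β ^ 2)) β = 0 :=
    fun β hβ => indicator_of_notMem (fun h => absurd h.1 (not_lt.mpr hβ)) _
  have hind : ∀ (G F : ℝ → ℂ), ∫ β, G β * ((β : ℂ) * (Ioc 0 R).indicator F β) =
      ∫ β in (0 : ℝ)..R, G β * ((β : ℂ) * F β) := by
    intro G F
    rw [intervalIntegral.integral_of_le hR, ← integral_indicator measurableSet_Ioc]
    refine integral_congr_ae (Eventually.of_forall fun β => ?_)
    by_cases hβ : β ∈ Ioc 0 R <;> simp [hβ]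
  simp only
  rw [fourierInv_comp_smul]
  simp only [flowFourier, mul_add]
  rw [integral_add (hb _ hwi) (hb _ hei), integral_wave_mul_waveFourier hn hr2 hPm hPi,
    integral_wave_mul_evanescentFourier hn hκ hr2 hMm hMi hm0, hh, hind, hind,
    boundaryFlowPartial]
  simp_rw [hk]
  have hpi : (Real.pi : ℂ) ≠ 0 := by exact_mod_cast Real.pi_ne_zero
  field_simp

/-- Limits in `L²` are unique. Measurability of the approximants has to be assumed, as `eLpNorm`
obeys the triangle inequality only for measurable functions. -/
lemma IsTruncatedBoundaryFlow.unique {u u' : Lp ℂ 2 (volume : Measure Plane)}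
    (hA : ∀ R : ℝ, 0 ≤ R → AEStronglyMeasurable (fun P : Plane =>
      (η (P.snd / T) : ℂ) * boundaryFlowPartial ρ g R P.fst P.snd) volume)
    (hu : IsTruncatedBoundaryFlow η ρ T g u) (hu' : IsTruncatedBoundaryFlow η ρ T g u') :
    u = u' := by
  have h1 := hu.add hu'
  rw [add_zero] at h1
  have h2 : edist u u' ≤ 0 := by
    refine ge_of_tendsto h1 ?_
    filter_upwards [eventually_ge_atTop 0] with R hR
    rw [Lp.edist_def]
    refine le_trans (le_of_eq ?_) (eLpNorm_sub_le ((Lp.aestronglyMeasurable u).sub (hA R hR))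
      ((Lp.aestronglyMeasurable u').sub (hA R hR)) one_le_two)
    congr 1
    ext P
    simp
  exact edist_le_zero.mp h2

/-- The truncated boundary flow exists, is unique, and is bounded in `X^{0,b}` by the boundary
data. -/
lemma exists_isTruncatedBoundaryFlow (hb : 0 ≤ b) (hb2 : b < 1 / 2) (hn : IsSymbol n h K)
    (hK : 0 ≤ K) (hκ : IsSymbol κ k K') (hK' : 0 ≤ K')
    (hh : ∀ t, h t = (η t : ℂ)) (hk : ∀ y, k y = ((Real.exp (-y) * ρ y : ℝ) : ℂ))
    (hr : 0 < r) (hrT : r ^ 2 ≤ T₀)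
    (hP : Measurable fun β : ℝ => boundaryFourier g (-β ^ 2))
    (hPe : dataEnergy r (fun β : ℝ => boundaryFourier g (-β ^ 2)) < ⊤)
    (hM : Measurable fun β : ℝ => boundaryFourier g (β ^ 2))
    (hMe : dataEnergy r (fun β : ℝ => boundaryFourier g (β ^ 2)) < ⊤) :
    ∃ u : Lp ℂ 2 (volume : Measure Plane), IsTruncatedBoundaryFlow η ρ (r ^ 2) g u ∧
      (∀ u' : Lp ℂ 2 (volume : Measure Plane),
        IsTruncatedBoundaryFlow η ρ (r ^ 2) g u' → u' = u) ∧
      xNorm 0 b (u : 𝓢'(Plane, ℂ)) ^ 2 ≤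
        2 * (flowConstant b T₀ K K' * ENNReal.ofReal ((r ^ 2) ^ (-(2 * b)))) *
          (dataEnergy r (fun β : ℝ => boundaryFourier g (-β ^ 2)) +
            dataEnergy r (fun β : ℝ => boundaryFourier g (β ^ 2))) := by
  set P : ℝ → ℂ := fun β => boundaryFourier g (-β ^ 2) with hPdef
  set M : ℝ → ℂ := fun β => boundaryFourier g (β ^ 2) with hMdef
  have hbound : ∀ S : Set ℝ, MeasurableSet S →
      flowEnergy b (flowFourier n κ (r ^ 2) (S.indicator P) (S.indicator M)) ≤
        2 * (flowConstant b T₀ K K' * ENNReal.ofReal ((r ^ 2) ^ (-(2 * b)))) *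
          (dataEnergy r (S.indicator P) + dataEnergy r (S.indicator M)) := fun S hS =>
    flowEnergy_flowFourier_le hb hb2 hn hK hκ hK' hr hrT (hP.indicator hS) (hM.indicator hS)
  have hC : 2 * (flowConstant b T₀ K K' * ENNReal.ofReal ((r ^ 2) ^ (-(2 * b)))) < ⊤ := by
    have : flowConstant b T₀ K K' < ⊤ := flowConstant_lt_top
    finiteness
  have hPS : ∀ S : Set ℝ, dataEnergy r (S.indicator P) < ⊤ := fun S =>
    (dataEnergy_indicator_le r S P).trans_lt hPe
  have hMS : ∀ S : Set ℝ, dataEnergy r (S.indicator M) < ⊤ := fun S =>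
    (dataEnergy_indicator_le r S M).trans_lt hMe
  have hmem : ∀ S : Set ℝ, MeasurableSet S → MemLp (fun k : Plane =>
      flowFourier n κ (r ^ 2) (S.indicator P) (S.indicator M) (WithLp.ofLp k)) 2 := fun S hS =>
    memLp_of_flowEnergy_lt_top hb
      (measurable_flowFourier hn.continuous hκ.continuous _ (hP.indicator hS) (hM.indicator hS))
      ((hbound S hS).trans_lt (ENNReal.mul_lt_top hC (ENNReal.add_lt_top.mpr ⟨hPS S, hMS S⟩)))
  have happrox : ∀ R : ℝ, 0 ≤ R →
      (inverseFourierLp (hmem (Ioc 0 R) measurableSet_Ioc) : Plane → ℂ) =ᵐ[volume] fun p : Plane =>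
        (η (p.snd / r ^ 2) : ℂ) * boundaryFlowPartial ρ g R p.fst p.snd := fun R hR =>
    inverseFourierLp_ae_eq_boundaryFlowPartial hn hκ hh hk hr hP hPe hM hMe hR _
  have hflow : IsTruncatedBoundaryFlow η ρ (r ^ 2) g
      (inverseFourierLp (hmem (Ioi 0) measurableSet_Ioi)) := by
    refine tendsto_zero_of_sq ?_
    have htail : Tendsto (fun R : ℝ =>
        2 * (flowConstant b T₀ K K' * ENNReal.ofReal ((r ^ 2) ^ (-(2 * b)))) *
          (dataEnergy r ((Ioi R).indicator P) + dataEnergy r ((Ioi R).indicator M)))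
        atTop (𝓝 0) := by
      have h1 := ENNReal.Tendsto.const_mul
        (a := 2 * (flowConstant b T₀ K K' * ENNReal.ofReal ((r ^ 2) ^ (-(2 * b)))))
        ((tendsto_dataEnergy_indicator_Ioi hP hPe).add (tendsto_dataEnergy_indicator_Ioi hM hMe))
        (Or.inr hC.ne)
      simpa using h1
    refine tendsto_of_tendsto_of_tendsto_of_le_of_le' tendsto_const_nhds htail
      (Eventually.of_forall fun _ => zero_le) ?_
    filter_upwards [eventually_ge_atTop 0] with R hR
    have h1 : eLpNorm (fun p : Plane => inverseFourierLp (hmem (Ioi 0) measurableSet_Ioi) p -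
        (η (p.snd / r ^ 2) : ℂ) * boundaryFlowPartial ρ g R p.fst p.snd) 2 volume =
        edist (inverseFourierLp (hmem (Ioi 0) measurableSet_Ioi))
          (inverseFourierLp (hmem (Ioc 0 R) measurableSet_Ioc)) := by
      rw [Lp.edist_def]
      refine eLpNorm_congr_ae ?_
      filter_upwards [happrox R hR] with p hp
      rw [Pi.sub_apply, hp]
    have hind : ∀ F : ℝ → ℂ,
        (Ioi 0).indicator F - (Ioc 0 R).indicator F = (Ioi R).indicator F := by
      intro F
      ext β
      rcases le_or_gt β 0 with h | h
      · simp [not_lt.mpr h, not_lt.mpr (h.trans hR)]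
      · rcases le_or_gt β R with h' | h'
        · simp [h, h', not_lt.mpr h']
        · simp [h, h', not_le.mpr h']
    have h2 := flowFourier_sub_ae_eq (p := (Ioi 0).indicator P) (p' := (Ioc 0 R).indicator P)
      hn hK hκ hK' hr (hM.indicator measurableSet_Ioi) (hMS (Ioi 0))
      (hM.indicator measurableSet_Ioc) (hMS (Ioc 0 R))
    rw [hind, hind] at h2
    rw [h1]
    refine (sq_edist_inverseFourierLp_le _ _).trans ?_
    refine (lintegral_sq_le_flowEnergy hb _).trans ?_
    rw [flowEnergy_congr h2]
    exact hbound (Ioi R) measurableSet_Ioi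
  refine ⟨_, hflow, fun u' hu' => hu'.unique (fun R hR =>
    (Lp.aestronglyMeasurable _).congr (happrox R hR)) hflow, ?_⟩
  rw [sq_xNorm_inverseFourierLp]
  refine (hbound _ measurableSet_Ioi).trans ?_
  gcongr <;> exact dataEnergy_indicator_le _ _ _

end

/-! ### The boundary flow of the Duhamel trace -/

section

variable {η ρ : ℝ → ℝ} {b T₀ r : ℝ}

/-- The two formulations of the norm of the forcing term agree: on `Plane` and on `ℝ × ℝ`. -/
lemma sq_xNorm_eq_amplitudeEnergy {F : 𝓢'(Plane, ℂ)} {f : Plane → ℂ}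
    (hf : HasFourierFunction F f) (b : ℝ) :
    xNorm 0 (-b) F ^ 2 = amplitudeEnergy b fun z => f (WithLp.toLp 2 z) := by
  rw [hf.xNorm_eq, sq_eLpNorm_two, amplitudeEnergy, ← lintegral_comp_ofLp]
  refine lintegral_congr fun P => ?_
  rw [Real.rpow_zero, one_mul, enorm_mul, ← ofReal_norm (_ : ℂ), Complex.norm_real,
    Real.norm_of_nonneg (Real.rpow_nonneg (bracket_pos _).le _)]
  rfl

lemma continuous_boundaryFourier {T : ℝ} {g : ℝ → ℂ} (hT : 0 < T) (hg : MemLp g 2)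
    (hg0 : ∀ᵐ t, 2 * T < |t| → g t = 0) : Continuous (boundaryFourier g) := by
  have h1 : IntegrableOn g (Ioc 0 (T * 2)) := (hg.restrict _).integrable (by norm_num)
  have h2 : boundaryFourier g = fun τ => ∫ t in Ioc (0 : ℝ) (T * 2), g t * osc τ t := by
    ext τ
    rw [boundaryFourier_eq hT hg0, intervalIntegral.integral_of_le (by positivity)]
  rw [h2]
  refine continuous_of_dominated (bound := fun t => ‖g t‖) (fun τ => ?_) (fun τ => ?_) h1.norm ?_
  · exact h1.aestronglyMeasurable.mul (continuous_osc τ).aestronglyMeasurable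
  · exact Eventually.of_forall fun t => by rw [norm_mul, norm_osc, mul_one]
  · refine Eventually.of_forall fun t => continuous_const.mul ?_
    unfold osc
    fun_prop

/-- The estimate in squared form, with `T = r²`. -/
lemma exists_sq_xNorm_boundaryFlow_le (hη : ContDiff ℝ ∞ η) (hη_supp : tsupport η ⊆ Icc (-2 : ℝ) 2)
    (hρ : ContDiff ℝ ∞ ρ) (hρ_one : ∀ y : ℝ, 0 ≤ y → ρ y = 1)
    (hρ_supp : BddBelow (Function.support ρ)) (hb : 0 ≤ b) (hb2 : b < 1 / 2) (T₀ : ℝ) :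
    ∃ C : ℝ≥0∞, C < ⊤ ∧ ∀ r : ℝ, 0 < r → r ^ 2 ≤ T₀ → ∀ F : 𝓢'(Plane, ℂ), xNorm 0 (-b) F < ⊤ →
      ∀ w : ℝ → Lp ℂ 2 (volume : Measure ℝ), IsTruncatedDuhamel η (r ^ 2) F w →
        ∃ u : Lp ℂ 2 (volume : Measure Plane), IsTruncatedBoundaryFlow η ρ (r ^ 2) (w 0) u ∧
          (∀ u' : Lp ℂ 2 (volume : Measure Plane),
            IsTruncatedBoundaryFlow η ρ (r ^ 2) (w 0) u' → u' = u) ∧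
          xNorm 0 b (u : 𝓢'(Plane, ℂ)) ^ 2 ≤
            C * ENNReal.ofReal ((r ^ 2) ^ (1 - 2 * b)) ^ 2 * xNorm 0 (-b) F ^ 2 := by
  have hηc : HasCompactSupport η := isCompact_Icc.of_isClosed_subset (isClosed_tsupport η) hη_supp
  have h1 : HasCompactSupport (Complex.ofRealCLM ∘ η) := hηc.comp_left rfl
  have h2 : ContDiff ℝ ∞ (Complex.ofRealCLM ∘ η) := Complex.ofRealCLM.contDiff.comp hη
  obtain ⟨n, K, hK, hn⟩ := exists_isSymbol (h1.toSchwartzMap h2)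
  obtain ⟨φ, hφ⟩ := exists_schwartz_exp_neg_mul hρ hρ_one hρ_supp
  obtain ⟨κ, K', hK', hκ⟩ := exists_isSymbol φ
  obtain ⟨C, hC, hCv⟩ := exists_dataEnergy_boundaryFourier_le hη hη_supp hb hb2 T₀
  have hfc : flowConstant b T₀ K K' < ⊤ := flowConstant_lt_top
  refine ⟨2 * flowConstant b T₀ K K' * (2 * C), by finiteness, ?_⟩
  rintro r hr hrT F hF w ⟨f, hf, hw⟩
  have hr2 : 0 < r ^ 2 := by positivity
  have hE := sq_xNorm_eq_amplitudeEnergy hf b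
  have hfe : amplitudeEnergy b (fun z => f (WithLp.toLp 2 z)) < ⊤ := by
    rw [← hE]; finiteness
  obtain ⟨hw0, hbd⟩ := hCv r hr hrT f hf.aestronglyMeasurable hfe (w 0) (hw 0)
  have hcont := continuous_boundaryFourier hr2 (Lp.memLp (w 0)) hw0
  have hminus := hbd (-1) (by norm_num)
  have hplus := hbd 1 (by norm_num)
  simp only [neg_one_mul] at hminus
  simp only [one_mul] at hplus
  obtain ⟨u, hu, huniq, hle⟩ := exists_isTruncatedBoundaryFlow (η := η) (ρ := ρ) (T₀ := T₀)
    (g := w 0) hb hb2 hn hK hκ hK' (fun _ => rfl) hφ hr hrT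
    (hcont.comp (by fun_prop : Continuous fun β : ℝ => -β ^ 2)).measurable
    (hminus.trans_lt (by finiteness))
    (hcont.comp (by fun_prop : Continuous fun β : ℝ => β ^ 2)).measurable
    (hplus.trans_lt (by finiteness))
  refine ⟨u, hu, huniq, hle.trans ?_⟩
  have hpow : ENNReal.ofReal ((r ^ 2) ^ (-(2 * b))) * ENNReal.ofReal ((r ^ 2) ^ (2 - 2 * b)) =
      ENNReal.ofReal ((r ^ 2) ^ (1 - 2 * b)) ^ 2 := by
    rw [← ENNReal.ofReal_mul (by positivity), ← ENNReal.ofReal_pow (by positivity),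
      ← Real.rpow_add hr2, sq ((r ^ 2) ^ (1 - 2 * b)), ← Real.rpow_add hr2]
    congr 2
    ring
  rw [hE, ← hpow]
  calc _ ≤ 2 * (flowConstant b T₀ K K' * ENNReal.ofReal ((r ^ 2) ^ (-(2 * b)))) *
        (C * ENNReal.ofReal ((r ^ 2) ^ (2 - 2 * b)) *
          amplitudeEnergy b (fun z => f (WithLp.toLp 2 z)) +
        C * ENNReal.ofReal ((r ^ 2) ^ (2 - 2 * b)) *
          amplitudeEnergy b (fun z => f (WithLp.toLp 2 z))) := by gcongr
    _ = _ := by ring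

end

end SchrodingerHalfLine

end

theorem mainTheorem6
    (η : ℝ → ℝ) (hη : ContDiff ℝ ∞ η) (hη_one : ∀ t ∈ Icc (-1 : ℝ) 1, η t = 1)
    (hη_supp : tsupport η ⊆ Icc (-2 : ℝ) 2)
    (ρ : ℝ → ℝ) (hρ : ContDiff ℝ ∞ ρ) (hρ_one : ∀ y : ℝ, 0 ≤ y → ρ y = 1)
    (hρ_supp : BddBelow (Function.support ρ))
    (b : ℝ) (hb_nonneg : 0 ≤ b) (hb_lt : b < 1 / 2) (T₀ : ℝ) (hT₀ : 0 < T₀) :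
    ∃ C : ℝ, 0 < C ∧ ∀ T : ℝ, 0 < T → T ≤ T₀ →
      ∀ F : 𝓢'(Plane, ℂ), xNorm 0 (-b) F < ⊤ →
        (∃ w : ℝ → Lp ℂ 2 (volume : Measure ℝ), IsTruncatedDuhamel η T F w) ∧
        ∀ w : ℝ → Lp ℂ 2 (volume : Measure ℝ), IsTruncatedDuhamel η T F w →
          (∃ u : Lp ℂ 2 (volume : Measure Plane), IsTruncatedBoundaryFlow η ρ T (w 0) u) ∧
          ∀ u : Lp ℂ 2 (volume : Measure Plane), IsTruncatedBoundaryFlow η ρ T (w 0) u →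
            xNorm 0 b (u : 𝓢'(Plane, ℂ)) ≤
              ENNReal.ofReal (C * T ^ (1 - 2 * b)) * xNorm 0 (-b) F := by
  obtain ⟨C, hC, hCv⟩ := exists_sq_xNorm_boundaryFlow_le hη hη_supp hρ hρ_one hρ_supp hb_nonneg
    hb_lt T₀
  refine ⟨Real.sqrt C.toReal + 1, by positivity, fun T hT hTT F hF => ⟨?_, fun w hw => ?_⟩⟩
  · obtain ⟨f, hf⟩ := exists_hasFourierFunction_of_xNorm_lt_top hF
    refine exists_isTruncatedDuhamel hη hη_supp hb_nonneg hb_lt hT hf ?_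
    rw [← sq_xNorm_eq_amplitudeEnergy hf b]
    finiteness
  · have hr : 0 < Real.sqrt T := Real.sqrt_pos.mpr hT
    have hrT : Real.sqrt T ^ 2 = T := Real.sq_sqrt hT.le
    have h1 := hCv (Real.sqrt T) hr (by rwa [hrT]) F hF w (by rwa [hrT])
    rw [hrT] at h1
    obtain ⟨u, hu, huniq, hle⟩ := h1
    refine ⟨⟨u, hu⟩, fun u' hu' => ?_⟩
    rw [huniq u' hu', ← ENNReal.pow_le_pow_left_iff two_ne_zero]
    refine hle.trans ?_
    rw [mul_pow, ENNReal.ofReal_mul (by positivity), mul_pow]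
    gcongr
    rw [← ENNReal.ofReal_pow (by positivity)]
    refine ENNReal.le_ofReal_iff_toReal_le hC.ne (by positivity) |>.mpr ?_
    nlinarith [Real.sq_sqrt (ENNReal.toReal_nonneg (a := C)), Real.sqrt_nonneg C.toReal]
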